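/- **Theorem 2.2.** Let $\varphi_0=1$, $\varphi_j(x)=\sqrt2\cos(\pi jx)$ for $j\ge1$, and let $\alpha\ge1$, $Q>0$, $D\ge 0$. Let $(X_l,\mathbf Z_l,Y_l)$, $l=1,\dots,n$, be independent observations, where $(X,\mathbf Z)$ has a density $p$ supported on $[0,1]^{1+D}$ and, given $(X,\mathbf Z)=(x,\mathbf z)$, the response $Y$ is, with mean $f(x)+g(\mathbf z)$, * Bernoulli (variance $\sigma^2_{fg}(x,\mathbf z)=[f(x)+g(\mathbf z)][1-f(x)-g(\mathbf z)]$), or * Poisson (variance $\sigma^2_{fg}(x,\mathbf z)=f(x)+g(\mathbf z)$). Here $g$ is measurable with $\int_{[0,1]^D}g=0$. Let $\mathcal F^*(g)$ be the class of bona fide $f$: those with $0\le f(x)+g(\mathbf z)\le1$ (Bernoulli), respectively $f(x)+g(\mathbf z)>0$ (Poisson), on $[0,1]^{1+D}$. Let $f_0$ (the pivot) be a bounded measurable function on $[0,1]$, and for $M\in\{0,1,\dots\}$ put $S_Mf_0=\sum_{j<M}\big(\int_0^1f_0\varphi_j\big)\varphi_j$. For $0<\rho\le\infty$ let $\mathcal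 F(f_0,\rho,M,\alpha,Q)$ be the set of all functions $f$ on $[0,1]$ such that, with $\theta_j=\int_0^1f\varphi_j$, $$f=S_Mf_0+\sum_{j\ge M}\theta_j\varphi_j,\qquad \sum_{j\ge M}\big[1+(\pi j)^{2\alpha}\big]\theta_j^2\le Q,\qquad \sup_{x\in[0,1]}\Big|\sum_{j\ge M}\theta_j\varphi_j(x)\Big|<\rho .$$ Assume: 1. $|\ln p|$ and $|\ln\sigma_{f_0g}|$ are bounded on $[0,1]^{1+D}$, and $x\mapsto\int_{[0,1]^D}p(x,\mathbf z)\sigma_{f_0g}^{-2}(x,\mathbf z)\,d\mathbf z$ is Riemann integrable on $[0,1]$. 2. For some constants $C_*>0$ and $C^*<1$, $C_*\le f_0(x)+g(\mathbf z)$ on $[0,1]^{1+D}$, and in the Bernoulli case also $f_0(x)+g(\mathbf z)\le C^*$. 3. $M_n\to\infty$, and for all large $n$, $M_n<n^{1/(2\alpha+1)}/\ln^2 n$ and $\rho_n>n^{-1/(2\alpha+1)}\ln n$ (with $\rho_n=\infty$ allowed). 4. For some constants $c>0$ and $c'<1$ and all large $n$, $c\le S_{M_n}f_0(x)+g(\mathbf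 z)$ on $[0,1]^{1+D}$, and in the Bernoulli case also $S_{M_n}f_0(x)+g(\mathbf z)\le c'$. (Given 2 and $M_n\to\infty$, this holds for instance if the cosine series of $f_0$ converges to $f_0$ uniformly on $[0,1]$.) Then, for both regressions, $$\inf_{\tilde f}\ \sup_{f\in\mathcal F(f_0,\rho_n,M_n,\alpha,Q)\cap\mathcal F^*(g)}E\Big\{\int_0^1[\tilde f(x)-f(x)]^2dx\Big\}\ \ge\ P(\alpha,Q)\left[\int_0^1\frac{dx}{\int_{[0,1]^D}p(x,\mathbf z)\sigma_{f_0g}^{-2}(x,\mathbf z)\,d\mathbf z}\;n^{-1}\right]^{2\alpha/(2\alpha+1)}(1+o_n(1)),$$ where $o_n(1)\to 0$ as $n\to\infty$, $P(\alpha,Q)=\big[\tfrac{\alpha}{\pi(\alpha+1)}\big]^{2\alpha/(2\alpha+1)}[Q(2\alpha+1)]^{1/(2\alpha+1)}$, and the infimum is over all (jointly measurable) estimators $\tilde f$ based on the sample, which may depend on $f_0,g,p,\alpha,Q$, $(\rho_n)$ and $(M_n)$. -/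

import Mathlib

open MeasureTheory Set Filter Topology
open scoped ENNReal Nat

noncomputable section

namespace SharpMinimax

/-! ### Cosine basis and the function family -/

/-- The cosine basis of `L²[0,1]`: `φ₀ = 1`, `φ_j(x) = √2 cos(π j x)` for `j ≥ 1`. -/
def cosBasis (j : ℕ) (x : ℝ) : ℝ :=
  if j = 0 then 1 else √2 * Real.cos (Real.pi * j * x)

/-- The `j`-th Fourier coefficient `∫₀¹ f(u) φ_j(u) du`. -/
def cosCoeff (f : ℝ → ℝ) (j : ℕ) : ℝ :=
  ∫ u in (0 : ℝ)..1, f u * cosBasis j u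

/-- The part of `f` on the `M` lowest frequencies (it is `0` for `M = 0`). -/
def lowFreq (f : ℝ → ℝ) (M : ℕ) (x : ℝ) : ℝ :=
  ∑ j ∈ Finset.range M, cosCoeff f j * cosBasis j x

/-- The family `𝓕(f₀, ρ, M, α, Q)` for one sample size: functions that coincide with the pivot `f₀`
on the first `M` frequencies, and whose remaining part `∑_{j ≥ M} θ_j φ_j` lies in a Sobolev
ellipsoid and has supremum norm on `[0,1]` below `ρ` (the value `ρ = ∞` is allowed). -/
def family (f₀ : ℝ → ℝ) (ρ : ℝ≥0∞) (M : ℕ) (α Q : ℝ) : Set (ℝ → ℝ) :=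
  {f | (∀ x ∈ Icc (0 : ℝ) 1,
          HasSum (fun j : ℕ => if M ≤ j then cosCoeff f j * cosBasis j x else 0)
            (f x - lowFreq f₀ M x)) ∧
       Summable (fun j : ℕ =>
          if M ≤ j then (1 + (Real.pi * j) ^ (2 * α)) * cosCoeff f j ^ 2 else 0) ∧
       (∑' j : ℕ, if M ≤ j then (1 + (Real.pi * j) ^ (2 * α)) * cosCoeff f j ^ 2 else 0) ≤ Q ∧
       (⨆ x ∈ Icc (0 : ℝ) 1, ENNReal.ofReal |f x - lowFreq f₀ M x|) < ρ}

/-! ### The two regression models -/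

/-- The two discrete regression models. -/
inductive Model
  | bernoulli
  | poisson

/-- Probability that the response equals `y` when the conditional mean of the response is `t`. -/
def Model.pmf : Model → ℝ → ℕ → ℝ
  | .bernoulli, t, y => if y = 0 then 1 - t else if y = 1 then t else 0
  | .poisson, t, y => Real.exp (-t) * t ^ y / (y ! : ℝ)

/-- Conditional variance of the response when its conditional mean is `t`, so that
`σ²_{fg}(x,z) = m.variance (f x + g z)`. -/
def Model.variance : Model → ℝ → ℝ
  | .bernoulli, t => t * (1 - t)
  | .poisson, t => t

/-- `t` is an admissible conditional mean: in `[0,1]` (Bernoulli), positive (Poisson). -/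
def Model.IsMean : Model → ℝ → Prop
  | .bernoulli, t => 0 ≤ t ∧ t ≤ 1
  | .poisson, t => 0 < t

/-- `f(x) + g(z)` is at least `c` on `[0,1]^{1+D}` and, in the Bernoulli case only,
at most `c'` there. -/
def Model.MeanBounds {D : ℕ} (m : Model) (c c' : ℝ) (f : ℝ → ℝ) (g : (Fin D → ℝ) → ℝ) : Prop :=
  ∀ x ∈ Icc (0 : ℝ) 1, ∀ z ∈ Icc (0 : Fin D → ℝ) 1,
    c ≤ f x + g z ∧ (m = .bernoulli → f x + g z ≤ c')

/-- The class `𝓕*(g)` of bona fide regression functions. -/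
def Model.bonaFide {D : ℕ} (m : Model) (g : (Fin D → ℝ) → ℝ) : Set (ℝ → ℝ) :=
  {f | ∀ x ∈ Icc (0 : ℝ) 1, ∀ z ∈ Icc (0 : Fin D → ℝ) 1, m.IsMean (f x + g z)}

/-- Values of one observation `((X, Z), Y)`. -/
abbrev Obs (D : ℕ) : Type := (ℝ × (Fin D → ℝ)) × ℕ

/-- Law of one observation: `(X, Z)` has density `p`, and given `(X, Z) = (x, z)` the response has
the Bernoulli, respectively Poisson, distribution with mean `f(x) + g(z)`. It is given by its joint
density with respect to Lebesgue measure times counting measure. -/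
def Model.obsLaw {D : ℕ} (m : Model) (p : ℝ × (Fin D → ℝ) → ℝ) (g : (Fin D → ℝ) → ℝ)
    (f : ℝ → ℝ) : Measure (Obs D) :=
  ((volume : Measure (ℝ × (Fin D → ℝ))).prod (Measure.count : Measure ℕ)).withDensity
    fun o => ENNReal.ofReal (p o.1) * ENNReal.ofReal (m.pmf (f o.1.1 + g o.1.2) o.2)

/-- Law of a sample of `n` independent observations. -/
def Model.sampleLaw {D : ℕ} (m : Model) (p : ℝ × (Fin D → ℝ) → ℝ) (g : (Fin D → ℝ) → ℝ)
    (f : ℝ → ℝ) (n : ℕ) : Measure (Fin n → Obs D) :=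
  Measure.pi fun _ => m.obsLaw p g f

/-- Mean integrated squared error `E ∫₀¹ (T(x) - f(x))² dx` (possibly infinite) of an estimator. -/
def Model.mise {D : ℕ} (m : Model) (p : ℝ × (Fin D → ℝ) → ℝ) (g : (Fin D → ℝ) → ℝ)
    {n : ℕ} (T : (Fin n → Obs D) → ℝ → ℝ) (f : ℝ → ℝ) : ℝ≥0∞ :=
  ∫⁻ s, (∫⁻ x in Icc (0 : ℝ) 1, ENNReal.ofReal ((T s x - f x) ^ 2)) ∂(m.sampleLaw p g f n)

/-- The minimax MISE over a class `C` of regression functions for sample size `n`. The infimum is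
over all (measurable) estimators. An estimator here may depend on everything fixed beforehand
(`p`, `g`, the class), but on the estimated function only through the sample. -/
def Model.minimaxMISE {D : ℕ} (m : Model) (p : ℝ × (Fin D → ℝ) → ℝ) (g : (Fin D → ℝ) → ℝ)
    (C : Set (ℝ → ℝ)) (n : ℕ) : ℝ≥0∞ :=
  ⨅ (T : (Fin n → Obs D) → ℝ → ℝ) (_ : Measurable (Function.uncurry T)),
    ⨆ f ∈ C, m.mise p g T f

/-! ### The constants -/

/-- The Pinsker constant. -/
def pinsker (α Q : ℝ) : ℝ :=
  (α / (Real.pi * (α + 1))) ^ (2 * α / (2 * α + 1)) * (Q * (2 * α + 1)) ^ (1 / (2 * α + 1))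

/-- `𝓘(x) = ∫_{[0,1]^D} p(x,z) σ_{fg}^{-2}(x,z) dz`. -/
def Model.info {D : ℕ} (m : Model) (p : ℝ × (Fin D → ℝ) → ℝ) (g : (Fin D → ℝ) → ℝ)
    (f : ℝ → ℝ) (x : ℝ) : ℝ :=
  ∫ z in Icc (0 : Fin D → ℝ) 1, p (x, z) * (m.variance (f x + g z))⁻¹

/-- The coefficient of difficulty `∫₀¹ dx / 𝓘(x)`. -/
def Model.difficulty {D : ℕ} (m : Model) (p : ℝ × (Fin D → ℝ) → ℝ) (g : (Fin D → ℝ) → ℝ)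
    (f : ℝ → ℝ) : ℝ :=
  ∫ x in (0 : ℝ)..1, 1 / m.info p g f x

/-! ### Assumptions on the design and the scale -/

/-- The unit interval as a one-dimensional box. -/
def unitBox : BoxIntegral.Box (Fin 1) := ⟨fun _ => 0, fun _ => 1, fun _ => zero_lt_one⟩

/-- Riemann integrability on `[0,1]`. -/
def RiemannIntegrable (h : ℝ → ℝ) : Prop :=
  BoxIntegral.Integrable unitBox BoxIntegral.IntegrationParams.Riemann
    (fun v : Fin 1 → ℝ => h (v 0)) BoxIntegral.BoxAdditiveMap.volume

/-- `p` is a probability density supported on `[0,1]^{1+D}`. -/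
structure IsDesignDensity {D : ℕ} (p : ℝ × (Fin D → ℝ) → ℝ) : Prop where
  measurable : Measurable p
  nonneg : ∀ w, 0 ≤ p w
  support : ∀ w, w ∉ Icc (0 : ℝ) 1 ×ˢ Icc (0 : Fin D → ℝ) 1 → p w = 0
  total : ∫⁻ w, ENNReal.ofReal (p w) = 1

/-- The design density and the scale function `σ_{fg}` are bounded away from `0` and `∞` on
`[0,1]^{1+D}`, in the form that `|ln p|` and `|ln σ_{fg}|` are bounded, and `𝓘` is Riemann
integrable. -/
structure Model.ScaleAssumption {D : ℕ} (m : Model) (p : ℝ × (Fin D → ℝ) → ℝ)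
    (g : (Fin D → ℝ) → ℝ) (f : ℝ → ℝ) : Prop where
  density : IsDesignDensity p
  log_bounded : ∃ B : ℝ, ∀ x ∈ Icc (0 : ℝ) 1, ∀ z ∈ Icc (0 : Fin D → ℝ) 1,
    0 < p (x, z) ∧ |Real.log (p (x, z))| ≤ B ∧
    0 < m.variance (f x + g z) ∧ |Real.log (√(m.variance (f x + g z)))| ≤ B
  info_riemann : RiemannIntegrable (m.info p g f)

end SharpMinimax

end

open SharpMinimax

noncomputable section

namespace SharpMinimax

/-! ### Finite products of measures with densities -/

/-! The minimax risk dominates the Bayes risk over any prior on the class, and a finite-dimensional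
prior can be chosen whose Bayes risk already has Pinsker's constant. The prior lives on the curves
S_M f₀ + Σ_l ξ_l r_l h φ_{L+K+l}, with independent ξ_l in [-1,1] and L + l running from about εN up
to N = (κn)^{1/(2α+1)}. Here h is a cosine polynomial with h² close to 1/𝓘, where 𝓘 is the
information at the pivot. Weighted by h, the directions make the information matrix of the sample
nearly n·diag(r_l²), while each direction has squared norm exactly r_l² ∫h², with ∫h² close to the
coefficient of difficulty. The regression then behaves like a Gaussian sequence model whose loss and
Sobolev energy both carry the factor ∫h².

The Bayes risk is bounded by a van Trees inequality adapted to the integrated squared error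
(`IsSubmodel.vanTrees`). For U = T - f one expands the nonnegative integral of (U - Σ w_i score_i
e_i)² over x, the sample and ξ. Integration by parts in ξ turns the cross term into Σ w_i ⟨e_i,e_i⟩;
the quadratic term contains ⟨e_i,e_j⟩ times n∫𝓘 e_i e_j plus the prior information J on the
diagonal. Neither matrix has to be diagonal or inverted: `sum_mul_integral_le` bounds the deviation
from the diagonal case by the L¹ norm of 𝓘h² - 1. Control in L¹ is therefore enough everywhere,
which is why h can be a polynomial approximation (`exists_cosPoly_sq_near_inv`) and why convergence
of S_M f₀ to f₀ in mean suffices.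

The prior must have bounded support, so that all its curves are admissible means, yet be almost
Gaussian in the sense VJ ≤ 1 + ε; powers of 1 - x² do this (`exists_isPrior`). It need not be
supported in the family: `IsMultiplier.exists_mem_family` shows that it nearly is. Since h shifts
frequencies by at most K, each curve is a finite cosine sum with frequencies at least L ≥ M; its
energy concentrates by Chebyshev because the coefficients have short-range dependence, and its
supremum is controlled by Hoeffding's inequality on a grid. The exceptional set costs its
probability times the squared radius of the submodel, because an estimator may be truncated to stay
near S_M f₀ (`IsSubmodel.le_minimaxMISE_add`). That radius is of order N/n, the order of the minimax
risk, so it suffices that the probability tends to 0.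

With r_l² = ((N/j)^α - 1)/(nV), j = L + l, the bound becomes nearly ∫h²·n⁻¹ Σ_j (1 - (j/N)^α), about
∫h²·αN/((α+1)n). The energy constraint fixes κ, and `difficulty_mul_rate` identifies the result with
the Pinsker expression. All the relative losses are small multiples of ε. -/

theorem lintegral_fin_pi_prod {E : Type*} [MeasurableSpace E] {n : ℕ} (μ : Fin n → Measure E)
    [∀ i, SigmaFinite (μ i)] (f : Fin n → E → ℝ≥0∞) (hf : ∀ i, Measurable (f i)) :
    ∫⁻ x, ∏ i, f i (x i) ∂(Measure.pi μ) = ∏ i, ∫⁻ x, f i x ∂(μ i) := by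
  induction n with
  | zero => simp
  | succ n ih =>
    rw [← ((measurePreserving_piFinSuccAbove μ 0).symm).lintegral_comp_emb
      (MeasurableEquiv.measurableEmbedding _)]
    simp_rw [MeasurableEquiv.piFinSuccAbove_symm_apply, Fin.insertNthEquiv,
      Fin.prod_univ_succ, Fin.insertNth_zero, Equiv.coe_fn_mk, Fin.cons_succ,
      Fin.zero_succAbove, cast_eq, Fin.cons_zero]
    rw [← ih (fun i => μ i.succ) (fun i => f i.succ) (fun i => hf _)]
    refine lintegral_prod_mul (f := f 0)
      (g := fun x : Fin n → E => ∏ i, f (Fin.succ i) (x i)) (hf 0).aemeasurable ?_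
    exact (Finset.measurable_fun_prod _ fun i _ =>
      (hf i.succ).comp (measurable_pi_apply i)).aemeasurable

theorem pi_withDensity {E : Type*} [MeasurableSpace E] {n : ℕ} (μ : Measure E) [SigmaFinite μ]
    (f : Fin n → E → ℝ≥0∞) (hf : ∀ i, Measurable (f i))
    [∀ i, SigmaFinite (μ.withDensity (f i))] :
    Measure.pi (fun i => μ.withDensity (f i)) =
      (Measure.pi fun _ => μ).withDensity fun x => ∏ i, f i (x i) := by
  refine Measure.pi_eq fun s hs => ?_
  rw [withDensity_apply _ (MeasurableSet.univ_pi hs),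
    ← lintegral_indicator (MeasurableSet.univ_pi hs)]
  have : ((univ.pi s).indicator fun x : Fin n → E => ∏ i, f i (x i)) =
      fun x => ∏ i, (s i).indicator (f i) (x i) := by
    ext x
    by_cases hx : x ∈ univ.pi s
    · rw [indicator_of_mem hx]
      exact Finset.prod_congr rfl fun i _ => (indicator_of_mem (hx i (mem_univ i)) _).symm
    · rw [indicator_of_notMem hx]
      simp only [Set.mem_pi, mem_univ, true_imp_iff, not_forall] at hx
      obtain ⟨i, hi⟩ := hx
      exact (Finset.prod_eq_zero (Finset.mem_univ i) (indicator_of_notMem hi _)).symm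
  rw [this, lintegral_fin_pi_prod (fun _ => μ) _ fun i => (hf i).indicator (hs i)]
  exact Finset.prod_congr rfl fun i _ => by
    rw [withDensity_apply _ (hs i), lintegral_indicator (hs i)]

/-! ### The score of the response distributions -/

/-- `t` lies in the interior of the admissible conditional means. -/
def Model.IsInterior (m : Model) (t : ℝ) : Prop := 0 < t ∧ (m = .bernoulli → t < 1)

/-- The derivative of the log-likelihood of the response in its conditional mean. -/
def Model.score (m : Model) (t : ℝ) (y : ℕ) : ℝ := (y - t) / m.variance t

/-- The derivative of the probability of a response in its conditional mean. -/
def Model.dpmf (m : Model) (t : ℝ) (y : ℕ) : ℝ := deriv (fun t => m.pmf t y) t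

/-- The formulas for the probabilities are smooth in t on the whole line, also where they are not
probabilities. Hence likelihoods can be differentiated in the parameter everywhere, not only inside
the parameter box. -/
theorem Model.hasDerivAt_pmf (m : Model) (t : ℝ) (y : ℕ) :
    HasDerivAt (fun t => m.pmf t y) (m.dpmf t y) t := by
  apply DifferentiableAt.hasDerivAt
  cases m
  · simp only [Model.pmf]
    split_ifs <;> fun_prop
  · simp only [Model.pmf]
    fun_prop

/-- Both models are exponential families parametrised by their mean, for which the logarithmic
derivative in the mean is the centred response over its variance. -/
theorem Model.dpmf_eq {m : Model} {t : ℝ} (ht : m.IsInterior t) (y : ℕ) :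
    m.dpmf t y = m.score t y * m.pmf t y := by
  have h0 : t ≠ 0 := ht.1.ne'
  cases m
  · have h1 : (1 - t) ≠ 0 := by have := ht.2 rfl; linarith
    unfold Model.dpmf Model.score Model.pmf Model.variance
    by_cases hy : y = 0
    · subst hy
      simp only [if_true]
      rw [deriv_const_sub, deriv_id'']
      field_simp
      simp
    · by_cases hy1 : y = 1
      · subst hy1
        simp
        field_simp
      · simp [hy, hy1]
  · refine HasDerivAt.deriv ?_
    simp only [Model.pmf, Model.score, Model.variance]
    have h := (((hasDerivAt_id t).neg.exp).mul (hasDerivAt_pow y t)).div_const (y ! : ℝ)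
    refine h.congr_deriv ?_
    rcases y with _ | y
    · simp
      field_simp
    · simp only [Nat.add_sub_cancel, pow_succ]
      have : ((y + 1)! : ℝ) ≠ 0 := by positivity
      field_simp
      push_cast
      simp
      ring

theorem Model.pmf_nonneg {m : Model} {t : ℝ} (ht : m.IsInterior t) (y : ℕ) : 0 ≤ m.pmf t y := by
  have h0 := ht.1
  cases m
  · have := ht.2 rfl
    simp only [Model.pmf]
    split_ifs <;> linarith
  · simp only [Model.pmf]
    positivity

theorem hasSum_poisson_pmf (t : ℝ) : HasSum (fun y : ℕ => Real.exp (-t) * t ^ y / (y ! : ℝ)) 1 := by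
  have h := (NormedSpace.expSeries_div_hasSum_exp t).mul_left (Real.exp (-t))
  rw [← Real.exp_eq_exp_ℝ, ← Real.exp_add, neg_add_cancel, Real.exp_zero] at h
  simpa only [mul_div_assoc] using h

theorem hasSum_poisson_mean (t : ℝ) :
    HasSum (fun y : ℕ => (y : ℝ) * (Real.exp (-t) * t ^ y / (y ! : ℝ))) t := by
  rw [← hasSum_nat_add_iff' 1]
  simp only [Finset.range_one, Finset.sum_singleton, Nat.cast_zero, zero_mul, sub_zero]
  have h := (hasSum_poisson_pmf t).mul_left t
  rw [mul_one] at h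
  refine h.congr_fun fun y => ?_
  rw [Nat.factorial_succ]
  push_cast
  field_simp
  ring

theorem hasSum_poisson_factorial_moment (t : ℝ) :
    HasSum (fun y : ℕ => (y : ℝ) * (y - 1) * (Real.exp (-t) * t ^ y / (y ! : ℝ))) (t ^ 2) := by
  rw [← hasSum_nat_add_iff' 1]
  simp only [Finset.range_one, Finset.sum_singleton, Nat.cast_zero, zero_mul, sub_zero]
  have h := (hasSum_poisson_mean t).mul_left t
  rw [← sq] at h
  refine h.congr_fun fun y => ?_
  rw [Nat.factorial_succ]
  push_cast
  field_simp
  ring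

theorem hasSum_of_zero_one {f : ℕ → ℝ} (hf : ∀ y, y ≠ 0 → y ≠ 1 → f y = 0) :
    HasSum f (f 0 + f 1) := by
  have h : HasSum f (∑ y ∈ {0, 1}, f y) := hasSum_sum_of_ne_finset_zero fun y hy => by
    simp only [Finset.mem_insert, Finset.mem_singleton, not_or] at hy
    exact hf y hy.1 hy.2
  simpa using h

theorem Model.hasSum_pmf (m : Model) (t : ℝ) : HasSum (m.pmf t) 1 := by
  cases m
  · have h := hasSum_of_zero_one (f := Model.pmf .bernoulli t) fun y hy hy1 => by
      simp [Model.pmf, hy, hy1]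
    simpa [Model.pmf] using h
  · exact hasSum_poisson_pmf t

theorem Model.hasSum_score {m : Model} {t : ℝ} (ht : m.IsInterior t) :
    HasSum (fun y => m.score t y * m.pmf t y) 0 := by
  have h0 : t ≠ 0 := ht.1.ne'
  cases m
  · have h1 : (1 - t) ≠ 0 := by have := ht.2 rfl; linarith
    have h := hasSum_of_zero_one
      (f := fun y => Model.score .bernoulli t y * Model.pmf .bernoulli t y) fun y hy hy1 => by
        simp [Model.pmf, hy, hy1]
    convert! h using 1
    simp [Model.pmf, Model.score, Model.variance]
    field_simp
    ring
  · have h := ((hasSum_poisson_mean t).sub ((hasSum_poisson_pmf t).mul_left t)).div_const t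
    simp only [mul_one, sub_self, zero_div] at h
    refine h.congr_fun fun y => ?_
    simp only [Model.score, Model.variance, Model.pmf]
    ring

/-- The Fisher information about the mean is variance over squared variance; this is the source of
σ⁻² in 𝓘. -/
theorem Model.hasSum_score_sq {m : Model} {t : ℝ} (ht : m.IsInterior t) :
    HasSum (fun y => m.score t y ^ 2 * m.pmf t y) (m.variance t)⁻¹ := by
  have h0 : t ≠ 0 := ht.1.ne'
  cases m
  · have h1 : (1 - t) ≠ 0 := by have := ht.2 rfl; linarith
    have h := hasSum_of_zero_one
      (f := fun y => Model.score .bernoulli t y ^ 2 * Model.pmf .bernoulli t y) fun y hy hy1 => by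
        simp [Model.pmf, hy, hy1]
    convert! h using 1
    simp [Model.pmf, Model.score, Model.variance]
    field_simp
    ring
  -- This uses (y - t)² = y(y - 1) + (1 - 2t)y + t².
  · have h := (((hasSum_poisson_factorial_moment t).add
      ((hasSum_poisson_mean t).mul_left (1 - 2 * t))).add
      ((hasSum_poisson_pmf t).mul_left (t ^ 2))).div_const (t ^ 2)
    have e : (t ^ 2 + (1 - 2 * t) * t + t ^ 2 * 1) / t ^ 2 = t⁻¹ := by
      field_simp
      ring
    rw [e] at h
    refine h.congr_fun fun y => ?_
    simp only [Model.score, Model.variance, Model.pmf]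
    ring

/-- The bounds of `Model.MeanBounds` at a single value of the mean. -/
def Model.Between (m : Model) (c c' t : ℝ) : Prop := c ≤ t ∧ (m = .bernoulli → t ≤ c')

theorem Model.Between.isInterior {m : Model} {c c' t : ℝ} (h : m.Between c c' t) (hc : 0 < c)
    (hc' : c' < 1) : m.IsInterior t :=
  ⟨hc.trans_le h.1, fun hm => (h.2 hm).trans_lt hc'⟩

theorem Model.exists_variance_lower (m : Model) {c c' : ℝ} (hc : 0 < c) (hc' : c' < 1) :
    ∃ v : ℝ, 0 < v ∧ ∀ t, m.Between c c' t → v ≤ m.variance t := by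
  cases m
  · refine ⟨c * (1 - c'), mul_pos hc (by linarith), fun t ht => ?_⟩
    have := ht.2 rfl
    exact mul_le_mul ht.1 (by linarith) (by linarith) (hc.le.trans ht.1)
  · exact ⟨c, hc, fun t ht => ht.1⟩

theorem Model.abs_variance_sub_le {m : Model} {s t : ℝ} (hs : m.IsInterior s)
    (ht : m.IsInterior t) : |m.variance s - m.variance t| ≤ |s - t| := by
  cases m
  · have := hs.2 rfl
    have := ht.2 rfl
    have := hs.1
    have := ht.1
    have e : Model.variance .bernoulli s - Model.variance .bernoulli t
        = (s - t) * (1 - s - t) := by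
      simp only [Model.variance]
      ring
    rw [e, abs_mul]
    exact mul_le_of_le_one_right (abs_nonneg _) (abs_le.2 ⟨by linarith, by linarith⟩)
  · simp [Model.variance]

/-- Away from the boundary the variance is at least v and 1-Lipschitz, so its inverse is bounded by
v⁻¹ and v⁻²-Lipschitz. One constant serves both purposes when the information at a curve is compared
with that at the pivot. -/
theorem Model.exists_inv_variance_lipschitz (m : Model) {c c' : ℝ} (hc : 0 < c) (hc' : c' < 1) :
    ∃ C : ℝ, 0 < C ∧ (∀ t, m.Between c c' t → 0 < m.variance t ∧ (m.variance t)⁻¹ ≤ C) ∧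
      ∀ s t, m.Between c c' s → m.Between c c' t →
        |(m.variance s)⁻¹ - (m.variance t)⁻¹| ≤ C * |s - t| := by
  obtain ⟨v, hv, hvar⟩ := m.exists_variance_lower hc hc'
  refine ⟨max v⁻¹ (v⁻¹ ^ 2), by positivity, fun t ht => ⟨hv.trans_le (hvar t ht), ?_⟩,
    fun s t hs ht => ?_⟩
  · exact (inv_anti₀ hv (hvar t ht)).trans (le_max_left _ _)
  · have h1 := hv.trans_le (hvar s hs)
    have h2 := hv.trans_le (hvar t ht)
    have e : (m.variance s)⁻¹ - (m.variance t)⁻¹ =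
        (m.variance s)⁻¹ * (m.variance t)⁻¹ * (m.variance t - m.variance s) := by
      field_simp
    rw [e, abs_mul, abs_of_pos (by positivity)]
    have h3 := Model.abs_variance_sub_le (ht.isInterior hc hc') (hs.isInterior hc hc')
    rw [abs_sub_comm t s] at h3
    refine mul_le_mul ?_ h3 (abs_nonneg _) (by positivity)
    refine le_trans ?_ (le_max_right _ _)
    rw [sq]
    exact mul_le_mul (inv_anti₀ hv (hvar s hs)) (inv_anti₀ hv (hvar t ht)) (by positivity)
      (by positivity)

theorem Model.measurable_pmf (m : Model) : Measurable fun q : ℝ × ℕ => m.pmf q.1 q.2 := by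
  refine measurable_from_prod_countable_left fun y => ?_
  cases m
  · simp only [Model.pmf]
    split_ifs <;> fun_prop
  · simp only [Model.pmf]
    fun_prop

theorem Model.measurable_variance (m : Model) : Measurable m.variance := by
  cases m
  · exact measurable_id.mul (measurable_const.sub measurable_id)
  · exact measurable_id

theorem Model.measurable_score (m : Model) : Measurable fun q : ℝ × ℕ => m.score q.1 q.2 := by
  refine measurable_from_prod_countable_left fun y => ?_
  change Measurable fun t : ℝ => ((y : ℝ) - t) / m.variance t
  exact (measurable_const.sub measurable_id).div m.measurable_variance

/-! ### The law of one observation -/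

variable {D : ℕ}

/-- The measure with respect to which the law of an observation has the probability of the
response as its density. -/
def baseMeasure (p : ℝ × (Fin D → ℝ) → ℝ) : Measure (Obs D) :=
  ((volume : Measure (ℝ × (Fin D → ℝ))).prod (Measure.count : Measure ℕ)).withDensity
    fun o => ENNReal.ofReal (p o.1)

/-- The likelihood of a single observation. -/
def Model.lik (m : Model) (g : (Fin D → ℝ) → ℝ) (f : ℝ → ℝ) (o : Obs D) : ℝ :=
  m.pmf (f o.1.1 + g o.1.2) o.2

/-- The score of a single observation. -/
def Model.obsScore (m : Model) (g : (Fin D → ℝ) → ℝ) (f : ℝ → ℝ) (o : Obs D) : ℝ :=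
  m.score (f o.1.1 + g o.1.2) o.2

/-- The unit cube of the covariates. -/
def cube (D : ℕ) : Set (ℝ × (Fin D → ℝ)) := Icc (0 : ℝ) 1 ×ˢ Icc (0 : Fin D → ℝ) 1

/-- The conditional mean of the response is interior to the admissible set. -/
def Model.Regular (m : Model) (g : (Fin D → ℝ) → ℝ) (f : ℝ → ℝ) : Prop :=
  ∀ w ∈ cube D, m.IsInterior (f w.1 + g w.2)

variable {m : Model} {p : ℝ × (Fin D → ℝ) → ℝ} {g : (Fin D → ℝ) → ℝ} {f : ℝ → ℝ}

theorem Model.measurable_lik (hg : Measurable g) (hf : Measurable f) :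
    Measurable (m.lik g f : Obs D → ℝ) :=
  m.measurable_pmf.comp ((by fun_prop : Measurable fun o : Obs D =>
    (f o.1.1 + g o.1.2, o.2)))

theorem Model.measurable_obsScore (hg : Measurable g) (hf : Measurable f) :
    Measurable (m.obsScore g f : Obs D → ℝ) :=
  m.measurable_score.comp ((by fun_prop : Measurable fun o : Obs D =>
    (f o.1.1 + g o.1.2, o.2)))

instance sigmaFinite_baseMeasure : SigmaFinite (baseMeasure p) :=
  SigmaFinite.withDensity_ofReal _

theorem Model.obsLaw_eq_withDensity (hp : Measurable p) (hg : Measurable g) (hf : Measurable f) :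
    m.obsLaw p g f = (baseMeasure p).withDensity fun o => ENNReal.ofReal (m.lik g f o) := by
  have h1 : Measurable fun o : Obs D => ENNReal.ofReal (m.lik g f o) :=
    ENNReal.measurable_ofReal.comp (Model.measurable_lik hg hf)
  rw [baseMeasure, ← withDensity_mul _ (by fun_prop) h1]
  rfl

theorem ae_mem_cube_baseMeasure (hp : IsDesignDensity p) :
    ∀ᵐ o ∂(baseMeasure p), o.1 ∈ cube D := by
  have := hp.measurable
  rw [baseMeasure, ae_withDensity_iff (by fun_prop)]
  refine ae_of_all _ fun o ho => ?_
  by_contra h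
  exact ho (by rw [hp.support _ h, ENNReal.ofReal_zero])

theorem Model.lintegral_obsLaw (hp : Measurable p) (hg : Measurable g) (hf : Measurable f)
    {F : Obs D → ℝ≥0∞} (hF : Measurable F) :
    ∫⁻ o, F o ∂(m.obsLaw p g f) =
      ∫⁻ w, ENNReal.ofReal (p w) *
        ∑' y, ENNReal.ofReal (m.pmf (f w.1 + g w.2) y) * F (w, y) := by
  have h1 : Measurable fun o : Obs D => ENNReal.ofReal (m.pmf (f o.1.1 + g o.1.2) o.2) :=
    ENNReal.measurable_ofReal.comp (Model.measurable_lik hg hf)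
  have h2 : Measurable fun o : Obs D => ENNReal.ofReal (p o.1) := by fun_prop
  have h3 := h2.fun_mul h1
  rw [Model.obsLaw, lintegral_withDensity_eq_lintegral_mul _ h3 hF,
    lintegral_prod _ (h3.mul hF).aemeasurable]
  refine lintegral_congr fun w => ?_
  simp only [Pi.mul_apply]
  rw [lintegral_count]
  simp only [mul_assoc, ENNReal.tsum_mul_left]

theorem Model.Regular.tsum_ofReal_pmf (hr : m.Regular g f) {w : ℝ × (Fin D → ℝ)}
    (hw : w ∈ cube D) : ∑' y, ENNReal.ofReal (m.pmf (f w.1 + g w.2) y) = 1 := by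
  rw [← ENNReal.ofReal_tsum_of_nonneg (Model.pmf_nonneg (hr w hw)) (m.hasSum_pmf _).summable,
    (m.hasSum_pmf _).tsum_eq, ENNReal.ofReal_one]

theorem Model.Regular.isProbabilityMeasure_obsLaw (hp : IsDesignDensity p) (hg : Measurable g)
    (hf : Measurable f) (hr : m.Regular g f) : IsProbabilityMeasure (m.obsLaw p g f) := by
  refine ⟨?_⟩
  rw [← lintegral_one, Model.lintegral_obsLaw hp.measurable hg hf
    (F := fun _ => 1) measurable_const]
  refine (lintegral_congr fun w => ?_).trans hp.total
  by_cases hw : w ∈ cube D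
  · simp only [mul_one, hr.tsum_ofReal_pmf hw]
  · rw [hp.support w hw]
    simp

theorem Model.integral_obsLaw (hp : IsDesignDensity p) (hg : Measurable g) (hf : Measurable f)
    (hr : m.Regular g f) {F : Obs D → ℝ} (hF : Integrable F (m.obsLaw p g f)) :
    ∫ o, F o ∂(m.obsLaw p g f) =
      ∫ w, p w * ∑' y, m.pmf (f w.1 + g w.2) y * F (w, y) := by
  have hpm := hp.measurable
  have h1 : Measurable fun o : Obs D => ENNReal.ofReal (m.pmf (f o.1.1 + g o.1.2) o.2) :=
    ENNReal.measurable_ofReal.comp (Model.measurable_lik hg hf)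
  have h2 : Measurable fun o : Obs D => ENNReal.ofReal (p o.1) := by fun_prop
  have hfin : ∀ o : Obs D, ENNReal.ofReal (p o.1) *
      ENNReal.ofReal (m.pmf (f o.1.1 + g o.1.2) o.2) < ∞ := fun o =>
    ENNReal.mul_lt_top ENNReal.ofReal_lt_top ENNReal.ofReal_lt_top
  have h3 := h2.fun_mul h1
  rw [Model.obsLaw, integrable_withDensity_iff_integrable_smul' h3 (ae_of_all _ hfin)]
    at hF
  rw [Model.obsLaw, integral_withDensity_eq_integral_toReal_smul h3 (ae_of_all _ hfin),
    integral_prod _ hF]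
  refine integral_congr_ae ?_
  filter_upwards [hF.prod_right_ae] with w hw
  rw [integral_countable hw, ← tsum_mul_left]
  refine tsum_congr fun y => ?_
  simp only [Measure.real, Measure.count_singleton, ENNReal.toReal_one, one_mul, smul_eq_mul,
    ENNReal.toReal_mul, ENNReal.toReal_ofReal (hp.nonneg w)]
  by_cases hc : w ∈ cube D
  · rw [ENNReal.toReal_ofReal (Model.pmf_nonneg (hr w hc) y), mul_assoc]
  · rw [hp.support w hc]
    simp

theorem IsDesignDensity.integrable (hp : IsDesignDensity p) : Integrable p := by
  refine ⟨hp.measurable.aestronglyMeasurable, ?_⟩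
  rw [hasFiniteIntegral_iff_ofReal (ae_of_all _ hp.nonneg), hp.total]
  exact ENNReal.one_lt_top

/-! ### Moments of the score of one observation. -/

section Score

variable {C : ℝ} (hp : IsDesignDensity p) (hg : Measurable g) (hf : Measurable f)
  (hr : m.Regular g f) (hC : ∀ w ∈ cube D, (m.variance (f w.1 + g w.2))⁻¹ ≤ C)

theorem Model.variance_pos {t : ℝ} (ht : m.IsInterior t) : 0 < m.variance t := by
  cases m
  · exact mul_pos ht.1 (sub_pos.2 (ht.2 rfl))
  · exact ht.1

include hp hg hf hr hC

theorem Model.integrable_density_div_variance {c : ℝ → ℝ} (hc : Measurable c) {B : ℝ}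
    (hB : ∀ x, |c x| ≤ B) :
    Integrable fun w : ℝ × (Fin D → ℝ) => p w * (m.variance (f w.1 + g w.2))⁻¹ * c w.1 := by
  have hpm := hp.measurable
  have hvm := m.measurable_variance
  have hB0 : 0 ≤ B := (abs_nonneg _).trans (hB 0)
  refine (hp.integrable.mul_const (C * B)).mono' ?_ (ae_of_all _ fun w => ?_)
  · exact ((hpm.mul (hvm.comp (by fun_prop : Measurable fun w : ℝ × (Fin D → ℝ) =>
      f w.1 + g w.2)).inv).mul (hc.comp measurable_fst)).aestronglyMeasurable
  · by_cases hw : w ∈ cube D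
    · have h1 := Model.variance_pos (hr w hw)
      rw [norm_mul, norm_mul, Real.norm_of_nonneg (hp.nonneg w),
        Real.norm_of_nonneg (inv_nonneg.2 h1.le), mul_assoc]
      exact mul_le_mul_of_nonneg_left (mul_le_mul (hC w hw) (hB _) (abs_nonneg _)
        ((inv_nonneg.2 h1.le).trans (hC w hw))) (hp.nonneg w)
    · rw [hp.support w hw]
      simp

theorem Model.integrable_obsScore_sq_mul {c : ℝ → ℝ} (hc : Measurable c) {B : ℝ}
    (hB : ∀ x, |c x| ≤ B) :
    Integrable (fun o : Obs D => m.obsScore g f o ^ 2 * c o.1.1) (m.obsLaw p g f) := by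
  have hs : Measurable (m.obsScore g f : Obs D → ℝ) := Model.measurable_obsScore hg hf
  refine ⟨by fun_prop, ?_⟩
  rw [hasFiniteIntegral_iff_enorm, Model.lintegral_obsLaw hp.measurable hg hf (by fun_prop)]
  have h := (Model.integrable_density_div_variance hp hg hf hr hC hc hB).hasFiniteIntegral
  rw [hasFiniteIntegral_iff_enorm] at h
  refine (le_of_eq (lintegral_congr fun w => ?_)).trans_lt h
  by_cases hw : w ∈ cube D
  · rw [enorm_mul, enorm_mul, Real.enorm_of_nonneg (hp.nonneg w),
      Real.enorm_of_nonneg (inv_nonneg.2 (Model.variance_pos (hr w hw)).le), mul_assoc]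
    congr 1
    rw [← (Model.hasSum_score_sq (hr w hw)).tsum_eq, ENNReal.ofReal_tsum_of_nonneg
      (fun y => mul_nonneg (sq_nonneg _) (Model.pmf_nonneg (hr w hw) y))
      (Model.hasSum_score_sq (hr w hw)).summable, ← ENNReal.tsum_mul_right]
    refine tsum_congr fun y => ?_
    rw [enorm_mul, ← mul_assoc, ENNReal.ofReal_mul (sq_nonneg _),
      Real.enorm_of_nonneg (sq_nonneg _)]
    congr 1
    exact mul_comm _ _
  · rw [hp.support w hw]
    simp

theorem Model.integral_obsScore_sq_mul_eq_density {c : ℝ → ℝ} (hc : Measurable c) {B : ℝ}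
    (hB : ∀ x, |c x| ≤ B) :
    ∫ o : Obs D, m.obsScore g f o ^ 2 * c o.1.1 ∂(m.obsLaw p g f) =
      ∫ w : ℝ × (Fin D → ℝ), p w * (m.variance (f w.1 + g w.2))⁻¹ * c w.1 := by
  rw [Model.integral_obsLaw hp hg hf hr (Model.integrable_obsScore_sq_mul hp hg hf hr hC hc hB)]
  have e : (fun w : ℝ × (Fin D → ℝ) => p w * ∑' y, m.pmf (f w.1 + g w.2) y *
      (m.obsScore g f (w, y) ^ 2 * c w.1)) =
      fun w => p w * (m.variance (f w.1 + g w.2))⁻¹ * c w.1 := by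
    ext w
    by_cases hw : w ∈ cube D
    · rw [mul_assoc, ← (Model.hasSum_score_sq (hr w hw)).tsum_eq, ← tsum_mul_right]
      congr 1
      exact tsum_congr fun y => by rw [Model.obsScore]; ring
    · rw [hp.support w hw]
      simp
  rw [e]

theorem Model.integral_obsScore_sq_le :
    ∫ o : Obs D, m.obsScore g f o ^ 2 ∂(m.obsLaw p g f) ≤ C := by
  have h := Model.integral_obsScore_sq_mul_eq_density hp hg hf hr hC (c := fun _ => 1)
    measurable_const (B := 1) (fun _ => by simp)
  have h2 := Model.integrable_density_div_variance hp hg hf hr hC (c := fun _ => 1)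
    measurable_const (B := 1) (fun _ => by simp)
  simp only [mul_one] at h h2
  rw [h]
  have h1 : ∫ w, p w = 1 := by
    rw [integral_eq_lintegral_of_nonneg_ae (ae_of_all _ hp.nonneg)
      hp.measurable.aestronglyMeasurable, hp.total, ENNReal.toReal_one]
  calc _ ≤ ∫ w, p w * C := integral_mono h2 (hp.integrable.mul_const C) fun w => by
        by_cases hw : w ∈ cube D
        · exact mul_le_mul_of_nonneg_left (hC w hw) (hp.nonneg w)
        · simp [hp.support w hw]
    _ = C := by rw [integral_mul_const, h1, one_mul]

/-- Given the covariates the squared score has mean σ⁻²; integrating out z against p leaves 𝓘(x). -/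
theorem Model.integral_obsScore_sq_mul {c : ℝ → ℝ} (hc : Measurable c) {B : ℝ}
    (hB : ∀ x, |c x| ≤ B) :
    ∫ o : Obs D, m.obsScore g f o ^ 2 * c o.1.1 ∂(m.obsLaw p g f) =
      ∫ x in (0 : ℝ)..1, m.info p g f x * c x := by
  have hint := Model.integrable_density_div_variance hp hg hf hr hC hc hB
  rw [Model.integral_obsScore_sq_mul_eq_density hp hg hf hr hC hc hB, Measure.volume_eq_prod,
    integral_prod _ (by rwa [← Measure.volume_eq_prod]),
    intervalIntegral.integral_of_le zero_le_one, ← integral_Icc_eq_integral_Ioc,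
    ← integral_indicator measurableSet_Icc]
  congr 1
  ext x
  by_cases hx : x ∈ Icc (0 : ℝ) 1
  · rw [indicator_of_mem hx, Model.info]
    simp only
    rw [integral_mul_const]
    congr 1
    refine (setIntegral_eq_integral_of_forall_compl_eq_zero fun z hz => ?_).symm
    rw [hp.support (x, z) (fun h => hz h.2), zero_mul]
  · rw [indicator_of_notMem hx]
    simp_rw [fun z => hp.support (x, z) fun h => hx h.1, zero_mul]
    simp

theorem Model.memLp_obsScore_mul {c : ℝ → ℝ} (hc : Measurable c) {B : ℝ}
    (hB : ∀ x, |c x| ≤ B) :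
    MemLp (fun o : Obs D => m.obsScore g f o * c o.1.1) 2 (m.obsLaw p g f) := by
  have hs : Measurable (m.obsScore g f : Obs D → ℝ) := Model.measurable_obsScore hg hf
  rw [memLp_two_iff_integrable_sq (by fun_prop)]
  have hB0 : 0 ≤ B := (abs_nonneg _).trans (hB 0)
  have := Model.integrable_obsScore_sq_mul hp hg hf hr hC (c := fun x => c x ^ 2)
    (hc.pow_const 2) (B := B ^ 2) fun x => by
      rw [abs_pow]
      exact pow_le_pow_left₀ (abs_nonneg _) (hB x) 2
  simpa only [mul_pow] using this

theorem Model.integral_obsScore_mul {c : ℝ → ℝ} (hc : Measurable c) {B : ℝ}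
    (hB : ∀ x, |c x| ≤ B) :
    ∫ o : Obs D, m.obsScore g f o * c o.1.1 ∂(m.obsLaw p g f) = 0 := by
  have := hr.isProbabilityMeasure_obsLaw hp hg hf
  rw [Model.integral_obsLaw hp hg hf hr
    ((Model.memLp_obsScore_mul hp hg hf hr hC hc hB).integrable one_le_two)]
  refine integral_eq_zero_of_ae (ae_of_all _ fun w => ?_)
  by_cases hw : w ∈ cube D
  · have : ∀ y, m.pmf (f w.1 + g w.2) y * (m.obsScore g f (w, y) * c w.1) =
        m.score (f w.1 + g w.2) y * m.pmf (f w.1 + g w.2) y * c w.1 := fun y => by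
      rw [Model.obsScore]; ring
    simp_rw [this, tsum_mul_right, (Model.hasSum_score (hr w hw)).tsum_eq]
    simp
  · simp [hp.support w hw]

end Score

/-! ### Sums over independent observations -/

section Sums

variable {E : Type*} [MeasurableSpace E] {P : Measure E} [IsProbabilityMeasure P] {n : ℕ}

theorem integral_pi_eval {u : E → ℝ} (hu : AEStronglyMeasurable u P) (l : Fin n) :
    ∫ s : Fin n → E, u (s l) ∂(Measure.pi fun _ => P) = ∫ o, u o ∂P := by
  have h := measurePreserving_eval (fun _ : Fin n => P) l
  rw [← h.map_eq] at hu
  conv_rhs => rw [← h.map_eq, integral_map h.measurable.aemeasurable hu]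

theorem memLp_pi_eval {u : E → ℝ} {q : ℝ≥0∞} (hu : MemLp u q P) (l : Fin n) :
    MemLp (fun s : Fin n → E => u (s l)) q (Measure.pi fun _ => P) :=
  hu.comp_measurePreserving (measurePreserving_eval (fun _ : Fin n => P) l)

theorem integral_pi_mul_of_ne {u v : E → ℝ} (hu : AEStronglyMeasurable u P)
    (hv : AEStronglyMeasurable v P) {l l' : Fin n} (hne : l ≠ l') :
    ∫ s : Fin n → E, u (s l) * v (s l') ∂(Measure.pi fun _ => P) =
      (∫ o, u o ∂P) * ∫ o, v o ∂P := by
  have hind := ProbabilityTheory.iIndepFun_pi (μ := fun _ : Fin n => P)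
    (X := fun _ : Fin n => (id : E → E)) fun _ => aemeasurable_id
  have hm := fun l : Fin n => measurePreserving_eval (fun _ : Fin n => P) l
  have h2 : ProbabilityTheory.IndepFun (fun s : Fin n → E => u (s l))
      (fun s : Fin n → E => v (s l')) (Measure.pi fun _ => P) := by
    refine ProbabilityTheory.IndepFun.comp₀ (hind.indepFun hne)
      (measurable_pi_apply l).aemeasurable (measurable_pi_apply l').aemeasurable ?_ ?_
    · change AEMeasurable u (Measure.map (Function.eval l) (Measure.pi fun _ => P))
      rw [(hm l).map_eq]
      exact hu.aemeasurable
    · change AEMeasurable v (Measure.map (Function.eval l') (Measure.pi fun _ => P))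
      rw [(hm l').map_eq]
      exact hv.aemeasurable
  rw [h2.integral_fun_mul_eq_mul_integral (hu.comp_measurePreserving (hm l))
    (hv.comp_measurePreserving (hm l')), integral_pi_eval hu, integral_pi_eval hv]

/-- Distinct observations are independent, so the off-diagonal products factor and vanish as soon as
one of the two functions is centred; the n diagonal products remain. -/
theorem integral_sum_mul_sum {u v : E → ℝ} (hu : MemLp u 2 P) (hv : MemLp v 2 P)
    (hu0 : ∫ o, u o ∂P = 0) :
    ∫ s : Fin n → E, (∑ l, u (s l)) * ∑ l, v (s l) ∂(Measure.pi fun _ => P) =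
      n * ∫ o, u o * v o ∂P := by
  have hint : ∀ l l' : Fin n, Integrable (fun s : Fin n → E => u (s l) * v (s l'))
      (Measure.pi fun _ => P) := fun l l' =>
    (memLp_pi_eval hu l).integrable_mul (memLp_pi_eval hv l')
  simp_rw [Finset.sum_mul_sum]
  rw [integral_finsetSum _ fun l _ => integrable_finsetSum _ fun l' _ => hint l l']
  have h : ∀ l : Fin n, ∫ s : Fin n → E, ∑ l', u (s l) * v (s l') ∂(Measure.pi fun _ => P) =
      ∫ o, u o * v o ∂P := by
    intro l
    rw [integral_finsetSum _ fun l' _ => hint l l', Finset.sum_eq_single l]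
    · exact integral_pi_eval (u := fun o => u o * v o) (hu.integrable_mul hv).aestronglyMeasurable l
    · intro l' _ hne
      rw [integral_pi_mul_of_ne hu.aestronglyMeasurable hv.aestronglyMeasurable hne.symm, hu0,
        zero_mul]
    · simp
  rw [Finset.sum_congr rfl fun l _ => h l]
  simp

end Sums

/-! ### Compactly supported densities with nearly Gaussian Fisher information -/

/-- `q` is an even continuously differentiable probability density on `[-1,1]` with variance `V`,
score `τ` and Fisher information `J`. -/
structure IsPrior (q τ : ℝ → ℝ) (V J : ℝ) : Prop where
  nonneg : ∀ x, 0 ≤ q x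
  hasDerivAt : ∀ x, HasDerivAt q (τ x * q x) x
  measurable_score : Measurable τ
  even : ∀ x, q (-x) = q x
  support : ∀ x, x ∉ Icc (-1 : ℝ) 1 → q x = 0
  total : ∫ x, q x = 1
  var : ∫ x, x ^ 2 * q x = V
  info : ∫ x, τ x ^ 2 * q x = J
  integrable_info : Integrable fun x => τ x ^ 2 * q x
  var_pos : 0 < V

/-- `(1 - x²)₊ ^ k`. -/
def bump (k : ℕ) (x : ℝ) : ℝ := max 0 (1 - x ^ 2) ^ k

/-- The mass of `bump k`. -/
def bumpMass (k : ℕ) : ℝ := ∫ x in (-1 : ℝ)..1, (1 - x ^ 2) ^ k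

/-- A power at least 2 of the positive part is continuously differentiable. -/
theorem hasDerivAt_max_pow (k : ℕ) (y : ℝ) :
    HasDerivAt (fun y : ℝ => max 0 y ^ (k + 2)) ((k + 2) * max 0 y ^ (k + 1)) y := by
  rcases lt_trichotomy y 0 with hy | rfl | hy
  · have h : (fun y : ℝ => max 0 y ^ (k + 2)) =ᶠ[𝓝 y] fun _ => 0 := by
      filter_upwards [eventually_lt_nhds hy] with z hz
      rw [max_eq_left hz.le, zero_pow (by omega)]
    refine ((hasDerivAt_const y (0 : ℝ)).congr_of_eventuallyEq h).congr_deriv ?_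
    rw [max_eq_left hy.le, zero_pow (by omega), mul_zero]
  -- At the corner the difference quotient equals the positive part to the power k + 1, which tends
  -- to 0.
  · rw [hasDerivAt_iff_tendsto_slope]
    have h : Tendsto (fun z : ℝ => max 0 z ^ (k + 1)) (𝓝 0) (𝓝 (max 0 0 ^ (k + 1))) :=
      Continuous.tendsto (by fun_prop) _
    simp only [max_self, zero_pow (Nat.succ_ne_zero k), mul_zero] at h ⊢
    refine (h.mono_left nhdsWithin_le_nhds).congr' ?_
    filter_upwards [self_mem_nhdsWithin] with z hz
    have hz : z ≠ 0 := hz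
    rw [slope_def_field]
    rcases le_total z 0 with h0 | h0
    · simp [max_eq_left h0]
    · simp only [max_eq_right h0, max_self, sub_zero]
      rw [zero_pow (by omega), pow_succ z (k + 1)]
      field_simp
      ring
  · have h : (fun y : ℝ => max 0 y ^ (k + 2)) =ᶠ[𝓝 y] fun y => y ^ (k + 2) := by
      filter_upwards [eventually_gt_nhds hy] with z hz
      rw [max_eq_right hz.le]
    refine ((hasDerivAt_pow (k + 2) y).congr_of_eventuallyEq h).congr_deriv ?_
    rw [max_eq_right hy.le]
    push_cast
    rfl

theorem integral_mul_bump (F : ℝ → ℝ) (k : ℕ) :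
    ∫ x, F x * bump (k + 1) x = ∫ x in (-1 : ℝ)..1, F x * (1 - x ^ 2) ^ (k + 1) := by
  rw [intervalIntegral.integral_of_le (by norm_num), ← integral_Icc_eq_integral_Ioc,
    ← setIntegral_eq_integral_of_forall_compl_eq_zero (s := Icc (-1 : ℝ) 1)]
  · refine setIntegral_congr_fun measurableSet_Icc fun x hx => ?_
    have : 0 ≤ 1 - x ^ 2 := by nlinarith [hx.1, hx.2]
    simp only [bump, max_eq_right this]
  · intro x hx
    have : 1 - x ^ 2 ≤ 0 := by
      by_contra h
      exact hx ⟨by nlinarith, by nlinarith⟩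
    simp [bump, max_eq_left this]

/-- The function x(1 - x²)^{k+1} vanishes at ±1, so its derivative has integral zero. This recursion
yields both the variance and the information without evaluating any mass. -/
theorem bumpMass_succ (k : ℕ) : (2 * k + 3) * bumpMass (k + 1) = (2 * k + 2) * bumpMass k := by
  have hd : ∀ x ∈ uIcc (-1 : ℝ) 1, HasDerivAt (fun x : ℝ => x * (1 - x ^ 2) ^ (k + 1))
      ((2 * k + 3) * (1 - x ^ 2) ^ (k + 1) - (2 * k + 2) * (1 - x ^ 2) ^ k) x := by
    intro x _
    have h1 : HasDerivAt (fun x : ℝ => 1 - x ^ 2) (-(2 * x)) x := by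
      simpa using (hasDerivAt_pow 2 x).const_sub 1
    refine ((hasDerivAt_id x).mul (h1.pow (k + 1))).congr_deriv ?_
    simp only [id, Nat.add_sub_cancel, one_mul, Pi.pow_apply]
    push_cast
    ring
  have h := intervalIntegral.integral_eq_sub_of_hasDerivAt hd
    (Continuous.intervalIntegrable (by fun_prop) _ _)
  rw [intervalIntegral.integral_sub (Continuous.intervalIntegrable (by fun_prop) _ _)
    (Continuous.intervalIntegrable (by fun_prop) _ _), intervalIntegral.integral_const_mul,
    intervalIntegral.integral_const_mul] at h
  norm_num at h
  have := sub_eq_zero.1 h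
  exact this

theorem integral_sq_mul_bumpMass (k : ℕ) :
    ∫ x in (-1 : ℝ)..1, x ^ 2 * (1 - x ^ 2) ^ k = bumpMass k / (2 * k + 3) := by
  have h : ∫ x in (-1 : ℝ)..1, x ^ 2 * (1 - x ^ 2) ^ k = bumpMass k - bumpMass (k + 1) := by
    rw [bumpMass, bumpMass, ← intervalIntegral.integral_sub
      (Continuous.intervalIntegrable (by fun_prop) _ _)
      (Continuous.intervalIntegrable (by fun_prop) _ _)]
    congr 1
    ext x
    ring
  have h2 := bumpMass_succ k
  rw [h, eq_div_iff (by positivity)]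
  linarith

theorem bumpMass_pos (k : ℕ) : 0 < bumpMass k := by
  induction k with
  | zero => simp [bumpMass]
  | succ k ih =>
    have h := bumpMass_succ k
    have : 0 < (2 * (k : ℝ) + 3) * bumpMass (k + 1) := by rw [h]; positivity
    exact pos_of_mul_pos_right this (by positivity)

theorem continuous_bump (k : ℕ) : Continuous (bump k) := by
  unfold bump
  fun_prop

theorem bump_eq_zero {k : ℕ} {x : ℝ} (hx : x ∉ Icc (-1 : ℝ) 1) : bump (k + 1) x = 0 := by
  have : 1 - x ^ 2 ≤ 0 := by
    by_contra h
    exact hx ⟨by nlinarith, by nlinarith⟩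
  simp [bump, max_eq_left this]

theorem hasCompactSupport_of_Icc {F : ℝ → ℝ} (hF : ∀ x, x ∉ Icc (-1 : ℝ) 1 → F x = 0) :
    HasCompactSupport F := HasCompactSupport.intro isCompact_Icc hF

/-- For the density proportional to (1 - x²)^{k+3}, the squared score times the density is
proportional to x²(1 - x²)^{k+1}, so V and J are ratios of consecutive masses. Off (-1,1) the
quotient defining the score carries no meaning, but there it only ever multiplies a zero density. -/
theorem isPrior_bump (k : ℕ) :
    IsPrior (fun x => (bumpMass (k + 3))⁻¹ * bump (k + 3) x)
      (fun x => -(2 * (k + 3) * x) / (1 - x ^ 2)) (1 / (2 * k + 9))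
      ((k + 3) * (2 * k + 7) / (k + 2)) := by
  have hZ := bumpMass_pos (k + 3)
  have hscore : ∀ x : ℝ, (-(2 * (k + 3) * x) / (1 - x ^ 2)) * bump (k + 3) x =
      -(2 * (k + 3) * x) * bump (k + 2) x := by
    intro x
    rcases lt_or_ge 0 (1 - x ^ 2) with h | h
    · rw [bump, bump, max_eq_right h.le, pow_succ _ (k + 2)]
      field_simp
    · simp [bump, max_eq_left h]
  have hscore2 : ∀ x : ℝ, (-(2 * (k + 3) * x) / (1 - x ^ 2)) ^ 2 * bump (k + 3) x =
      (4 * (k + 3) ^ 2 * x ^ 2) * bump (k + 1) x := by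
    intro x
    rcases lt_or_ge 0 (1 - x ^ 2) with h | h
    · rw [bump, bump, max_eq_right h.le, pow_add _ (k + 1) 2]
      field_simp
      ring
    · simp [bump, max_eq_left h]
  have hinfo : ∀ x : ℝ, (-(2 * (k + 3) * x) / (1 - x ^ 2)) ^ 2 *
      ((bumpMass (k + 3))⁻¹ * bump (k + 3) x) =
      (bumpMass (k + 3))⁻¹ * (4 * (k + 3) ^ 2) * (x ^ 2 * bump (k + 1) x) := by
    intro x
    rw [mul_left_comm, hscore2]
    ring
  refine ⟨fun x => ?_, fun x => ?_, ?_, fun x => ?_, fun x hx => ?_, ?_, ?_, ?_, ?_, ?_⟩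
  · exact mul_nonneg (inv_nonneg.2 hZ.le) (pow_nonneg (le_max_left _ _) _)
  · have h1 : HasDerivAt (fun x : ℝ => 1 - x ^ 2) (-(2 * x)) x := by
      simpa using (hasDerivAt_pow 2 x).const_sub 1
    have h2 := ((hasDerivAt_max_pow (k + 1) (1 - x ^ 2)).comp x h1).const_mul
      (bumpMass (k + 3))⁻¹
    refine h2.congr_deriv ?_
    rw [mul_left_comm (_ / _), hscore, bump]
    push_cast
    ring
  · fun_prop
  · simp [bump]
  · simp [bump_eq_zero hx]
  · rw [integral_const_mul]
    have := integral_mul_bump (fun _ => 1) (k + 2)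
    simp only [one_mul] at this
    rw [this]
    exact inv_mul_cancel₀ hZ.ne'
  · simp_rw [mul_left_comm _ (bumpMass (k + 3))⁻¹]
    rw [integral_const_mul, integral_mul_bump (fun x => x ^ 2) (k + 2), integral_sq_mul_bumpMass]
    push_cast
    field_simp
    ring
  · simp_rw [hinfo]
    rw [integral_const_mul, integral_mul_bump (fun x => x ^ 2) k, integral_sq_mul_bumpMass]
    have h1 := bumpMass_succ (k + 1)
    have h2 := bumpMass_succ (k + 2)
    have h0 := bumpMass_pos (k + 1)
    push_cast at h1 h2 ⊢
    have e1 : bumpMass (k + 1 + 1) = (2 * (k + 1) + 2) * bumpMass (k + 1) / (2 * (k + 1) + 3) := by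
      rw [eq_div_iff (by positivity), mul_comm]
      exact h1
    have e2 : bumpMass (k + 3) = (2 * (k + 2) + 2) * bumpMass (k + 2) / (2 * (k + 2) + 3) := by
      rw [eq_div_iff (by positivity), mul_comm]
      exact h2
    rw [e2, e1]
    field_simp
    ring
  · simp_rw [hinfo]
    refine Integrable.const_mul (Continuous.integrable_of_hasCompactSupport
      ((continuous_pow 2).mul (continuous_bump _)) ?_) _
    exact hasCompactSupport_of_Icc fun x hx => by simp [bump_eq_zero hx]
  · positivity

/-- Here VJ = 1 + 3/((k+2)(2k+9)), which tends to 1. The value 1 is that of a Gaussian; the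
densities here approach it while keeping bounded support. -/
theorem exists_isPrior {ε : ℝ} (hε : 0 < ε) :
    ∃ (q τ : ℝ → ℝ) (V J : ℝ), IsPrior q τ V J ∧ V * J ≤ 1 + ε := by
  obtain ⟨k, hk⟩ := exists_nat_gt (1 / ε)
  refine ⟨_, _, _, _, isPrior_bump k, ?_⟩
  have hk' : 1 < k * ε := by rwa [div_lt_iff₀ hε] at hk
  rw [one_div_mul_eq_div, div_div, div_le_iff₀ (by positivity)]
  have h0 : (0 : ℝ) ≤ k := Nat.cast_nonneg k
  nlinarith [mul_nonneg h0 hε.le]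

namespace IsPrior

variable {q τ : ℝ → ℝ} {V J : ℝ} (hq : IsPrior q τ V J)

include hq

theorem continuous : Continuous q :=
  continuous_iff_continuousAt.2 fun x => (hq.hasDerivAt x).continuousAt

theorem integrable : Integrable q :=
  hq.continuous.integrable_of_hasCompactSupport (hasCompactSupport_of_Icc hq.support)

theorem integrable_score_mul : Integrable fun x => τ x * q x := by
  refine (hq.integrable.add hq.integrable_info).mono'
    (hq.measurable_score.mul hq.continuous.measurable).aestronglyMeasurable
    (ae_of_all _ fun x => ?_)
  rw [norm_mul, Real.norm_of_nonneg (hq.nonneg x), Real.norm_eq_abs, Pi.add_apply]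
  have h : |τ x| ≤ 1 + τ x ^ 2 := by
    rw [← sq_abs]
    nlinarith [sq_nonneg (|τ x| - 1)]
  nlinarith [mul_le_mul_of_nonneg_right h (hq.nonneg x)]

theorem integral_score_mul : ∫ x, τ x * q x = 0 :=
  integral_eq_zero_of_hasDerivAt_of_integrable hq.hasDerivAt hq.integrable_score_mul hq.integrable

theorem integral_id_mul : ∫ x, x * q x = 0 := by
  have h := integral_neg_eq_self (fun x => x * q x) volume
  simp only [hq.even, neg_mul] at h
  rw [integral_neg] at h
  linarith

end IsPrior

/-- The probability measure with density `q`. -/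
def priorMeasure (q : ℝ → ℝ) : Measure ℝ := volume.withDensity fun x => ENNReal.ofReal (q x)

namespace IsPrior

variable {q τ : ℝ → ℝ} {V J : ℝ} (hq : IsPrior q τ V J)

include hq

theorem isProbabilityMeasure : IsProbabilityMeasure (priorMeasure q) := by
  refine ⟨?_⟩
  rw [priorMeasure, withDensity_apply _ MeasurableSet.univ, setLIntegral_univ,
    ← ofReal_integral_eq_lintegral_ofReal hq.integrable (ae_of_all _ hq.nonneg), hq.total,
    ENNReal.ofReal_one]

theorem ae_mem_Icc : ∀ᵐ x ∂(priorMeasure q), x ∈ Icc (-1 : ℝ) 1 := by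
  have := hq.continuous.measurable
  rw [priorMeasure, ae_withDensity_iff (by fun_prop)]
  refine ae_of_all _ fun x hx => ?_
  by_contra h
  exact hx (by rw [hq.support _ h, ENNReal.ofReal_zero])

theorem integral_priorMeasure (F : ℝ → ℝ) : ∫ x, F x ∂(priorMeasure q) = ∫ x, F x * q x := by
  have := hq.continuous.measurable
  rw [priorMeasure, integral_withDensity_eq_integral_toReal_smul (by fun_prop)
    (ae_of_all _ fun _ => ENNReal.ofReal_lt_top)]
  refine integral_congr_ae (ae_of_all _ fun x => ?_)
  simp only [ENNReal.toReal_ofReal (hq.nonneg x), smul_eq_mul, mul_comm]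

theorem integrable_priorMeasure_iff {F : ℝ → ℝ} :
    Integrable F (priorMeasure q) ↔ Integrable fun x => F x * q x := by
  have := hq.continuous.measurable
  rw [priorMeasure, integrable_withDensity_iff_integrable_smul' (by fun_prop)
    (ae_of_all _ fun _ => ENNReal.ofReal_lt_top)]
  refine integrable_congr (ae_of_all _ fun x => ?_)
  simp only [ENNReal.toReal_ofReal (hq.nonneg x), smul_eq_mul, mul_comm]

theorem memLp_score : MemLp τ 2 (priorMeasure q) := by
  rw [memLp_two_iff_integrable_sq hq.measurable_score.aestronglyMeasurable,
    hq.integrable_priorMeasure_iff]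
  exact hq.integrable_info

theorem memLp_id : MemLp (fun x : ℝ => x) 2 (priorMeasure q) := by
  have := hq.isProbabilityMeasure
  refine MemLp.of_bound measurable_id.aestronglyMeasurable 1 ?_
  filter_upwards [hq.ae_mem_Icc] with x hx
  exact abs_le.2 hx

end IsPrior

/-! ### Finite-dimensional submodels with a product prior -/

/-- If the function is not integrable, the left side is 0 by convention, so no integrability is
needed when a signed lower bound is integrated into an extended risk. -/
theorem ofReal_integral_le_lintegral_ofReal {E : Type*} [MeasurableSpace E] (μ : Measure E)
    (F : E → ℝ) : ENNReal.ofReal (∫ x, F x ∂μ) ≤ ∫⁻ x, ENNReal.ofReal (F x) ∂μ := by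
  by_cases hF : Integrable F μ
  · have h : ∫ x, F x ∂μ ≤ ∫ x, max (F x) 0 ∂μ :=
      integral_mono hF hF.pos_part fun x => le_max_left _ _
    refine (ENNReal.ofReal_le_ofReal h).trans ?_
    rw [ofReal_integral_eq_lintegral_ofReal hF.pos_part (ae_of_all _ fun x => le_max_right _ _)]
    refine lintegral_mono fun x => ?_
    rw [ENNReal.ofReal_max, ENNReal.ofReal_zero, max_eq_left (zero_le)]
  · simp [integral_undef hF]

/-- The cube of the parameters. -/
def paramBox (k : ℕ) : Set (Fin k → ℝ) := {ξ | ∀ i, ξ i ∈ Icc (-1 : ℝ) 1}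

/-- The regression function with parameter `ξ`. -/
def curve {k : ℕ} (S : ℝ → ℝ) (e : Fin k → ℝ → ℝ) (ξ : Fin k → ℝ) (x : ℝ) : ℝ :=
  S x + ∑ i, ξ i * e i x

/-- The product prior with marginal density `q`. -/
def prior (k : ℕ) (q : ℝ → ℝ) : Measure (Fin k → ℝ) := Measure.pi fun _ => priorMeasure q

/-- The functions `S + ∑ ξᵢ eᵢ`, for `ξ` in the cube, form a regular submodel in which the
conditional variances are bounded below by `1 / C` and the directions are bounded by `B`. -/
structure IsSubmodel {D k : ℕ} (m : Model) (p : ℝ × (Fin D → ℝ) → ℝ) (g : (Fin D → ℝ) → ℝ)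
    (S : ℝ → ℝ) (e : Fin k → ℝ → ℝ) (C B : ℝ) : Prop where
  density : IsDesignDensity p
  measurable_g : Measurable g
  measurable_S : Measurable S
  measurable_e : ∀ i, Measurable (e i)
  abs_e_le : ∀ i x, |e i x| ≤ B
  regular : ∀ ξ ∈ paramBox k, m.Regular g (curve S e ξ)
  inv_variance_le : ∀ ξ ∈ paramBox k, ∀ w ∈ cube D,
    (m.variance (curve S e ξ w.1 + g w.2))⁻¹ ≤ C

/-! ### Density and score moments of the product prior. -/

section Prior

variable {k : ℕ} {q τ : ℝ → ℝ} {V J : ℝ} (hq : IsPrior q τ V J)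

include hq

theorem IsPrior.prior_eq_withDensity :
    prior k q = (volume : Measure (Fin k → ℝ)).withDensity
      fun ξ => ENNReal.ofReal (∏ i, q (ξ i)) := by
  have hm := hq.continuous.measurable
  have h : ∀ _ : Fin k, SigmaFinite ((volume : Measure ℝ).withDensity fun x =>
      ENNReal.ofReal (q x)) := fun _ => SigmaFinite.withDensity_ofReal _
  unfold prior priorMeasure
  rw [pi_withDensity (n := k) (volume : Measure ℝ) (fun _ x => ENNReal.ofReal (q x))
    fun _ => by fun_prop, ← volume_pi]
  congr 1
  ext ξ
  rw [ENNReal.ofReal_prod_of_nonneg fun i _ => hq.nonneg _]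

theorem IsPrior.isProbabilityMeasure_prior : IsProbabilityMeasure (prior k q) := by
  have := hq.isProbabilityMeasure
  unfold prior
  infer_instance

theorem IsPrior.ae_mem_paramBox : ∀ᵐ ξ ∂(prior k q), ξ ∈ paramBox k := by
  have := hq.isProbabilityMeasure
  exact ae_all_iff.2 fun i => (Measure.quasiMeasurePreserving_eval
    (μ := fun _ : Fin k => priorMeasure q) i).ae hq.ae_mem_Icc

theorem IsPrior.prod_eq_zero {ξ : Fin k → ℝ} (hξ : ξ ∉ paramBox k) : ∏ i, q (ξ i) = 0 := by
  simp only [paramBox, Set.mem_ofPred_eq, not_forall] at hξ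
  obtain ⟨i, hi⟩ := hξ
  exact Finset.prod_eq_zero (Finset.mem_univ i) (hq.support _ hi)

theorem IsPrior.integral_prior (F : (Fin k → ℝ) → ℝ) :
    ∫ ξ, F ξ ∂(prior k q) = ∫ ξ, (∏ i, q (ξ i)) * F ξ := by
  have hm := hq.continuous.measurable
  rw [hq.prior_eq_withDensity, integral_withDensity_eq_integral_toReal_smul (by fun_prop)
    (ae_of_all _ fun _ => ENNReal.ofReal_lt_top)]
  refine integral_congr_ae (ae_of_all _ fun ξ => ?_)
  simp only [ENNReal.toReal_ofReal (Finset.prod_nonneg fun i _ => hq.nonneg (ξ i)), smul_eq_mul]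

theorem IsPrior.integrable_prior_iff {F : (Fin k → ℝ) → ℝ} :
    Integrable F (prior k q) ↔ Integrable fun ξ => (∏ i, q (ξ i)) * F ξ := by
  have hm := hq.continuous.measurable
  rw [hq.prior_eq_withDensity, integrable_withDensity_iff_integrable_smul' (by fun_prop)
    (ae_of_all _ fun _ => ENNReal.ofReal_lt_top)]
  refine integrable_congr (ae_of_all _ fun ξ => ?_)
  simp only [ENNReal.toReal_ofReal (Finset.prod_nonneg fun i _ => hq.nonneg (ξ i)), smul_eq_mul]

theorem IsPrior.integral_prior_score_mul_score (i j : Fin k) :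
    ∫ ξ, τ (ξ i) * τ (ξ j) ∂(prior k q) = if i = j then J else 0 := by
  have := hq.isProbabilityMeasure
  have hm := hq.memLp_score
  split_ifs with h
  · subst h
    have h2 := integral_pi_eval (P := priorMeasure q) (u := fun x => τ x * τ x)
      (hm.aestronglyMeasurable.mul hm.aestronglyMeasurable) i
    rw [prior, h2, hq.integral_priorMeasure]
    simp_rw [← sq]
    exact hq.info
  · rw [prior, integral_pi_mul_of_ne hm.aestronglyMeasurable hm.aestronglyMeasurable h,
      hq.integral_priorMeasure, hq.integral_score_mul, zero_mul]

end Prior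

/-! ### Joint score and joint density of the sample and the parameter. -/

section Sample

variable {D k n : ℕ} {m : Model} {p : ℝ × (Fin D → ℝ) → ℝ} {g : (Fin D → ℝ) → ℝ}
  {S : ℝ → ℝ} {e : Fin k → ℝ → ℝ} {C B : ℝ}

/-- The derivative of the joint log-density of the sample and the parameter in the `i`-th
parameter. -/
def jointScore (m : Model) (g : (Fin D → ℝ) → ℝ) (S : ℝ → ℝ) (e : Fin k → ℝ → ℝ) (τ : ℝ → ℝ)
    (i : Fin k) (ξ : Fin k → ℝ) (s : Fin n → Obs D) : ℝ :=
  ∑ l, m.obsScore g (curve S e ξ) (s l) * e i (s l).1.1 + τ (ξ i)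

/-- The joint density of the sample and the parameter. -/
def jointDensity (m : Model) (g : (Fin D → ℝ) → ℝ) (S : ℝ → ℝ) (e : Fin k → ℝ → ℝ) (q : ℝ → ℝ)
    (ξ : Fin k → ℝ) (s : Fin n → Obs D) : ℝ :=
  (∏ l, m.lik g (curve S e ξ) (s l)) * ∏ i, q (ξ i)

/-- The dominating measure of the sample. -/
def sampleBase (p : ℝ × (Fin D → ℝ) → ℝ) (n : ℕ) : Measure (Fin n → Obs D) :=
  Measure.pi fun _ => baseMeasure p

instance sigmaFinite_sampleBase : SigmaFinite (sampleBase p n) := by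
  unfold sampleBase
  infer_instance

theorem ae_mem_cube_sampleBase (hp : IsDesignDensity p) :
    ∀ᵐ s ∂(sampleBase p n), ∀ l, (s l).1 ∈ cube D :=
  ae_all_iff.2 fun l => (Measure.quasiMeasurePreserving_eval
    (μ := fun _ : Fin n => baseMeasure p) l).ae (ae_mem_cube_baseMeasure hp)

theorem Model.sampleLaw_eq_withDensity {f : ℝ → ℝ} (hp : Measurable p) (hg : Measurable g)
    (hf : Measurable f) : m.sampleLaw p g f n =
      (sampleBase p n).withDensity fun s => ∏ l, ENNReal.ofReal (m.lik g f (s l)) := by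
  have hl : Measurable (m.lik g f : Obs D → ℝ) := Model.measurable_lik hg hf
  have h : ∀ _ : Fin n, SigmaFinite ((baseMeasure p).withDensity fun o =>
      ENNReal.ofReal (m.lik g f o)) := fun _ => SigmaFinite.withDensity_ofReal _
  unfold Model.sampleLaw sampleBase
  rw [Model.obsLaw_eq_withDensity hp hg hf]
  exact pi_withDensity (n := n) (baseMeasure p) (fun _ o => ENNReal.ofReal (m.lik g f o))
    fun _ => by fun_prop

namespace IsSubmodel

variable (h : IsSubmodel m p g S e C B)

include h

theorem measurable_curve (ξ : Fin k → ℝ) : Measurable (curve S e ξ) := by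
  have := h.measurable_S
  have := h.measurable_e
  unfold curve
  fun_prop

theorem isProbabilityMeasure_obsLaw {ξ : Fin k → ℝ} (hξ : ξ ∈ paramBox k) :
    IsProbabilityMeasure (m.obsLaw p g (curve S e ξ)) :=
  (h.regular ξ hξ).isProbabilityMeasure_obsLaw h.density h.measurable_g (h.measurable_curve ξ)

theorem isProbabilityMeasure_sampleLaw {ξ : Fin k → ℝ} (hξ : ξ ∈ paramBox k) :
    IsProbabilityMeasure (m.sampleLaw p g (curve S e ξ) n) := by
  have := h.isProbabilityMeasure_obsLaw hξ
  unfold Model.sampleLaw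
  infer_instance

theorem memLp_score {ξ : Fin k → ℝ} (hξ : ξ ∈ paramBox k) (i : Fin k) :
    MemLp (fun o : Obs D => m.obsScore g (curve S e ξ) o * e i o.1.1) 2
      (m.obsLaw p g (curve S e ξ)) :=
  Model.memLp_obsScore_mul h.density h.measurable_g (h.measurable_curve ξ) (h.regular ξ hξ)
    (h.inv_variance_le ξ hξ) (h.measurable_e i) (h.abs_e_le i)

theorem integral_score {ξ : Fin k → ℝ} (hξ : ξ ∈ paramBox k) (i : Fin k) :
    ∫ o : Obs D, m.obsScore g (curve S e ξ) o * e i o.1.1 ∂(m.obsLaw p g (curve S e ξ)) = 0 :=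
  Model.integral_obsScore_mul h.density h.measurable_g (h.measurable_curve ξ) (h.regular ξ hξ)
    (h.inv_variance_le ξ hξ) (h.measurable_e i) (h.abs_e_le i)

theorem integral_score_mul_score {ξ : Fin k → ℝ} (hξ : ξ ∈ paramBox k) (i j : Fin k) :
    ∫ o : Obs D, (m.obsScore g (curve S e ξ) o * e i o.1.1) *
        (m.obsScore g (curve S e ξ) o * e j o.1.1) ∂(m.obsLaw p g (curve S e ξ)) =
      ∫ x in (0 : ℝ)..1, m.info p g (curve S e ξ) x * (e i x * e j x) := by
  rw [← Model.integral_obsScore_sq_mul h.density h.measurable_g (h.measurable_curve ξ)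
    (h.regular ξ hξ) (h.inv_variance_le ξ hξ) (c := fun x => e i x * e j x)
    ((h.measurable_e i).mul (h.measurable_e j)) (B := B * B) fun x => by
      rw [abs_mul]
      exact mul_le_mul (h.abs_e_le i x) (h.abs_e_le j x) (abs_nonneg _)
        ((abs_nonneg _).trans (h.abs_e_le i x))]
  refine integral_congr_ae (ae_of_all _ fun o => ?_)
  ring

theorem memLp_jointScore {τ : ℝ → ℝ} {ξ : Fin k → ℝ} (hξ : ξ ∈ paramBox k) (i : Fin k) :
    MemLp (fun s : Fin n → Obs D => jointScore m g S e τ i ξ s) 2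
      (m.sampleLaw p g (curve S e ξ) n) := by
  have := h.isProbabilityMeasure_obsLaw hξ
  have := h.isProbabilityMeasure_sampleLaw (n := n) hξ
  exact (memLp_finsetSum _ fun l _ => memLp_pi_eval (h.memLp_score hξ i) l).add (memLp_const _)

/-- For fixed ξ the score of the sample is centred, so it is uncorrelated with the constant prior
score; the information of the n observations adds up. -/
theorem integral_jointScore_mul {τ : ℝ → ℝ} {ξ : Fin k → ℝ} (hξ : ξ ∈ paramBox k)
    (i j : Fin k) :
    ∫ s : Fin n → Obs D, jointScore m g S e τ i ξ s * jointScore m g S e τ j ξ s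
        ∂(m.sampleLaw p g (curve S e ξ) n) =
      n * (∫ x in (0 : ℝ)..1, m.info p g (curve S e ξ) x * (e i x * e j x)) +
        τ (ξ i) * τ (ξ j) := by
  have := h.isProbabilityMeasure_obsLaw hξ
  have := h.isProbabilityMeasure_sampleLaw (n := n) hξ
  unfold Model.sampleLaw at this ⊢
  have hL : ∀ i : Fin k, MemLp (fun s : Fin n → Obs D =>
      ∑ l, m.obsScore g (curve S e ξ) (s l) * e i (s l).1.1) 2
      (Measure.pi fun _ => m.obsLaw p g (curve S e ξ)) := fun i =>
    memLp_finsetSum _ fun l _ => memLp_pi_eval (h.memLp_score hξ i) l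
  have h0 : ∀ i : Fin k, ∫ s : Fin n → Obs D,
      ∑ l, m.obsScore g (curve S e ξ) (s l) * e i (s l).1.1
      ∂(Measure.pi fun _ => m.obsLaw p g (curve S e ξ)) = 0 := by
    intro i
    rw [integral_finsetSum _ fun l _ =>
      (memLp_pi_eval (h.memLp_score hξ i) l).integrable one_le_two]
    refine Finset.sum_eq_zero fun l _ => ?_
    exact (integral_pi_eval (h.memLp_score hξ i).aestronglyMeasurable l).trans
      (h.integral_score hξ i)
  rw [← h.integral_score_mul_score hξ, ← integral_sum_mul_sum (n := n) (h.memLp_score hξ i)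
    (h.memLp_score hξ j) (h.integral_score hξ i)]
  have e1 : ∀ s : Fin n → Obs D, jointScore m g S e τ i ξ s * jointScore m g S e τ j ξ s =
      (∑ l, m.obsScore g (curve S e ξ) (s l) * e i (s l).1.1) *
        (∑ l, m.obsScore g (curve S e ξ) (s l) * e j (s l).1.1) +
      ((∑ l, m.obsScore g (curve S e ξ) (s l) * e i (s l).1.1) * τ (ξ j) +
      (τ (ξ i) * (∑ l, m.obsScore g (curve S e ξ) (s l) * e j (s l).1.1) +
        τ (ξ i) * τ (ξ j))) := fun s => by
    rw [jointScore, jointScore]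
    ring
  simp_rw [e1]
  have i1 : Integrable (fun s : Fin n → Obs D =>
      (∑ l, m.obsScore g (curve S e ξ) (s l) * e i (s l).1.1) *
        (∑ l, m.obsScore g (curve S e ξ) (s l) * e j (s l).1.1))
      (Measure.pi fun _ => m.obsLaw p g (curve S e ξ)) := (hL i).integrable_mul (hL j)
  have i2 := ((hL i).integrable one_le_two).mul_const (τ (ξ j))
  have i3 := ((hL j).integrable one_le_two).const_mul (τ (ξ i))
  rw [integral_add i1 (i2.fun_add (i3.fun_add (integrable_const _))),
    integral_add i2 (i3.fun_add (integrable_const _)), integral_add i3 (integrable_const _),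
    integral_mul_const, integral_const_mul, h0, h0]
  simp

/-- A crude bound, uniform in ξ apart from the prior score, whose only purpose is to dominate the
integrand in Fubini's theorem. It uses |s| ≤ 1 + s². -/
theorem integral_abs_jointScore_le {τ : ℝ → ℝ} {ξ : Fin k → ℝ} (hξ : ξ ∈ paramBox k)
    (i : Fin k) :
    ∫ s : Fin n → Obs D, |jointScore m g S e τ i ξ s| ∂(m.sampleLaw p g (curve S e ξ) n) ≤
      n * (B * (1 + C)) + |τ (ξ i)| := by
  have := h.isProbabilityMeasure_obsLaw hξ
  have := h.isProbabilityMeasure_sampleLaw (n := n) hξ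
  unfold Model.sampleLaw at this ⊢
  have hu := h.memLp_score hξ i
  have hui := fun l : Fin n => ((memLp_pi_eval hu l).integrable one_le_two).abs
  have hB : 0 ≤ B := (abs_nonneg _).trans (h.abs_e_le i 0)
  have hj := h.memLp_jointScore (n := n) (τ := τ) hξ i
  unfold Model.sampleLaw at hj
  have h1 : ∫ o : Obs D, |m.obsScore g (curve S e ξ) o * e i o.1.1|
      ∂(m.obsLaw p g (curve S e ξ)) ≤ B * (1 + C) := by
    have hs := Model.memLp_obsScore_mul h.density h.measurable_g (h.measurable_curve ξ)
      (h.regular ξ hξ) (h.inv_variance_le ξ hξ) (c := fun _ => 1) measurable_const (B := 1)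
      (fun _ => by simp)
    simp only [mul_one] at hs
    calc _ ≤ ∫ o : Obs D, B * (1 + m.obsScore g (curve S e ξ) o ^ 2)
          ∂(m.obsLaw p g (curve S e ξ)) := by
          refine integral_mono (hu.integrable one_le_two).abs
            (((integrable_const _).add hs.integrable_sq).const_mul B) fun o => ?_
          simp only
          rw [abs_mul, mul_comm]
          refine mul_le_mul (h.abs_e_le i _) ?_ (abs_nonneg _) hB
          rw [← sq_abs]
          nlinarith [sq_nonneg (|m.obsScore g (curve S e ξ) o| - 1)]
      _ ≤ B * (1 + C) := by
          rw [integral_const_mul, integral_add (integrable_const _) hs.integrable_sq]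
          refine mul_le_mul_of_nonneg_left ?_ hB
          simp only [integral_const, probReal_univ, smul_eq_mul, mul_one]
          exact add_le_add_right (Model.integral_obsScore_sq_le h.density h.measurable_g
            (h.measurable_curve ξ) (h.regular ξ hξ) (h.inv_variance_le ξ hξ)) 1
  calc _ ≤ ∫ s : Fin n → Obs D,
        (∑ l, |m.obsScore g (curve S e ξ) (s l) * e i (s l).1.1| + |τ (ξ i)|)
        ∂(Measure.pi fun _ => m.obsLaw p g (curve S e ξ)) := by
        refine integral_mono (hj.integrable one_le_two).abs
          ((integrable_finsetSum _ fun l _ => hui l).add (integrable_const _)) fun s => ?_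
        exact (abs_add_le _ _).trans (add_le_add_left (Finset.abs_sum_le_sum_abs _ _) _)
    _ = n * (∫ o : Obs D, |m.obsScore g (curve S e ξ) o * e i o.1.1|
          ∂(m.obsLaw p g (curve S e ξ))) + |τ (ξ i)| := by
        rw [integral_add (integrable_finsetSum _ fun l _ => hui l) (integrable_const _),
          integral_finsetSum _ fun l _ => hui l]
        have h2 := fun l : Fin n => integral_pi_eval (P := m.obsLaw p g (curve S e ξ))
          (u := fun o : Obs D => |m.obsScore g (curve S e ξ) o * e i o.1.1|)
          hu.aestronglyMeasurable.norm l
        rw [Finset.sum_congr rfl fun l _ => h2 l]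
        simp
    _ ≤ _ := by gcongr

end IsSubmodel

end Sample

/-! ### Integration by parts against the joint density -/

section JointDensity

variable {D k n : ℕ} {m : Model} {p : ℝ × (Fin D → ℝ) → ℝ} {g : (Fin D → ℝ) → ℝ}
  {S : ℝ → ℝ} {e : Fin k → ℝ → ℝ} {C B : ℝ} {q τ : ℝ → ℝ} {V J : ℝ}

theorem curve_add_smul_single (ξ : Fin k → ℝ) (i : Fin k) (t x : ℝ) :
    curve S e (ξ + t • Pi.single i 1) x = curve S e ξ x + t * e i x := by
  simp only [curve, Pi.add_apply, Pi.smul_apply, smul_eq_mul, add_mul, Finset.sum_add_distrib,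
    Pi.single_apply, mul_ite, mul_one, mul_zero, ite_mul, zero_mul, Finset.sum_ite_eq',
    Finset.mem_univ, if_true, add_assoc]

namespace IsSubmodel

variable (h : IsSubmodel m p g S e C B) (hq : IsPrior q τ V J)

include h

theorem measurable_lik (l : Fin n) : Measurable fun z : (Fin k → ℝ) × (Fin n → Obs D) =>
    m.lik g (curve S e z.1) (z.2 l) := by
  have := h.measurable_S
  have := h.measurable_e
  have := h.measurable_g
  unfold Model.lik curve
  exact m.measurable_pmf.comp (f := fun z : (Fin k → ℝ) × (Fin n → Obs D) =>
    (S (z.2 l).1.1 + ∑ i, z.1 i * e i (z.2 l).1.1 + g (z.2 l).1.2, (z.2 l).2)) (by fun_prop)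

include hq

theorem measurable_jointDensity : Measurable fun z : (Fin k → ℝ) × (Fin n → Obs D) =>
    jointDensity m g S e q z.1 z.2 := by
  have := hq.continuous.measurable
  have := h.measurable_lik (n := n)
  unfold jointDensity
  fun_prop

theorem measurable_jointScore (i : Fin k) : Measurable fun z : (Fin k → ℝ) × (Fin n → Obs D) =>
    jointScore m g S e τ i z.1 z.2 := by
  have := hq.measurable_score
  have := h.measurable_S
  have := h.measurable_e
  have := h.measurable_g
  have h1 : ∀ l, Measurable fun z : (Fin k → ℝ) × (Fin n → Obs D) =>
      m.obsScore g (curve S e z.1) (z.2 l) := fun l => by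
    unfold Model.obsScore curve
    exact m.measurable_score.comp (f := fun z : (Fin k → ℝ) × (Fin n → Obs D) =>
      (S (z.2 l).1.1 + ∑ i, z.1 i * e i (z.2 l).1.1 + g (z.2 l).1.2, (z.2 l).2)) (by fun_prop)
  unfold jointScore
  fun_prop

omit hq in
theorem integrable_sampleLaw_iff {ξ : Fin k → ℝ} (hξ : ξ ∈ paramBox k)
    {F : (Fin n → Obs D) → ℝ} : Integrable F (m.sampleLaw p g (curve S e ξ) n) ↔
      Integrable (fun s => F s * ∏ l, m.lik g (curve S e ξ) (s l)) (sampleBase p n) := by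
  have hl : Measurable (m.lik g (curve S e ξ) : Obs D → ℝ) :=
    Model.measurable_lik h.measurable_g (h.measurable_curve ξ)
  rw [Model.sampleLaw_eq_withDensity h.density.measurable h.measurable_g (h.measurable_curve ξ),
    integrable_withDensity_iff_integrable_smul' (by fun_prop)
      (ae_of_all _ fun s => ENNReal.prod_lt_top fun l _ => ENNReal.ofReal_lt_top)]
  refine integrable_congr ?_
  filter_upwards [ae_mem_cube_sampleBase (n := n) h.density] with s hs
  rw [ENNReal.toReal_prod, smul_eq_mul, mul_comm]
  congr 1
  exact Finset.prod_congr rfl fun l _ =>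
    ENNReal.toReal_ofReal (Model.pmf_nonneg (h.regular ξ hξ _ (hs l)) _)

omit hq in
theorem integral_sampleLaw {ξ : Fin k → ℝ} (hξ : ξ ∈ paramBox k)
    (F : (Fin n → Obs D) → ℝ) : ∫ s, F s ∂(m.sampleLaw p g (curve S e ξ) n) =
      ∫ s, F s * ∏ l, m.lik g (curve S e ξ) (s l) ∂(sampleBase p n) := by
  have hl : Measurable (m.lik g (curve S e ξ) : Obs D → ℝ) :=
    Model.measurable_lik h.measurable_g (h.measurable_curve ξ)
  rw [Model.sampleLaw_eq_withDensity h.density.measurable h.measurable_g (h.measurable_curve ξ),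
    integral_withDensity_eq_integral_toReal_smul (by fun_prop)
      (ae_of_all _ fun s => ENNReal.prod_lt_top fun l _ => ENNReal.ofReal_lt_top)]
  refine integral_congr_ae ?_
  filter_upwards [ae_mem_cube_sampleBase (n := n) h.density] with s hs
  rw [ENNReal.toReal_prod, smul_eq_mul, mul_comm]
  congr 1
  exact Finset.prod_congr rfl fun l _ =>
    ENNReal.toReal_ofReal (Model.pmf_nonneg (h.regular ξ hξ _ (hs l)) _)

theorem integral_mul_jointDensity (ξ : Fin k → ℝ) (F : (Fin n → Obs D) → ℝ) :
    ∫ s, F s * jointDensity m g S e q ξ s ∂(sampleBase p n) =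
      (∏ i, q (ξ i)) * ∫ s, F s ∂(m.sampleLaw p g (curve S e ξ) n) := by
  by_cases hξ : ξ ∈ paramBox k
  · rw [h.integral_sampleLaw hξ, ← integral_const_mul]
    congr 1
    ext s
    rw [jointDensity]
    ring
  · simp [jointDensity, hq.prod_eq_zero hξ]

theorem integrable_joint {K : (Fin k → ℝ) → (Fin n → Obs D) → ℝ}
    (hK : Measurable (Function.uncurry K))
    (hKi : ∀ ξ ∈ paramBox k, Integrable (K ξ) (m.sampleLaw p g (curve S e ξ) n))
    {b : (Fin k → ℝ) → ℝ} (hb : Integrable b (prior k q))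
    (hKb : ∀ ξ ∈ paramBox k, ∫ s, |K ξ s| ∂(m.sampleLaw p g (curve S e ξ) n) ≤ b ξ) :
    Integrable (fun z : (Fin k → ℝ) × (Fin n → Obs D) =>
      K z.1 z.2 * jointDensity m g S e q z.1 z.2) (volume.prod (sampleBase p n)) := by
  have hm : Measurable fun z : (Fin k → ℝ) × (Fin n → Obs D) =>
      K z.1 z.2 * jointDensity m g S e q z.1 z.2 := by
    have : Measurable fun z : (Fin k → ℝ) × (Fin n → Obs D) => K z.1 z.2 := hK
    exact this.mul (h.measurable_jointDensity hq)
  rw [integrable_prod_iff hm.aestronglyMeasurable]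
  constructor
  · refine ae_of_all _ fun ξ => ?_
    by_cases hξ : ξ ∈ paramBox k
    · have h1 := ((h.integrable_sampleLaw_iff hξ).1 (hKi ξ hξ)).mul_const (∏ i, q (ξ i))
      refine h1.congr (ae_of_all _ fun s => ?_)
      simp only [jointDensity]
      ring
    · simp [jointDensity, hq.prod_eq_zero hξ]
  · refine (hq.integrable_prior_iff.1 hb).mono'
      hm.aestronglyMeasurable.norm.integral_prod_right' (ae_of_all _ fun ξ => ?_)
    rw [Real.norm_of_nonneg (integral_nonneg fun s => norm_nonneg _)]
    have hnn : 0 ≤ ∏ i, q (ξ i) := Finset.prod_nonneg fun i _ => hq.nonneg _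
    by_cases hξ : ξ ∈ paramBox k
    · calc ∫ s, ‖K ξ s * jointDensity m g S e q ξ s‖ ∂(sampleBase p n)
          = ∫ s, |K ξ s| * jointDensity m g S e q ξ s ∂(sampleBase p n) := by
            refine integral_congr_ae ?_
            filter_upwards [ae_mem_cube_sampleBase (n := n) h.density] with s hs
            rw [norm_mul, Real.norm_eq_abs, Real.norm_of_nonneg]
            exact mul_nonneg (Finset.prod_nonneg fun l _ =>
              Model.pmf_nonneg (h.regular ξ hξ _ (hs l)) _) hnn
        _ = (∏ i, q (ξ i)) * ∫ s, |K ξ s| ∂(m.sampleLaw p g (curve S e ξ) n) :=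
            h.integral_mul_jointDensity hq ξ _
        _ ≤ _ := mul_le_mul_of_nonneg_left (hKb ξ hξ) hnn
    · simp [jointDensity, hq.prod_eq_zero hξ]

theorem integral_prior_integral_sampleLaw {K : (Fin k → ℝ) → (Fin n → Obs D) → ℝ}
    (hK : Integrable (fun z : (Fin k → ℝ) × (Fin n → Obs D) =>
      K z.1 z.2 * jointDensity m g S e q z.1 z.2) (volume.prod (sampleBase p n))) :
    Integrable (fun ξ => ∫ s, K ξ s ∂(m.sampleLaw p g (curve S e ξ) n)) (prior k q) ∧
    ∫ ξ, ∫ s, K ξ s ∂(m.sampleLaw p g (curve S e ξ) n) ∂(prior k q) =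
      ∫ s, (∫ ξ, K ξ s * jointDensity m g S e q ξ s) ∂(sampleBase p n) := by
  have e1 : (fun ξ : Fin k → ℝ => (∏ i, q (ξ i)) * ∫ s, K ξ s ∂(m.sampleLaw p g (curve S e ξ) n)) =
      fun ξ => ∫ s, K ξ s * jointDensity m g S e q ξ s ∂(sampleBase p n) := by
    ext ξ
    rw [h.integral_mul_jointDensity hq]
  rw [hq.integrable_prior_iff, hq.integral_prior, e1]
  exact ⟨hK.integral_prod_left, integral_integral_swap hK⟩

omit h in
theorem continuous_jointDensity (s : Fin n → Obs D) :
    Continuous fun ξ : Fin k → ℝ => jointDensity m g S e q ξ s := by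
  have := hq.continuous
  have h1 : ∀ l, Continuous fun ξ : Fin k → ℝ => m.lik g (curve S e ξ) (s l) := fun l => by
    have h2 : Continuous fun t => m.pmf t (s l).2 :=
      continuous_iff_continuousAt.2 fun t => (m.hasDerivAt_pmf t _).continuousAt
    unfold Model.lik curve
    exact h2.comp (f := fun ξ : Fin k → ℝ => S (s l).1.1 + ∑ i, ξ i * e i (s l).1.1 +
      g (s l).1.2) (by fun_prop)
  unfold jointDensity
  fun_prop

omit h in
theorem integrable_continuous_mul_jointDensity (s : Fin n → Obs D) {F : (Fin k → ℝ) → ℝ}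
    (hF : Continuous F) : Integrable fun ξ => F ξ * jointDensity m g S e q ξ s := by
  refine (hF.mul (continuous_jointDensity hq s)).integrable_of_hasCompactSupport ?_
  refine HasCompactSupport.intro (K := univ.pi fun _ => Icc (-1 : ℝ) 1)
    (isCompact_univ_pi fun _ => isCompact_Icc) fun ξ hξ => ?_
  have : ξ ∉ paramBox k := fun h => hξ fun i _ => h i
  simp [jointDensity, hq.prod_eq_zero this]

theorem hasLineDerivAt_jointDensity {s : Fin n → Obs D} (hs : ∀ l, (s l).1 ∈ cube D)
    (i : Fin k) (ξ : Fin k → ℝ) :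
    HasLineDerivAt ℝ (fun ξ => jointDensity m g S e q ξ s)
      (jointScore m g S e τ i ξ s * jointDensity m g S e q ξ s) ξ (Pi.single i 1) := by
  have h1 : ∀ l, HasDerivAt (fun t : ℝ => m.lik g (curve S e (ξ + t • Pi.single i 1)) (s l))
      (m.dpmf (curve S e ξ (s l).1.1 + g (s l).1.2) (s l).2 * e i (s l).1.1) 0 := fun l => by
    simp only [Model.lik, curve_add_smul_single]
    have h2 : HasDerivAt (fun t : ℝ => curve S e ξ (s l).1.1 + t * e i (s l).1.1 + g (s l).1.2)
        (e i (s l).1.1) 0 := by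
      simpa using (((hasDerivAt_id (0 : ℝ)).mul_const (e i (s l).1.1)).const_add
        (curve S e ξ (s l).1.1)).add_const (g (s l).1.2)
    have h3 := m.hasDerivAt_pmf (curve S e ξ (s l).1.1 + 0 * e i (s l).1.1 + g (s l).1.2) (s l).2
    have h4 := HasDerivAt.comp (0 : ℝ) h3 h2
    simpa [Function.comp_def] using h4
  have h5 : ∀ j, HasDerivAt (fun t : ℝ => q ((ξ + t • Pi.single i 1 : Fin k → ℝ) j))
      (τ (ξ j) * q (ξ j) * (Pi.single i 1 : Fin k → ℝ) j) 0 := fun j => by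
    have h2 : HasDerivAt (fun t : ℝ => (ξ + t • Pi.single i 1 : Fin k → ℝ) j)
        ((Pi.single i 1 : Fin k → ℝ) j) 0 := by
      simpa using ((hasDerivAt_id (0 : ℝ)).mul_const ((Pi.single i 1 : Fin k → ℝ) j)).const_add
        (ξ j)
    have h3 := hq.hasDerivAt ((ξ + (0 : ℝ) • Pi.single i 1 : Fin k → ℝ) j)
    have h4 := HasDerivAt.comp (0 : ℝ) h3 h2
    simpa [Function.comp_def] using h4
  have h6 := (HasDerivAt.fun_finsetProd (u := Finset.univ) fun l _ => h1 l).mul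
    (HasDerivAt.fun_finsetProd (u := Finset.univ) fun j _ => h5 j)
  simp only [zero_smul, add_zero, smul_eq_mul] at h6
  refine HasDerivAt.congr_deriv h6 ?_
  have e2 : ∑ j, (∏ j' ∈ Finset.univ.erase j, q (ξ j')) *
      (τ (ξ j) * q (ξ j) * (Pi.single i 1 : Fin k → ℝ) j) = τ (ξ i) * ∏ j, q (ξ j) := by
    rw [Finset.sum_eq_single i, Pi.single_eq_same,
      ← Finset.mul_prod_erase Finset.univ _ (Finset.mem_univ i)]
    · ring
    · intro j _ hj
      rw [Pi.single_eq_of_ne hj]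
      ring
    · simp
  rw [e2]
  -- Outside the box the mean may fail to be interior, and then the likelihood derivative need not
  -- have score form. This does no harm: the prior density is 0 there, and so is its directional
  -- derivative.
  by_cases hξ : ξ ∈ paramBox k
  · have e1 : ∑ l, (∏ l' ∈ Finset.univ.erase l, m.lik g (curve S e ξ) (s l')) *
        (m.dpmf (curve S e ξ (s l).1.1 + g (s l).1.2) (s l).2 * e i (s l).1.1) =
        (∑ l, m.obsScore g (curve S e ξ) (s l) * e i (s l).1.1) *
          ∏ l, m.lik g (curve S e ξ) (s l) := by
      rw [Finset.sum_mul]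
      refine Finset.sum_congr rfl fun l _ => ?_
      rw [Model.dpmf_eq (h.regular ξ hξ _ (hs l)),
        ← Finset.mul_prod_erase Finset.univ _ (Finset.mem_univ l), Model.lik, Model.obsScore]
      ring
    rw [e1, jointScore, jointDensity]
    ring
  · simp [jointDensity, hq.prod_eq_zero hξ]

/-- For a frozen sample the estimator contributes the constant a, so the residual has derivative
-b_i in ξ_i. The joint density is compactly supported in ξ, hence there are no boundary terms. -/
theorem integral_score_by_parts {s : Fin n → Obs D} (hs : ∀ l, (s l).1 ∈ cube D)
    (i : Fin k) (a : ℝ) (b : Fin k → ℝ)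
    (hint : Integrable fun ξ : Fin k → ℝ => (a - ∑ j, ξ j * b j) * jointScore m g S e τ i ξ s *
      jointDensity m g S e q ξ s) :
    ∫ ξ : Fin k → ℝ, (a - ∑ j, ξ j * b j) * jointScore m g S e τ i ξ s *
      jointDensity m g S e q ξ s = b i * ∫ ξ, jointDensity m g S e q ξ s := by
  have hf : ∀ ξ : Fin k → ℝ, HasLineDerivAt ℝ (fun ξ : Fin k → ℝ => a - ∑ j, ξ j * b j) (-b i) ξ
      (Pi.single i 1) := by
    intro ξ
    have e1 : ∀ t : ℝ, a - ∑ j, (ξ + t • Pi.single i 1 : Fin k → ℝ) j * b j =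
        a - ∑ j, ξ j * b j - t * b i := by
      intro t
      simp [add_mul, Finset.sum_add_distrib, Pi.single_apply]
      ring
    simp only [HasLineDerivAt, e1]
    simpa using ((hasDerivAt_id (0 : ℝ)).mul_const (b i)).const_sub (a - ∑ j, ξ j * b j)
  have key := integral_bilinear_hasLineDerivAt_right_eq_neg_left_of_integrable
    (μ := (volume : Measure (Fin k → ℝ))) (f := fun ξ : Fin k → ℝ => a - ∑ j, ξ j * b j)
    (f' := fun _ => -b i) (g := fun ξ => jointDensity m g S e q ξ s)
    (g' := fun ξ => jointScore m g S e τ i ξ s * jointDensity m g S e q ξ s)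
    (v := Pi.single i 1) (B := ContinuousLinearMap.mul ℝ ℝ)
    (integrable_continuous_mul_jointDensity hq s continuous_const)
    (by simpa only [ContinuousLinearMap.mul_apply', mul_assoc] using hint)
    (integrable_continuous_mul_jointDensity hq s (by fun_prop))
    (fun ξ _ => hf ξ) (fun ξ _ => h.hasLineDerivAt_jointDensity hq hs i ξ)
  simp only [ContinuousLinearMap.mul_apply'] at key
  simp_rw [mul_assoc]
  rw [key, integral_const_mul]
  ring

theorem integrable_residual_mul_score {a : (Fin n → Obs D) → ℝ} (ha : Measurable a) {R : ℝ}
    (haR : ∀ s, |a s| ≤ R) (b : Fin k → ℝ) (i : Fin k) :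
    Integrable (fun z : (Fin k → ℝ) × (Fin n → Obs D) =>
      (a z.2 - ∑ j, z.1 j * b j) * jointScore m g S e τ i z.1 z.2 *
        jointDensity m g S e q z.1 z.2) (volume.prod (sampleBase p n)) := by
  have hprob := hq.isProbabilityMeasure
  have hprob' := hq.isProbabilityMeasure_prior (k := k)
  have hbd : ∀ ξ ∈ paramBox k, ∀ s, |a s - ∑ j, ξ j * b j| ≤ R + ∑ j, |b j| := by
    intro ξ hξ s
    refine (abs_sub _ _).trans (add_le_add (haR s) ?_)
    refine (Finset.abs_sum_le_sum_abs _ _).trans (Finset.sum_le_sum fun j _ => ?_)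
    rw [abs_mul]
    exact mul_le_of_le_one_left (abs_nonneg _) (abs_le.2 (hξ j))
  have hTm := h.measurable_jointScore (n := n) hq i
  have hKi : ∀ ξ ∈ paramBox k, Integrable (fun s : Fin n → Obs D =>
      (a s - ∑ j, ξ j * b j) * jointScore m g S e τ i ξ s)
      (m.sampleLaw p g (curve S e ξ) n) := by
    intro ξ hξ
    have := h.isProbabilityMeasure_sampleLaw (n := n) hξ
    exact ((h.memLp_jointScore hξ i).integrable one_le_two).bdd_mul (c := R + ∑ j, |b j|)
      (ha.sub_const _).aestronglyMeasurable (ae_of_all _ (hbd ξ hξ))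
  have hm : Measurable (Function.uncurry fun (ξ : Fin k → ℝ) (s : Fin n → Obs D) =>
      (a s - ∑ j, ξ j * b j) * jointScore m g S e τ i ξ s) := by
    refine Measurable.mul ?_ hTm
    change Measurable fun z : (Fin k → ℝ) × (Fin n → Obs D) => a z.2 - ∑ j, z.1 j * b j
    fun_prop
  have hb : Integrable (fun ξ : Fin k → ℝ =>
      (R + ∑ j, |b j|) * (n * (B * (1 + C)) + |τ (ξ i)|)) (prior k q) := by
    have h1 : Integrable (fun ξ : Fin k → ℝ => |τ (ξ i)|) (prior k q) :=
      ((memLp_pi_eval (P := priorMeasure q) hq.memLp_score i).integrable one_le_two).abs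
    exact ((integrable_const _).add h1).const_mul _
  refine h.integrable_joint hq hm hKi hb fun ξ hξ => ?_
  have := h.isProbabilityMeasure_sampleLaw (n := n) hξ
  have hR0 : 0 ≤ R + ∑ j, |b j| := (abs_nonneg _).trans (hbd ξ hξ fun _ => ((0, 0), 0))
  have hT := ((h.memLp_jointScore (n := n) (τ := τ) hξ i).integrable one_le_two).abs
  calc ∫ s, |(a s - ∑ j, ξ j * b j) * jointScore m g S e τ i ξ s|
        ∂(m.sampleLaw p g (curve S e ξ) n)
      ≤ ∫ s, (R + ∑ j, |b j|) * |jointScore m g S e τ i ξ s|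
        ∂(m.sampleLaw p g (curve S e ξ) n) := by
        refine integral_mono (hKi ξ hξ).abs (hT.const_mul _) fun s => ?_
        simp only
        rw [abs_mul]
        exact mul_le_mul_of_nonneg_right (hbd ξ hξ s) (abs_nonneg _)
    _ ≤ _ := by
        rw [integral_const_mul]
        exact mul_le_mul_of_nonneg_left (h.integral_abs_jointScore_le hξ i) hR0

theorem integral_integral_jointDensity :
    ∫ s : Fin n → Obs D, (∫ ξ, jointDensity m g S e q ξ s) ∂(sampleBase p n) = 1 := by
  have hprob' := hq.isProbabilityMeasure_prior (k := k)
  have hone := h.integrable_joint hq (n := n) (K := fun _ _ => 1) (b := fun _ => 1)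
    measurable_const
    (fun ξ hξ => by
      have := h.isProbabilityMeasure_sampleLaw (n := n) hξ
      exact integrable_const _) (integrable_const _)
    (fun ξ hξ => by
      have := h.isProbabilityMeasure_sampleLaw (n := n) hξ
      simp)
  have h1 := (h.integral_prior_integral_sampleLaw hq (K := fun _ _ => 1) hone).2
  simp only [one_mul] at h1
  rw [← h1, integral_congr_ae (g := fun _ => (1 : ℝ))]
  · simp
  · filter_upwards [hq.ae_mem_paramBox] with ξ hξ
    have := h.isProbabilityMeasure_sampleLaw (n := n) hξ
    simp

/-- The covariance of an estimator with the score. -/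
theorem integral_residual_mul_score {a : (Fin n → Obs D) → ℝ} (ha : Measurable a) {R : ℝ}
    (haR : ∀ s, |a s| ≤ R) (b : Fin k → ℝ) (i : Fin k) :
    Integrable (fun ξ : Fin k → ℝ => ∫ s, (a s - ∑ j, ξ j * b j) * jointScore m g S e τ i ξ s
      ∂(m.sampleLaw p g (curve S e ξ) n)) (prior k q) ∧
    ∫ ξ, ∫ s, (a s - ∑ j, ξ j * b j) * jointScore m g S e τ i ξ s
      ∂(m.sampleLaw p g (curve S e ξ) n) ∂(prior k q) = b i := by
  have hjoint := h.integrable_residual_mul_score hq ha haR b i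
  have h1 := h.integral_prior_integral_sampleLaw hq (K := fun ξ s =>
    (a s - ∑ j, ξ j * b j) * jointScore m g S e τ i ξ s) hjoint
  refine ⟨h1.1, ?_⟩
  rw [h1.2]
  have h2 : ∫ s, (∫ ξ, (a s - ∑ j, ξ j * b j) * jointScore m g S e τ i ξ s *
      jointDensity m g S e q ξ s) ∂(sampleBase p n) =
      ∫ s : Fin n → Obs D, b i * (∫ ξ, jointDensity m g S e q ξ s) ∂(sampleBase p n) := by
    refine integral_congr_ae ?_
    filter_upwards [ae_mem_cube_sampleBase (n := n) h.density, hjoint.prod_left_ae] with s hs hi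
    exact h.integral_score_by_parts hq hs i (a s) b hi
  rw [h2, integral_const_mul, h.integral_integral_jointDensity hq, mul_one]

end IsSubmodel

end JointDensity

/-! ### The multivariate van Trees inequality -/

theorem integrable_fun_sub {E : Type*} [MeasurableSpace E] {μ : Measure E} {u v : E → ℝ}
    (hu : Integrable u μ) (hv : Integrable v μ) : Integrable (fun x => u x - v x) μ := hu.sub hv

/-- This is the nonnegativity of ∫(U - Σ t_i e_i)². The coefficients stay free, so no Gram matrix is
inverted. -/
theorem two_mul_sum_sub_le_integral_sq {E : Type*} [MeasurableSpace E] {μ : Measure E} {k : ℕ}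
    {U : E → ℝ} (hU : MemLp U 2 μ) {e : Fin k → E → ℝ} (he : ∀ i, MemLp (e i) 2 μ)
    (t : Fin k → ℝ) :
    2 * ∑ i, t i * ∫ x, U x * e i x ∂μ - ∑ i, ∑ j, t i * t j * ∫ x, e i x * e j x ∂μ ≤
      ∫ x, U x ^ 2 ∂μ := by
  have i1 : Integrable (fun x => U x ^ 2) μ := hU.integrable_sq
  have i2 : ∀ i, Integrable (fun x => U x * e i x) μ := fun i => hU.integrable_mul (he i)
  have i3 : ∀ i j, Integrable (fun x => e i x * e j x) μ := fun i j => (he i).integrable_mul (he j)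
  have e1 : ∀ x, (U x - ∑ i, t i * e i x) ^ 2 = U x ^ 2 -
      (2 * ∑ i, t i * (U x * e i x) - ∑ i, ∑ j, t i * t j * (e i x * e j x)) := by
    intro x
    have h1 : ∑ i, t i * (U x * e i x) = U x * ∑ i, t i * e i x := by
      rw [Finset.mul_sum]
      exact Finset.sum_congr rfl fun i _ => by ring
    have h2 : ∑ i, ∑ j, t i * t j * (e i x * e j x) =
        (∑ i, t i * e i x) * ∑ j, t j * e j x := by
      rw [Finset.sum_mul_sum]
      exact Finset.sum_congr rfl fun i _ => Finset.sum_congr rfl fun j _ => by ring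
    rw [h1, h2]
    ring
  have j2 : Integrable (fun x => 2 * ∑ i, t i * (U x * e i x)) μ :=
    (integrable_finsetSum _ fun i _ => (i2 i).const_mul _).const_mul 2
  have j3 : Integrable (fun x => ∑ i, ∑ j, t i * t j * (e i x * e j x)) μ :=
    integrable_finsetSum _ fun i _ => integrable_finsetSum _ fun j _ => (i3 i j).const_mul _
  have h0 : 0 ≤ ∫ x, (U x - ∑ i, t i * e i x) ^ 2 ∂μ := integral_nonneg fun x => sq_nonneg _
  simp_rw [e1] at h0
  rw [integral_sub i1 (integrable_fun_sub j2 j3), integral_sub j2 j3, integral_const_mul,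
    integral_finsetSum _ fun i _ => (i2 i).const_mul _,
    integral_finsetSum _ fun i _ => integrable_finsetSum _ fun j _ => (i3 i j).const_mul _] at h0
  simp_rw [integral_const_mul] at h0
  have h4 : ∀ i, ∫ x, ∑ j, t i * t j * (e i x * e j x) ∂μ =
      ∑ j, t i * t j * ∫ x, e i x * e j x ∂μ := fun i => by
    rw [integral_finsetSum _ fun j _ => (i3 i j).const_mul _]
    simp_rw [integral_const_mul]
  simp_rw [h4] at h0
  linarith

section VanTrees

variable {D k n : ℕ} {m : Model} {p : ℝ × (Fin D → ℝ) → ℝ} {g : (Fin D → ℝ) → ℝ}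
  {S : ℝ → ℝ} {e : Fin k → ℝ → ℝ} {C B : ℝ} {q τ : ℝ → ℝ} {V J : ℝ}

theorem memLp_two_of_lintegral_sq_le {E : Type*} [MeasurableSpace E] {μ : Measure E} {U : E → ℝ}
    (hU : Measurable U) {R : ℝ} (hR : ∫⁻ x, ENNReal.ofReal (U x ^ 2) ∂μ ≤ ENNReal.ofReal R) :
    MemLp U 2 μ := by
  rw [memLp_two_iff_integrable_sq hU.aestronglyMeasurable]
  refine ⟨(hU.pow_const 2).aestronglyMeasurable, ?_⟩
  rw [hasFiniteIntegral_iff_ofReal (ae_of_all _ fun x => sq_nonneg _)]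
  exact hR.trans_lt ENNReal.ofReal_lt_top

/-- The inner product on `[0,1]`. -/
def unitInner (u v : ℝ → ℝ) : ℝ := ∫ x in Icc (0 : ℝ) 1, u x * v x

theorem IsSubmodel.memLp_e (h : IsSubmodel m p g S e C B) (i : Fin k) :
    MemLp (e i) 2 (volume.restrict (Icc (0 : ℝ) 1)) :=
  MemLp.of_bound (h.measurable_e i).aestronglyMeasurable B (ae_of_all _ fun x => h.abs_e_le i x)

theorem IsSubmodel.abs_residual_le (h : IsSubmodel m p g S e C B) {U : ℝ → ℝ} (hU : Measurable U)
    {R : ℝ} (hR0 : 0 ≤ R)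
    (hR : ∫⁻ x in Icc (0 : ℝ) 1, ENNReal.ofReal (U x ^ 2) ≤ ENNReal.ofReal R) (i : Fin k) :
    |unitInner U (e i)| ≤ R + B ^ 2 := by
  have hU2 := memLp_two_of_lintegral_sq_le hU hR
  have he2 := h.memLp_e i
  have h1 : ∫ x in Icc (0 : ℝ) 1, U x ^ 2 ≤ R := by
    rw [integral_eq_lintegral_of_nonneg_ae (ae_of_all _ fun x => sq_nonneg _)
      (hU.pow_const 2).aestronglyMeasurable]
    exact ENNReal.toReal_le_of_le_ofReal hR0 hR
  have h2 : ∫ x in Icc (0 : ℝ) 1, e i x ^ 2 ≤ B ^ 2 := by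
    calc _ ≤ ∫ x in Icc (0 : ℝ) 1, B ^ 2 := by
          refine integral_mono he2.integrable_sq (integrable_const _) fun x => ?_
          simp only
          rw [← sq_abs]
          exact pow_le_pow_left₀ (abs_nonneg _) (h.abs_e_le i x) 2
      _ = B ^ 2 := by simp
  calc |unitInner U (e i)| ≤ ∫ x in Icc (0 : ℝ) 1, |U x * e i x| := abs_integral_le_integral_abs
    _ ≤ ∫ x in Icc (0 : ℝ) 1, (U x ^ 2 + e i x ^ 2) := by
        refine integral_mono (hU2.integrable_mul he2).abs
          (hU2.integrable_sq.add he2.integrable_sq) fun x => ?_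
        simp only
        rw [abs_mul, ← sq_abs (U x), ← sq_abs (e i x)]
        nlinarith [sq_nonneg (|U x| - |e i x|), abs_nonneg (U x), abs_nonneg (e i x),
          mul_nonneg (abs_nonneg (U x)) (abs_nonneg (e i x))]
    _ ≤ R + B ^ 2 := by
        rw [integral_add hU2.integrable_sq he2.integrable_sq]
        exact add_le_add h1 h2

/-- The L² inequality in x is applied sample by sample with random coefficients, then averaged over
the sample. The Gram matrix ⟨e_i,e_j⟩ of the loss thereby multiplies the score covariances
entrywise. -/
theorem IsSubmodel.ofReal_le_mise (h : IsSubmodel m p g S e C B)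
    {T : (Fin n → Obs D) → ℝ → ℝ} (hT : Measurable (Function.uncurry T)) {R : ℝ} (hR0 : 0 ≤ R)
    (hR : ∀ s, ∫⁻ x in Icc (0 : ℝ) 1, ENNReal.ofReal ((T s x - S x) ^ 2) ≤ ENNReal.ofReal R)
    (w : Fin k → ℝ) {ξ : Fin k → ℝ} (hξ : ξ ∈ paramBox k) :
    ENNReal.ofReal (2 * ∑ i, w i * (∫ s, (unitInner (fun x => T s x - S x) (e i) -
        ∑ j, ξ j * unitInner (e j) (e i)) * jointScore m g S e τ i ξ s
        ∂(m.sampleLaw p g (curve S e ξ) n)) -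
      ∑ i, ∑ j, w i * w j * unitInner (e i) (e j) *
        (n * (∫ x in (0 : ℝ)..1, m.info p g (curve S e ξ) x * (e i x * e j x)) +
          τ (ξ i) * τ (ξ j))) ≤ m.mise p g T (curve S e ξ) := by
  have hS := h.measurable_S
  have hem := h.measurable_e
  have hprob := h.isProbabilityMeasure_sampleLaw (n := n) hξ
  have hTs : ∀ s, Measurable (T s) := fun s => hT.comp measurable_prodMk_left
  have hU2 : ∀ s, MemLp (fun x => T s x - S x) 2 (volume.restrict (Icc (0 : ℝ) 1)) := fun s =>
    memLp_two_of_lintegral_sq_le ((hTs s).sub hS) (hR s)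
  have hT1 : Measurable fun z : (Fin n → Obs D) × ℝ => T z.1 z.2 := hT
  have ham : ∀ i, Measurable fun s => unitInner (fun x => T s x - S x) (e i) := fun i => by
    have : Measurable fun z : (Fin n → Obs D) × ℝ => (T z.1 z.2 - S z.2) * e i z.2 := by fun_prop
    exact this.stronglyMeasurable.integral_prod_right.measurable
  have hTi := fun i => h.memLp_jointScore (n := n) (τ := τ) hξ i
  have hi1 : ∀ i, Integrable (fun s => (unitInner (fun x => T s x - S x) (e i) -
      ∑ j, ξ j * unitInner (e j) (e i)) * jointScore m g S e τ i ξ s)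
      (m.sampleLaw p g (curve S e ξ) n) := fun i => by
    refine ((hTi i).integrable one_le_two).bdd_mul
      (c := (R + B ^ 2) + |∑ j, ξ j * unitInner (e j) (e i)|)
      ((ham i).sub_const _).aestronglyMeasurable (ae_of_all _ fun s => ?_)
    exact (abs_sub _ _).trans (add_le_add_left (h.abs_residual_le ((hTs s).sub hS) hR0 (hR s) i) _)
  have hi2 : ∀ i j, Integrable (fun s : Fin n → Obs D => jointScore m g S e τ i ξ s *
      jointScore m g S e τ j ξ s) (m.sampleLaw p g (curve S e ξ) n) := fun i j =>
    (hTi i).integrable_mul (hTi j)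
  have key : ∀ s, ENNReal.ofReal (2 * ∑ i, w i * ((unitInner (fun x => T s x - S x) (e i) -
      ∑ j, ξ j * unitInner (e j) (e i)) * jointScore m g S e τ i ξ s) -
      ∑ i, ∑ j, w i * w j * unitInner (e i) (e j) *
        (jointScore m g S e τ i ξ s * jointScore m g S e τ j ξ s)) ≤
      ∫⁻ x in Icc (0 : ℝ) 1, ENNReal.ofReal ((T s x - curve S e ξ x) ^ 2) := by
    intro s
    have hu : MemLp (fun x => T s x - curve S e ξ x) 2 (volume.restrict (Icc (0 : ℝ) 1)) := by
      have := (hU2 s).sub (memLp_finsetSum Finset.univ fun j _ => (h.memLp_e j).const_mul (ξ j))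
      refine this.ae_eq (ae_of_all _ fun x => ?_)
      simp only [Pi.sub_apply, curve]
      ring
    refine (ENNReal.ofReal_le_ofReal ?_).trans (ofReal_integral_le_lintegral_ofReal _ _)
    -- The coefficient of e_i is w_i times the i-th joint score at this sample.
    refine le_trans (le_of_eq ?_) (two_mul_sum_sub_le_integral_sq hu h.memLp_e
      fun i => w i * jointScore m g S e τ i ξ s)
    have e1 : ∀ i, ∫ x in Icc (0 : ℝ) 1, (T s x - curve S e ξ x) * e i x =
        unitInner (fun x => T s x - S x) (e i) - ∑ j, ξ j * unitInner (e j) (e i) := by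
      intro i
      have i1 : Integrable (fun x => (T s x - S x) * e i x) (volume.restrict (Icc (0 : ℝ) 1)) :=
        (hU2 s).integrable_mul (h.memLp_e i)
      have i2 : ∀ j, Integrable (fun x => ξ j * (e j x * e i x))
          (volume.restrict (Icc (0 : ℝ) 1)) := fun j =>
        ((h.memLp_e j).integrable_mul (h.memLp_e i)).const_mul _
      have e2 : ∀ x, (T s x - curve S e ξ x) * e i x = (T s x - S x) * e i x -
          ∑ j, ξ j * (e j x * e i x) := fun x => by
        have : ∑ j, ξ j * (e j x * e i x) = (∑ j, ξ j * e j x) * e i x := by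
          rw [Finset.sum_mul]
          exact Finset.sum_congr rfl fun j _ => by ring
        rw [this, curve]
        ring
      simp_rw [e2]
      rw [integral_sub i1 (integrable_finsetSum _ fun j _ => i2 j),
        integral_finsetSum _ fun j _ => i2 j]
      simp_rw [integral_const_mul]
      rfl
    simp_rw [e1]
    congr 1
    · congr 1
      exact Finset.sum_congr rfl fun i _ => by ring
    · refine Finset.sum_congr rfl fun i _ => Finset.sum_congr rfl fun j _ => ?_
      rw [unitInner]
      ring
  refine le_trans ?_ (lintegral_mono key)
  refine le_trans (le_of_eq ?_) (ofReal_integral_le_lintegral_ofReal _ _)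
  congr 1
  rw [integral_sub ((integrable_finsetSum _ fun i _ => (hi1 i).const_mul _).const_mul _)
    (integrable_finsetSum _ fun i _ => integrable_finsetSum _ fun j _ => (hi2 i j).const_mul _),
    integral_const_mul, integral_finsetSum _ fun i _ => (hi1 i).const_mul _,
    integral_finsetSum _ fun i _ => integrable_finsetSum _ fun j _ => (hi2 i j).const_mul _]
  simp_rw [integral_const_mul]
  congr 1
  refine Finset.sum_congr rfl fun i _ => ?_
  rw [integral_finsetSum _ fun j _ => (hi2 i j).const_mul _]
  refine Finset.sum_congr rfl fun j _ => ?_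
  rw [integral_const_mul, h.integral_jointScore_mul hξ]

/-- The **van Trees inequality** for the mean integrated squared error of an estimator of a function
in a finite-dimensional submodel. -/
theorem IsSubmodel.vanTrees (h : IsSubmodel m p g S e C B) (hq : IsPrior q τ V J)
    {T : (Fin n → Obs D) → ℝ → ℝ} (hT : Measurable (Function.uncurry T)) {R : ℝ} (hR0 : 0 ≤ R)
    (hR : ∀ s, ∫⁻ x in Icc (0 : ℝ) 1, ENNReal.ofReal ((T s x - S x) ^ 2) ≤ ENNReal.ofReal R)
    (w : Fin k → ℝ) {A : ℝ}
    (hA : ∀ ξ ∈ paramBox k, ∑ i, ∑ j, w i * w j * unitInner (e i) (e j) *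
      (∫ x in (0 : ℝ)..1, m.info p g (curve S e ξ) x * (e i x * e j x)) ≤ A) :
    ENNReal.ofReal (2 * ∑ i, w i * unitInner (e i) (e i) - n * A -
        J * ∑ i, w i ^ 2 * unitInner (e i) (e i)) ≤
      ∫⁻ ξ, m.mise p g T (curve S e ξ) ∂(prior k q) := by
  have hprob := hq.isProbabilityMeasure
  have hprob' := hq.isProbabilityMeasure_prior (k := k)
  have hS := h.measurable_S
  have hem := h.measurable_e
  have hTs : ∀ s, Measurable (T s) := fun s => hT.comp measurable_prodMk_left
  have hT1 : Measurable fun z : (Fin n → Obs D) × ℝ => T z.1 z.2 := hT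
  have ham : ∀ i, Measurable fun s => unitInner (fun x => T s x - S x) (e i) := fun i => by
    have : Measurable fun z : (Fin n → Obs D) × ℝ => (T z.1 z.2 - S z.2) * e i z.2 := by fun_prop
    exact this.stronglyMeasurable.integral_prod_right.measurable
  have hcov := fun i => h.integral_residual_mul_score hq (ham i)
    (fun s => h.abs_residual_le ((hTs s).sub hS) hR0 (hR s) i)
    (fun j => unitInner (e j) (e i)) i
  have hττ : ∀ i j : Fin k, Integrable (fun ξ : Fin k → ℝ => τ (ξ i) * τ (ξ j)) (prior k q) :=
    fun i j => (memLp_pi_eval (P := priorMeasure q) hq.memLp_score i).integrable_mul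
      (memLp_pi_eval (P := priorMeasure q) hq.memLp_score j)
  -- The information part has already been replaced by its uniform bound A. Averaging over the prior
  -- turns the cross terms into squared norms, and independence of the ξ_i leaves only the diagonal
  -- of the prior scores, with value J.
  have hmain : ∫ ξ, (2 * ∑ i, w i * (∫ s, (unitInner (fun x => T s x - S x) (e i) -
        ∑ j, ξ j * unitInner (e j) (e i)) * jointScore m g S e τ i ξ s
        ∂(m.sampleLaw p g (curve S e ξ) n)) - n * A -
      ∑ i, ∑ j, w i * w j * unitInner (e i) (e j) * (τ (ξ i) * τ (ξ j))) ∂(prior k q) =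
      2 * ∑ i, w i * unitInner (e i) (e i) - n * A -
        J * ∑ i, w i ^ 2 * unitInner (e i) (e i) := by
    have i1 := (integrable_finsetSum (μ := prior k q) Finset.univ fun i _ =>
      ((hcov i).1).const_mul (w i)).const_mul 2
    have i2 := integrable_finsetSum (μ := prior k q) Finset.univ fun i _ =>
      integrable_finsetSum Finset.univ fun j _ =>
        (hττ i j).const_mul (w i * w j * unitInner (e i) (e j))
    rw [integral_sub (integrable_fun_sub i1 (integrable_const _)) i2,
      integral_sub i1 (integrable_const _),
      integral_const_mul, integral_finsetSum _ fun i _ => ((hcov i).1).const_mul (w i),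
      integral_finsetSum _ fun i _ => integrable_finsetSum _ fun j _ =>
        (hττ i j).const_mul (w i * w j * unitInner (e i) (e j))]
    simp_rw [integral_const_mul, fun i => (hcov i).2]
    congr 1
    · simp
    · rw [Finset.mul_sum]
      refine Finset.sum_congr rfl fun i _ => ?_
      rw [integral_finsetSum _ fun j _ => (hττ i j).const_mul _]
      simp_rw [integral_const_mul, hq.integral_prior_score_mul_score]
      simp
      ring
  rw [← hmain]
  refine (ofReal_integral_le_lintegral_ofReal _ _).trans (lintegral_mono_ae ?_)
  filter_upwards [hq.ae_mem_paramBox] with ξ hξ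
  refine le_trans (ENNReal.ofReal_le_ofReal ?_) (h.ofReal_le_mise (τ := τ) hT hR0 hR w hξ)
  have h1 := mul_le_mul_of_nonneg_left (hA ξ hξ) (Nat.cast_nonneg (α := ℝ) n)
  have e1 : ∑ i, ∑ j, w i * w j * unitInner (e i) (e j) *
        (n * (∫ x in (0 : ℝ)..1, m.info p g (curve S e ξ) x * (e i x * e j x)) +
          τ (ξ i) * τ (ξ j)) =
      n * (∑ i, ∑ j, w i * w j * unitInner (e i) (e j) *
        (∫ x in (0 : ℝ)..1, m.info p g (curve S e ξ) x * (e i x * e j x))) +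
      ∑ i, ∑ j, w i * w j * unitInner (e i) (e j) * (τ (ξ i) * τ (ξ j)) := by
    rw [Finset.mul_sum, ← Finset.sum_add_distrib]
    refine Finset.sum_congr rfl fun i _ => ?_
    rw [Finset.mul_sum, ← Finset.sum_add_distrib]
    exact Finset.sum_congr rfl fun j _ => by ring
  rw [e1]
  linarith

end VanTrees

/-! ### From the Bayes risk to the minimax risk -/

/-- The squared distance in `L²[0,1]`. -/
def sqDist (u v : ℝ → ℝ) : ℝ≥0∞ := ∫⁻ x in Icc (0 : ℝ) 1, ENNReal.ofReal ((u x - v x) ^ 2)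

theorem sqDist_le {u v w : ℝ → ℝ} (hu : Measurable u) (hv : Measurable v) :
    sqDist u w ≤ 2 * sqDist u v + 2 * sqDist v w := by
  have h1 : Measurable fun x => ENNReal.ofReal ((u x - v x) ^ 2) := by fun_prop
  unfold sqDist
  rw [← lintegral_const_mul _ h1, ← lintegral_const_mul' _ _ ENNReal.ofNat_ne_top,
    ← lintegral_add_left (h1.const_mul 2)]
  refine lintegral_mono fun x => ?_
  simp only
  rw [← ENNReal.ofReal_ofNat 2, ← ENNReal.ofReal_mul (by norm_num), ← ENNReal.ofReal_mul (by norm_num),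
    ← ENNReal.ofReal_add (by positivity) (by positivity)]
  refine ENNReal.ofReal_le_ofReal ?_
  nlinarith [sq_nonneg (u x - v x - (v x - w x))]

theorem sqDist_comm (u v : ℝ → ℝ) : sqDist u v = sqDist v u := by
  unfold sqDist
  congr 1
  ext x
  rw [← neg_sub, neg_sq]

section Reduction

variable {D k n : ℕ} {m : Model} {p : ℝ × (Fin D → ℝ) → ℝ} {g : (Fin D → ℝ) → ℝ}
  {S : ℝ → ℝ} {e : Fin k → ℝ → ℝ} {C B : ℝ} {q τ : ℝ → ℝ} {V J : ℝ}

/-- An estimator replaced by `S` on the samples for which it is far from `S`. -/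
def truncated (T : (Fin n → Obs D) → ℝ → ℝ) (S : ℝ → ℝ) (R : ℝ≥0∞) (s : Fin n → Obs D) (x : ℝ) :
    ℝ := open Classical in if sqDist (T s) S ≤ R then T s x else S x

theorem measurable_truncated {T : (Fin n → Obs D) → ℝ → ℝ} (hT : Measurable (Function.uncurry T))
    (hS : Measurable S) (R : ℝ≥0∞) : Measurable (Function.uncurry (truncated T S R)) := by
  classical
  have hT1 : Measurable fun z : (Fin n → Obs D) × ℝ => T z.1 z.2 := hT
  have h1 : Measurable fun s => sqDist (T s) S := by
    have : Measurable fun z : (Fin n → Obs D) × ℝ =>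
        ENNReal.ofReal ((T z.1 z.2 - S z.2) ^ 2) := by fun_prop
    exact this.lintegral_prod_right'
  have e1 : Function.uncurry (truncated T S R) = fun z : (Fin n → Obs D) × ℝ =>
      if sqDist (T z.1) S ≤ R then T z.1 z.2 else S z.2 := by
    ext z
    simp [truncated, Function.uncurry]
  rw [e1]
  exact Measurable.ite (measurableSet_le (h1.comp measurable_fst) measurable_const) hT1
    (hS.comp measurable_snd)

theorem sqDist_truncated_le (T : (Fin n → Obs D) → ℝ → ℝ) (S : ℝ → ℝ) (R : ℝ≥0∞)
    (s : Fin n → Obs D) : sqDist (truncated T S R s) S ≤ R := by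
  by_cases h : sqDist (T s) S ≤ R
  · have : truncated T S R s = T s := by
      ext x
      simp [truncated, h]
    rwa [this]
  · have : truncated T S R s = S := by
      ext x
      simp [truncated, h]
    rw [this]
    simp [sqDist]

/-- An estimate at squared distance more than 4r from S cannot be within r of f, by (a + b)² ≤ 2a² +
2b², whereas S itself is within r of f. Truncation therefore never increases the loss at curves near
S. -/
theorem sqDist_truncated_le_of_near {T : (Fin n → Obs D) → ℝ → ℝ} {r : ℝ≥0∞}
    {s : Fin n → Obs D} (hT : Measurable (T s)) {f : ℝ → ℝ}
    (hf : Measurable f) (hfS : sqDist f S ≤ r) :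
    sqDist (truncated T S (4 * r) s) f ≤ sqDist (T s) f := by
  by_cases h : sqDist (T s) S ≤ 4 * r
  · have : truncated T S (4 * r) s = T s := by
      ext x
      simp [truncated, h]
    rw [this]
  · have : truncated T S (4 * r) s = S := by
      ext x
      simp [truncated, h]
    rw [this, sqDist_comm]
    refine hfS.trans ?_
    by_contra hlt
    push Not at h hlt
    refine absurd h (not_lt.2 ?_)
    calc sqDist (T s) S ≤ 2 * sqDist (T s) f + 2 * sqDist f S := sqDist_le hT hf
      _ ≤ 2 * r + 2 * r := by gcongr
      _ = 4 * r := by rw [← add_mul]; norm_num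

/-- The Bayes risk of the truncated estimator is split over G and its complement. On G the curves
belong to the class, so the supremum bounds the risk; off G the loss is at most 2·4R + 2·R, since
both the estimate and the curve are near S. -/
theorem IsSubmodel.le_minimaxMISE_add (h : IsSubmodel m p g S e C B) (hq : IsPrior q τ V J)
    {R : ℝ} (hR0 : 0 ≤ R)
    (hR : ∀ ξ ∈ paramBox k, sqDist (curve S e ξ) S ≤ ENNReal.ofReal R)
    (w : Fin k → ℝ) {A : ℝ}
    (hA : ∀ ξ ∈ paramBox k, ∑ i, ∑ j, w i * w j * unitInner (e i) (e j) *
      (∫ x in (0 : ℝ)..1, m.info p g (curve S e ξ) x * (e i x * e j x)) ≤ A)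
    {F : Set (ℝ → ℝ)} {G : Set (Fin k → ℝ)} (hGm : MeasurableSet G)
    (hG : ∀ ξ ∈ paramBox k, ξ ∈ G → curve S e ξ ∈ F) :
    ENNReal.ofReal (2 * ∑ i, w i * unitInner (e i) (e i) - n * A -
        J * ∑ i, w i ^ 2 * unitInner (e i) (e i)) ≤
      m.minimaxMISE p g F n + ENNReal.ofReal (10 * R) * prior k q Gᶜ := by
  have hprob := hq.isProbabilityMeasure_prior (k := k)
  rw [← tsub_le_iff_right]
  refine le_iInf₂ fun T hT => ?_
  rw [tsub_le_iff_right]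
  have hTs : ∀ s, Measurable (T s) := fun s => hT.comp measurable_prodMk_left
  set r := ENNReal.ofReal R with hr
  have h4 : 4 * r = ENNReal.ofReal (4 * R) := by
    rw [ENNReal.ofReal_mul (by norm_num), ENNReal.ofReal_ofNat]
  have hT'm := measurable_truncated hT h.measurable_S (4 * r)
  -- Truncation also supplies the uniform bound on the estimator that integration by parts requires.
  have hvt := h.vanTrees hq hT'm (R := 4 * R) (by positivity) (fun s => by
    rw [← h4]
    exact sqDist_truncated_le T S _ s) w hA
  refine hvt.trans ?_
  have hle : ∀ ξ ∈ paramBox k, m.mise p g (truncated T S (4 * r)) (curve S e ξ) ≤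
      m.mise p g T (curve S e ξ) := fun ξ hξ => lintegral_mono fun s =>
    sqDist_truncated_le_of_near (hTs s)
      (h.measurable_curve ξ) (hR ξ hξ)
  have hbd : ∀ ξ ∈ paramBox k, m.mise p g (truncated T S (4 * r)) (curve S e ξ) ≤
      ENNReal.ofReal (10 * R) := fun ξ hξ => by
    have := h.isProbabilityMeasure_sampleLaw (n := n) hξ
    have h1 : ∀ s, sqDist (truncated T S (4 * r) s) (curve S e ξ) ≤ ENNReal.ofReal (10 * R) := by
      intro s
      have hm : Measurable (truncated T S (4 * r) s) := hT'm.comp measurable_prodMk_left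
      calc _ ≤ 2 * sqDist (truncated T S (4 * r) s) S + 2 * sqDist S (curve S e ξ) :=
            sqDist_le hm h.measurable_S
        _ ≤ 2 * (4 * r) + 2 * r := by
            have h2 := sqDist_truncated_le T S (4 * r) s
            have h3 := hR ξ hξ
            rw [sqDist_comm] at h3
            gcongr
        _ = ENNReal.ofReal (10 * R) := by
            rw [ENNReal.ofReal_mul (by norm_num), ENNReal.ofReal_ofNat, ← mul_assoc, ← add_mul]
            norm_num
            rfl
    calc m.mise p g (truncated T S (4 * r)) (curve S e ξ)
        ≤ ∫⁻ s, ENNReal.ofReal (10 * R) ∂(m.sampleLaw p g (curve S e ξ) n) :=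
          lintegral_mono fun s => h1 s
      _ = ENNReal.ofReal (10 * R) := by simp
  rw [← lintegral_add_compl _ hGm]
  refine add_le_add ?_ ?_
  · calc _ ≤ ∫⁻ ξ in G, (⨆ f ∈ F, m.mise p g T f) ∂(prior k q) := by
          refine lintegral_mono_ae ?_
          filter_upwards [ae_restrict_mem hGm, ae_restrict_of_ae hq.ae_mem_paramBox] with ξ h1 h2
          exact (hle ξ h2).trans (le_iSup₂ (f := fun f (_ : f ∈ F) => m.mise p g T f) _
            (hG ξ h2 h1))
      _ ≤ _ := by
          rw [setLIntegral_const]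
          exact mul_le_of_le_one_right' prob_le_one
  · calc _ ≤ ∫⁻ ξ in Gᶜ, ENNReal.ofReal (10 * R) ∂(prior k q) := by
          refine lintegral_mono_ae ?_
          filter_upwards [ae_restrict_of_ae hq.ae_mem_paramBox] with ξ h2
          exact hbd ξ h2
      _ = _ := setLIntegral_const _ _

end Reduction

/-! ### The cosine basis -/

theorem integral_cos_int_mul (k : ℤ) :
    ∫ x in (0 : ℝ)..1, Real.cos (Real.pi * k * x) = if k = 0 then 1 else 0 := by
  split_ifs with hk
  · simp [hk]
  · have h : Real.pi * k ≠ 0 := mul_ne_zero Real.pi_ne_zero (Int.cast_ne_zero.2 hk)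
    rw [intervalIntegral.integral_comp_mul_left (fun x => Real.cos x) h, integral_cos]
    simp [mul_comm Real.pi, Real.sin_int_mul_pi]

/-- The normalising constant of `cosBasis`. -/
def cosNorm (j : ℕ) : ℝ := if j = 0 then 1 else √2

theorem cosNorm_pos (j : ℕ) : 0 < cosNorm j := by
  unfold cosNorm
  split_ifs <;> positivity

theorem cosBasis_eq (j : ℕ) (x : ℝ) : cosBasis j x = cosNorm j * Real.cos (Real.pi * j * x) := by
  unfold cosBasis cosNorm
  split_ifs with h <;> simp [h]

@[fun_prop]
theorem continuous_cosBasis (j : ℕ) : Continuous (cosBasis j) := by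
  simp_rw [funext (cosBasis_eq j)]
  fun_prop

theorem abs_cosBasis_le (j : ℕ) (x : ℝ) : |cosBasis j x| ≤ √2 := by
  rw [cosBasis_eq, abs_mul, abs_of_pos (cosNorm_pos j)]
  have h1 : cosNorm j ≤ √2 := by
    unfold cosNorm
    split_ifs
    · exact Real.one_le_sqrt.2 (by norm_num)
    · exact le_rfl
  calc _ ≤ √2 * 1 := mul_le_mul h1 (Real.abs_cos_le_one _) (abs_nonneg _) (by positivity)
    _ = √2 := mul_one _

theorem cosBasis_sq_le (j : ℕ) (x : ℝ) : cosBasis j x ^ 2 ≤ 2 := by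
  rw [← sq_abs, ← Real.sq_sqrt (show (0 : ℝ) ≤ 2 by norm_num)]
  exact pow_le_pow_left₀ (abs_nonneg _) (abs_cosBasis_le j x) 2

theorem cos_mul_cos_eq (a b x : ℝ) : Real.cos (Real.pi * a * x) * Real.cos (Real.pi * b * x) =
    (Real.cos (Real.pi * (a - b) * x) + Real.cos (Real.pi * (a + b) * x)) / 2 := by
  have h1 : Real.pi * (a - b) * x = Real.pi * a * x - Real.pi * b * x := by ring
  have h2 : Real.pi * (a + b) * x = Real.pi * a * x + Real.pi * b * x := by ring
  rw [h1, h2, Real.cos_sub, Real.cos_add]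
  ring

theorem integral_cosBasis_mul (i j : ℕ) :
    ∫ x in (0 : ℝ)..1, cosBasis i x * cosBasis j x = if i = j then 1 else 0 := by
  have e1 : ∀ x, cosBasis i x * cosBasis j x = cosNorm i * cosNorm j / 2 *
      (Real.cos (Real.pi * ((i : ℤ) - j : ℤ) * x) + Real.cos (Real.pi * ((i : ℤ) + j : ℤ) * x)) := by
    intro x
    rw [cosBasis_eq, cosBasis_eq]
    have := cos_mul_cos_eq i j x
    push_cast
    linear_combination (cosNorm i * cosNorm j) * this
  simp_rw [e1]
  rw [intervalIntegral.integral_const_mul, intervalIntegral.integral_add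
    (Continuous.intervalIntegrable (by fun_prop) _ _)
    (Continuous.intervalIntegrable (by fun_prop) _ _), integral_cos_int_mul, integral_cos_int_mul]
  have h2 : √2 * √2 = (2 : ℝ) := Real.mul_self_sqrt (by norm_num)
  by_cases hij : i = j
  · subst hij
    by_cases hi : i = 0
    · norm_num [hi, cosNorm]
    · have : ¬ ((i : ℤ) + i = 0) := by omega
      simp [this, cosNorm, hi, h2]
  · have h3 : ¬ ((i : ℤ) - j = 0) := by omega
    have h4 : ¬ ((i : ℤ) + j = 0) := by omega
    simp [h3, h4, hij]

theorem integral_sum_mul_cosBasis (s : Finset ℕ) (b : ℕ → ℝ) (j : ℕ) :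
    ∫ x in (0 : ℝ)..1, (∑ i ∈ s, b i * cosBasis i x) * cosBasis j x = if j ∈ s then b j else 0 := by
  simp_rw [Finset.sum_mul, mul_assoc]
  rw [intervalIntegral.integral_finsetSum fun i _ =>
    Continuous.intervalIntegrable (by fun_prop) _ _]
  simp_rw [intervalIntegral.integral_const_mul, integral_cosBasis_mul]
  simp

theorem setIntegral_Icc_eq (f : ℝ → ℝ) : ∫ x in Icc (0 : ℝ) 1, f x = ∫ x in (0 : ℝ)..1, f x := by
  rw [intervalIntegral.integral_of_le zero_le_one, integral_Icc_eq_integral_Ioc]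

/-! ### Cosine polynomials -/

/-- The cosine polynomial attached to a polynomial. -/
def cosPoly (P : Polynomial ℝ) (x : ℝ) : ℝ := P.eval (Real.cos (Real.pi * x))

@[fun_prop]
theorem continuous_cosPoly (P : Polynomial ℝ) : Continuous (cosPoly P) := by
  unfold cosPoly
  fun_prop

/-- A continuous L¹ approximation is clipped to [-B,B] and then approximated uniformly by a
polynomial in cos πx. Clipping does not move away from v, and it keeps the uniform bound B + 1
independent of the precision. -/
theorem exists_cosPoly_near {v : ℝ → ℝ} (hv : Measurable v) {B : ℝ}
    (hB : ∀ x ∈ Icc (0 : ℝ) 1, |v x| ≤ B) {ε : ℝ} (hε : 0 < ε) :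
    ∃ P : Polynomial ℝ, (∀ x, |cosPoly P x| ≤ B + 1) ∧
      ∫ x in Icc (0 : ℝ) 1, |cosPoly P x - v x| ≤ ε := by
  have hvi : Integrable v (volume.restrict (Icc (0 : ℝ) 1)) :=
    Integrable.of_bound hv.aestronglyMeasurable B
      ((ae_restrict_iff' measurableSet_Icc).2 (ae_of_all _ hB))
  obtain ⟨u, hu, -⟩ := hvi.exists_boundedContinuous_integral_sub_le (half_pos hε)
  have hB0 : 0 ≤ B := (abs_nonneg _).trans (hB 0 (by simp))
  have hclip : ∀ y, |max (-B) (min B y)| ≤ B := fun y =>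
    abs_le.2 ⟨le_max_left _ _, max_le (by linarith) (min_le_left _ _)⟩
  have hclip2 : ∀ y z, |z| ≤ B → |max (-B) (min B y) - z| ≤ |z - y| := by
    intro y z hz
    have hz := abs_le.1 hz
    rcases max_cases (-B) (min B y) with h | h <;> rcases min_cases B y with h' | h' <;>
      rw [h.1] <;> try rw [h'.1]
    all_goals
      rw [abs_le]
      have h1 := neg_abs_le (z - y)
      have h2 := le_abs_self (z - y)
      constructor <;> linarith [h.2, h'.2, hz.1, hz.2]
  -- The substitution y = cos πx maps [0,1] bijectively onto [-1,1], where Weierstrass' theorem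
  -- applies.
  have hcont : Continuous fun y => max (-B) (min B (u (Real.arccos y / Real.pi))) :=
    continuous_const.max (continuous_const.min (u.continuous.comp
      (Real.continuous_arccos.div_const _)))
  obtain ⟨P, hP⟩ := exists_polynomial_near_of_continuousOn (-1) 1 _ hcont.continuousOn
    (min 1 (ε / 2)) (by positivity)
  refine ⟨P, fun x => ?_, ?_⟩
  · have h1 := hP (Real.cos (Real.pi * x)) ⟨Real.neg_one_le_cos _, Real.cos_le_one _⟩
    have h2 := hclip (u (Real.arccos (Real.cos (Real.pi * x)) / Real.pi))
    have h3 := abs_sub_abs_le_abs_sub (P.eval (Real.cos (Real.pi * x)))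
      (max (-B) (min B (u (Real.arccos (Real.cos (Real.pi * x)) / Real.pi))))
    have h4 := h1.trans_le (min_le_left _ _)
    rw [cosPoly]
    linarith
  · have hpt : ∀ x ∈ Icc (0 : ℝ) 1, |cosPoly P x - v x| ≤ ε / 2 + ‖v x - u x‖ := by
      intro x hx
      have h1 := hP (Real.cos (Real.pi * x)) ⟨Real.neg_one_le_cos _, Real.cos_le_one _⟩
      have h5 : Real.arccos (Real.cos (Real.pi * x)) / Real.pi = x := by
        rw [Real.arccos_cos (mul_nonneg Real.pi_pos.le hx.1)
          (mul_le_of_le_one_right Real.pi_pos.le hx.2), mul_div_cancel_left₀ _ Real.pi_ne_zero]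
      rw [h5] at h1
      have h2 := hclip2 (u x) (v x) (hB x hx)
      have h4 := h1.trans_le (min_le_right _ _)
      rw [cosPoly, Real.norm_eq_abs]
      exact (abs_sub_le _ (max (-B) (min B (u x))) _).trans (add_le_add h4.le h2)
    have hui : Integrable (fun x => v x - u x) (volume.restrict (Icc (0 : ℝ) 1)) :=
      hvi.sub (u.continuous.continuousOn.integrableOn_Icc)
    have hPi : Integrable (fun x => cosPoly P x - v x) (volume.restrict (Icc (0 : ℝ) 1)) :=
      ((continuous_cosPoly P).continuousOn.integrableOn_Icc).sub hvi
    calc _ ≤ ∫ x in Icc (0 : ℝ) 1, (ε / 2 + ‖v x - u x‖) :=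
          setIntegral_mono_on hPi.abs ((integrable_const _).add hui.norm) measurableSet_Icc hpt
      _ = ε / 2 + ∫ x in Icc (0 : ℝ) 1, ‖v x - u x‖ := by
          rw [integral_add (integrable_const _) hui.norm]
          simp
      _ ≤ ε := by linarith

theorem sum_Icc_eq_of_le {K L : ℕ} (hKL : K ≤ L) {c : ℤ → ℝ}
    (hc : ∀ k, (K : ℤ) < |k| → c k = 0) (u : ℤ → ℝ) :
    ∑ k ∈ Finset.Icc (-(L : ℤ)) L, c k * u k = ∑ k ∈ Finset.Icc (-(K : ℤ)) K, c k * u k := by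
  refine (Finset.sum_subset (Finset.Icc_subset_Icc (by omega) (by omega)) fun k _ hk => ?_).symm
  rw [hc k, zero_mul]
  rw [Finset.mem_Icc, not_and_or] at hk
  rw [lt_abs]
  omega

/-- Multiplication by a cosine polynomial is a convolution of the frequencies. -/
theorem exists_cosPoly_mul_cos (P : Polynomial ℝ) : ∃ (K : ℕ) (c : ℤ → ℝ),
    (∀ k, (K : ℤ) < |k| → c k = 0) ∧ ∀ (j : ℤ) (x : ℝ),
      cosPoly P x * Real.cos (Real.pi * j * x) =
        ∑ k ∈ Finset.Icc (-(K : ℤ)) K, c k * Real.cos (Real.pi * (j + k : ℤ) * x) := by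
  induction P using Polynomial.induction_on' with
  | add P Q hP hQ =>
    obtain ⟨K, c, hc, hP⟩ := hP
    obtain ⟨L, d, hd, hQ⟩ := hQ
    refine ⟨max K L, fun k => c k + d k, fun k hk => ?_, fun j x => ?_⟩
    · rw [Nat.cast_max, max_lt_iff] at hk
      simp only
      rw [hc k hk.1, hd k hk.2, add_zero]
    · simp_rw [add_mul, Finset.sum_add_distrib]
      rw [sum_Icc_eq_of_le (le_max_left K L) hc, sum_Icc_eq_of_le (le_max_right K L) hd, ← hP, ← hQ]
      simp [cosPoly, add_mul]
  | monomial r a =>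
    induction r with
    | zero =>
      refine ⟨0, fun k => if k = 0 then a else 0, fun k hk => ?_, fun j x => ?_⟩
      · have : k ≠ 0 := by
          rintro rfl
          simp at hk
        simp [this]
      · simp [cosPoly]
    | succ r ih =>
      obtain ⟨K, c, hc, hP⟩ := ih
      refine ⟨K + 1, fun k => (c (k - 1) + c (k + 1)) / 2, fun k hk => ?_, fun j x => ?_⟩
      · rw [lt_abs] at hk
        push_cast at hk
        simp only
        rw [hc (k - 1) (by rw [lt_abs]; omega), hc (k + 1) (by rw [lt_abs]; omega)]
        simp
      -- A further factor cos πx averages the shifts of the frequency by +1 and by -1.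
      · have e1 : cosPoly (Polynomial.monomial (r + 1) a) x * Real.cos (Real.pi * j * x) =
            (cosPoly (Polynomial.monomial r a) x * Real.cos (Real.pi * (j - 1 : ℤ) * x) +
              cosPoly (Polynomial.monomial r a) x * Real.cos (Real.pi * (j + 1 : ℤ) * x)) / 2 := by
          have := cos_mul_cos_eq j 1 x
          simp only [mul_one] at this
          simp only [cosPoly, Polynomial.eval_monomial, pow_succ]
          push_cast
          linear_combination (a * Real.cos (Real.pi * x) ^ r) * this
        rw [e1, hP, hP]
        have s1 : ∑ k ∈ Finset.Icc (-(K : ℤ)) K, c k * Real.cos (Real.pi * (j + 1 + k : ℤ) * x) =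
            ∑ k ∈ Finset.Icc (-((K + 1 : ℕ) : ℤ)) (K + 1 : ℕ),
              c (k - 1) * Real.cos (Real.pi * (j + k : ℤ) * x) := by
          refine Finset.sum_bij_ne_zero (fun k _ _ => k + 1) ?_ ?_ ?_ ?_
          · intro k _ hk
            have : ¬ (K : ℤ) < |k| := fun h => hk (by rw [hc k h, zero_mul])
            rw [lt_abs] at this
            rw [Finset.mem_Icc]
            push_cast
            omega
          · intro k _ _ l _ _ h
            omega
          · intro k _ hk
            have : ¬ (K : ℤ) < |k - 1| := fun h => hk (by rw [hc _ h, zero_mul])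
            rw [lt_abs] at this
            refine ⟨k - 1, ?_, ?_, by omega⟩
            · rw [Finset.mem_Icc]
              omega
            · convert! hk using 4
              push_cast
              ring
          · intro k _ _
            rw [add_sub_cancel_right]
            congr 3
            push_cast
            ring
        have s2 : ∑ k ∈ Finset.Icc (-(K : ℤ)) K, c k * Real.cos (Real.pi * (j - 1 + k : ℤ) * x) =
            ∑ k ∈ Finset.Icc (-((K + 1 : ℕ) : ℤ)) (K + 1 : ℕ),
              c (k + 1) * Real.cos (Real.pi * (j + k : ℤ) * x) := by
          refine Finset.sum_bij_ne_zero (fun k _ _ => k - 1) ?_ ?_ ?_ ?_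
          · intro k _ hk
            have : ¬ (K : ℤ) < |k| := fun h => hk (by rw [hc k h, zero_mul])
            rw [lt_abs] at this
            rw [Finset.mem_Icc]
            push_cast
            omega
          · intro k _ _ l _ _ h
            omega
          · intro k _ hk
            have : ¬ (K : ℤ) < |k + 1| := fun h => hk (by rw [hc _ h, zero_mul])
            rw [lt_abs] at this
            refine ⟨k + 1, ?_, ?_, by omega⟩
            · rw [Finset.mem_Icc]
              omega
            · convert! hk using 4
              push_cast
              ring
          · intro k _ _
            rw [sub_add_cancel]
            congr 3
            push_cast
            ring
        rw [s1, s2, ← Finset.sum_add_distrib, Finset.sum_div]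
        exact Finset.sum_congr rfl fun k _ => by ring

/-- The action of a function `h` on the cosine basis: `h φ_{j+K} = ∑ᵢ dᵢ φ_{j+i}`, where `i` runs
from `0` to `2K`. -/
structure IsMultiplier (h : ℝ → ℝ) (K : ℕ) (d : ℤ → ℝ) : Prop where
  support : ∀ i : ℤ, i < 0 ∨ 2 * K < i → d i = 0
  mul_eq : ∀ j : ℕ, 1 ≤ j → ∀ x, h x * cosBasis (j + K) x =
    ∑ i ∈ Finset.range (2 * K + 1), d i * cosBasis (j + i) x
  integral_sq : ∀ j : ℕ, 1 ≤ j →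
    ∫ x in (0 : ℝ)..1, (h x * cosBasis (j + K) x) ^ 2 = ∫ x in (0 : ℝ)..1, h x ^ 2

theorem integral_sq_sum_cosBasis (s : Finset ℕ) (b : ℕ → ℝ) :
    ∫ x in (0 : ℝ)..1, (∑ i ∈ s, b i * cosBasis i x) ^ 2 = ∑ i ∈ s, b i ^ 2 := by
  simp_rw [sq, Finset.mul_sum]
  rw [intervalIntegral.integral_finsetSum fun i _ =>
    Continuous.intervalIntegrable (by fun_prop) _ _]
  refine Finset.sum_congr rfl fun i hi => ?_
  have e1 : ∀ x, (∑ i ∈ s, b i * cosBasis i x) * (b i * cosBasis i x) =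
      b i * ((∑ i ∈ s, b i * cosBasis i x) * cosBasis i x) := fun x => by ring
  simp_rw [e1]
  rw [intervalIntegral.integral_const_mul, integral_sum_mul_cosBasis, if_pos hi]

theorem sum_range_cosBasis_shift (b : ℕ → ℝ) (N j : ℕ) (x : ℝ) :
    ∑ i ∈ Finset.range N, b i * cosBasis (j + i) x =
      ∑ r ∈ Finset.Ico j (j + N), b (r - j) * cosBasis r x := by
  rw [Finset.sum_Ico_eq_sum_range, Nat.add_sub_cancel_left]
  exact Finset.sum_congr rfl fun i _ => by rw [Nat.add_sub_cancel_left]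

/-- Both sides are the squared norm of hφ_{1+K}, the left one by Parseval. -/
theorem IsMultiplier.sum_sq {h : ℝ → ℝ} {K : ℕ} {d : ℤ → ℝ} (hd : IsMultiplier h K d) :
    ∑ i ∈ Finset.range (2 * K + 1), d i ^ 2 = ∫ x in (0 : ℝ)..1, h x ^ 2 := by
  rw [← hd.integral_sq 1 le_rfl]
  simp_rw [hd.mul_eq 1 le_rfl, sum_range_cosBasis_shift (fun i => d i)]
  rw [integral_sq_sum_cosBasis, Finset.sum_Ico_eq_sum_range, Nat.add_sub_cancel_left]
  exact Finset.sum_congr rfl fun i _ => by rw [Nat.add_sub_cancel_left]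

/-- With j ≥ 1 all frequencies j + i are positive, so every basis function involved has the same
normalisation √2. For the norm, 2cos² = 1 + cos of the doubled frequency, and after multiplication
by h² the oscillating part has frequencies at least 2j > 0 and integrates to zero. The norm of
hφ_{j+K} is thus exactly that of h. -/
theorem exists_isMultiplier (P : Polynomial ℝ) :
    ∃ (K : ℕ) (d : ℤ → ℝ), IsMultiplier (cosPoly P) K d := by
  obtain ⟨K, c, hc, hP⟩ := exists_cosPoly_mul_cos P
  have hsum : ∀ u : ℤ → ℝ, ∑ k ∈ Finset.Icc (-(K : ℤ)) K, u k =
      ∑ i ∈ Finset.range (2 * K + 1), u (i - K) := by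
    intro u
    refine Finset.sum_bij' (fun k _ => (k + K).toNat) (fun i _ => (i : ℤ) - K) ?_ ?_ ?_ ?_ ?_
    · intro k hk
      rw [Finset.mem_Icc] at hk
      rw [Finset.mem_range]
      omega
    · intro i hi
      rw [Finset.mem_range] at hi
      rw [Finset.mem_Icc]
      omega
    · intro k hk
      rw [Finset.mem_Icc] at hk
      omega
    · intro i hi
      omega
    · intro k hk
      rw [Finset.mem_Icc] at hk
      congr 1
      omega
  refine ⟨K, fun i => c (i - K), fun i hi => hc _ (by rw [lt_abs]; omega), fun j hj x => ?_,
    fun j hj => ?_⟩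
  · have h1 := hP (j + K : ℕ) x
    rw [hsum] at h1
    rw [cosBasis_eq, mul_left_comm]
    have h2 : cosNorm (j + K) = √2 := by simp [cosNorm]; omega
    push_cast at h1 ⊢
    rw [h1, Finset.mul_sum]
    refine Finset.sum_congr rfl fun i _ => ?_
    have h3 : cosNorm (j + i) = √2 := by simp [cosNorm]; omega
    rw [cosBasis_eq, h2, h3]
    push_cast
    rw [show (j : ℝ) + K + (i - K) = j + i by ring]
    ring
  · have h2 : cosNorm (j + K) = √2 := by simp [cosNorm]; omega
    have hs : √2 * √2 = (2 : ℝ) := Real.mul_self_sqrt (by norm_num)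
    have e1 : ∀ x, (cosPoly P x * cosBasis (j + K) x) ^ 2 = cosPoly P x ^ 2 +
        ∑ k ∈ Finset.Icc (-(K : ℤ)) K, c k * ∑ l ∈ Finset.Icc (-(K : ℤ)) K, c l *
          Real.cos (Real.pi * (2 * (j + K) + k + l : ℤ) * x) := by
      intro x
      have h3 := hP (2 * (j + K)) x
      have h4 : cosPoly P x * ∑ k ∈ Finset.Icc (-(K : ℤ)) K, c k *
          Real.cos (Real.pi * (2 * (j + K) + k : ℤ) * x) =
          ∑ k ∈ Finset.Icc (-(K : ℤ)) K, c k * ∑ l ∈ Finset.Icc (-(K : ℤ)) K, c l *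
          Real.cos (Real.pi * (2 * (j + K) + k + l : ℤ) * x) := by
        rw [Finset.mul_sum]
        exact Finset.sum_congr rfl fun k _ => by rw [mul_left_comm, hP]
      rw [← h4, ← h3, cosBasis_eq, h2]
      have h5 := cos_mul_cos_eq ((j + K : ℕ) : ℝ) ((j + K : ℕ) : ℝ) x
      rw [sub_self, mul_zero, zero_mul, Real.cos_zero] at h5
      push_cast at h5 ⊢
      rw [show 2 * ((j : ℝ) + K) = j + K + (j + K) by ring]
      linear_combination (cosPoly P x ^ 2 * Real.cos (Real.pi * (j + K) * x) ^ 2) * hs +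
        (2 * cosPoly P x ^ 2) * h5
    simp_rw [e1]
    rw [intervalIntegral.integral_add (Continuous.intervalIntegrable (by fun_prop) _ _)
      (Continuous.intervalIntegrable (by fun_prop) _ _), add_eq_left,
      intervalIntegral.integral_finsetSum fun k _ =>
        Continuous.intervalIntegrable (by fun_prop) _ _]
    refine Finset.sum_eq_zero fun k hk => ?_
    rw [intervalIntegral.integral_const_mul, intervalIntegral.integral_finsetSum fun l _ =>
        Continuous.intervalIntegrable (by fun_prop) _ _, Finset.sum_eq_zero fun l hl => ?_,
      mul_zero]
    rw [Finset.mem_Icc] at hk hl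
    rw [intervalIntegral.integral_const_mul, integral_cos_int_mul, if_neg (by omega), mul_zero]

theorem exists_cosPoly_eq_sum (P : Polynomial ℝ) : ∃ (s : Finset ℤ) (b : ℤ → ℝ),
    ∀ x, cosPoly P x = ∑ k ∈ s, b k * cosBasis k.natAbs x := by
  obtain ⟨K, c, -, hP⟩ := exists_cosPoly_mul_cos P
  refine ⟨Finset.Icc (-(K : ℤ)) K, fun k => c k / cosNorm k.natAbs, fun x => ?_⟩
  have h := hP 0 x
  simp only [Int.cast_zero, mul_zero, zero_mul, Real.cos_zero, mul_one, zero_add] at h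
  rw [h]
  refine Finset.sum_congr rfl fun k _ => ?_
  rw [cosBasis_eq, ← mul_assoc, div_mul_cancel₀ _ (cosNorm_pos _).ne']
  congr 1
  rw [Nat.cast_natAbs, Int.cast_abs]
  rcases abs_choice (k : ℝ) with h | h <;> rw [h]
  rw [← Real.cos_neg]
  congr 1
  ring

/-! ### Convergence of the low-frequency part -/

@[fun_prop]
theorem continuous_lowFreq (f : ℝ → ℝ) (M : ℕ) : Continuous (lowFreq f M) := by
  unfold lowFreq
  fun_prop

theorem integral_abs_le_of_sq_le {E : Type*} [MeasurableSpace E] {μ : Measure E}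
    [IsProbabilityMeasure μ] {u : E → ℝ} (hu : MemLp u 2 μ) {t : ℝ} (ht : 0 < t)
    (h : ∫ x, u x ^ 2 ∂μ ≤ t ^ 2) : ∫ x, |u x| ∂μ ≤ t := by
  have h1 : ∫ x, |u x| ∂μ ≤ ∫ x, (t / 2 + (2 * t)⁻¹ * u x ^ 2) ∂μ := by
    refine integral_mono (hu.integrable one_le_two).abs
      ((integrable_const _).add (hu.integrable_sq.const_mul _)) fun x => ?_
    have e1 : t / 2 + (2 * t)⁻¹ * u x ^ 2 - |u x| = (2 * t)⁻¹ * (|u x| - t) ^ 2 := by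
      rw [← sq_abs (u x)]
      field_simp
      ring
    have : 0 ≤ (2 * t)⁻¹ * (|u x| - t) ^ 2 := by positivity
    simp only
    linarith
  refine h1.trans ?_
  rw [integral_add (integrable_const _) (hu.integrable_sq.const_mul _), integral_const_mul]
  have h2 : (2 * t)⁻¹ * ∫ x, u x ^ 2 ∂μ ≤ (2 * t)⁻¹ * t ^ 2 :=
    mul_le_mul_of_nonneg_left h (by positivity)
  have h3 : (2 * t)⁻¹ * t ^ 2 = t / 2 := by
    field_simp
  simp only [integral_const, probReal_univ, smul_eq_mul, one_mul]
  linarith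

instance isProbabilityMeasure_restrict_Icc :
    IsProbabilityMeasure ((volume : Measure ℝ).restrict (Icc (0 : ℝ) 1)) :=
  ⟨by simp⟩

/-- The low-frequency part is an orthogonal projection in L²[0,1]; once M exceeds all the
frequencies of a cosine polynomial, it is at least as close to f as that polynomial. Only
convergence in mean results, with no assumption on the cosine series of f. -/
theorem tendsto_integral_abs_lowFreq_sub {f : ℝ → ℝ} (hf : Measurable f) {B : ℝ}
    (hB : ∀ x ∈ Icc (0 : ℝ) 1, |f x| ≤ B) {ε : ℝ} (hε : 0 < ε) :
    ∀ᶠ M in atTop, ∫ x in Icc (0 : ℝ) 1, |lowFreq f M x - f x| ≤ ε := by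
  have hB0 : 0 ≤ B := (abs_nonneg _).trans (hB 0 (by simp))
  -- Since |P - f| ≤ 2B + 1, this L¹ precision gives squared L² error at most ε².
  obtain ⟨P, hPB, hP⟩ := exists_cosPoly_near hf hB
    (ε := ε ^ 2 / (2 * B + 1)) (by positivity)
  obtain ⟨s, b, hs⟩ := exists_cosPoly_eq_sum P
  set μ := (volume : Measure ℝ).restrict (Icc (0 : ℝ) 1) with hμ
  have hcont : ∀ u : ℝ → ℝ, Continuous u → MemLp u 2 μ := fun u hu => by
    obtain ⟨L, hL⟩ := isCompact_Icc.exists_bound_of_continuousOn hu.continuousOn (s := Icc (0:ℝ) 1)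
    exact MemLp.of_bound hu.aestronglyMeasurable L
      ((ae_restrict_iff' measurableSet_Icc).2 (ae_of_all _ hL))
  have hf2 : MemLp f 2 μ := MemLp.of_bound hf.aestronglyMeasurable B
      ((ae_restrict_iff' measurableSet_Icc).2 (ae_of_all _ hB))
  have hPf : ∫ x, (cosPoly P x - f x) ^ 2 ∂μ ≤ ε ^ 2 := by
    have hd : MemLp (fun x => cosPoly P x - f x) 2 μ := (hcont _ (by fun_prop)).sub hf2
    calc _ ≤ ∫ x, (2 * B + 1) * |cosPoly P x - f x| ∂μ := by
          refine setIntegral_mono_on hd.integrable_sq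
            ((hd.integrable one_le_two).abs.const_mul _) measurableSet_Icc fun x hx => ?_
          rw [← sq_abs, sq]
          refine mul_le_mul_of_nonneg_right ?_ (abs_nonneg _)
          exact (abs_sub _ _).trans (by linarith [hPB x, hB x hx])
      _ ≤ (2 * B + 1) * (ε ^ 2 / (2 * B + 1)) := by
          rw [integral_const_mul]
          exact mul_le_mul_of_nonneg_left hP (by positivity)
      _ = ε ^ 2 := by field_simp
  filter_upwards [eventually_gt_atTop (s.sup Int.natAbs)] with M hM
  have hr2 : MemLp (fun x => lowFreq f M x - f x) 2 μ := (hcont _ (by fun_prop)).sub hf2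
  have horth : ∀ j < M, ∫ x, (lowFreq f M x - f x) * cosBasis j x ∂μ = 0 := by
    intro j hj
    have i1 : Integrable (fun x => lowFreq f M x * cosBasis j x) μ :=
      (hcont (fun x => lowFreq f M x * cosBasis j x) (by fun_prop)).integrable one_le_two
    have i2 : Integrable (fun x => f x * cosBasis j x) μ :=
      hf2.integrable_mul (hcont _ (by fun_prop))
    simp_rw [sub_mul]
    rw [integral_sub i1 i2, hμ, setIntegral_Icc_eq, setIntegral_Icc_eq]
    unfold lowFreq
    rw [integral_sum_mul_cosBasis, if_pos (Finset.mem_range.2 hj), cosCoeff, sub_self]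
  have hi : ∀ j, Integrable (fun x => (lowFreq f M x - f x) * cosBasis j x) μ := fun j =>
    hr2.integrable_mul (hcont _ (by fun_prop))
  have hcross : ∫ x, (lowFreq f M x - f x) * (lowFreq f M x - cosPoly P x) ∂μ = 0 := by
    have e1 : ∀ x, (lowFreq f M x - f x) * (lowFreq f M x - cosPoly P x) =
        ∑ j ∈ Finset.range M, cosCoeff f j * ((lowFreq f M x - f x) * cosBasis j x) -
        ∑ k ∈ s, b k * ((lowFreq f M x - f x) * cosBasis k.natAbs x) := by
      intro x
      rw [mul_sub, hs]
      conv_lhs => rw [lowFreq]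
      rw [Finset.mul_sum, Finset.mul_sum]
      congr 1
      · refine Finset.sum_congr rfl fun j _ => ?_
        rw [lowFreq]
        ring
      · exact Finset.sum_congr rfl fun j _ => by rw [lowFreq]; ring
    simp_rw [e1]
    rw [integral_sub (integrable_finsetSum _ fun j _ => (hi j).const_mul _)
      (integrable_finsetSum _ fun j _ => (hi _).const_mul _),
      integral_finsetSum _ fun j _ => (hi j).const_mul _,
      integral_finsetSum _ fun j _ => (hi _).const_mul _,
      Finset.sum_eq_zero, Finset.sum_eq_zero, sub_zero]
    · intro k hk
      rw [integral_const_mul, horth _ ((Finset.le_sup hk).trans_lt hM), mul_zero]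
    · intro j hj
      rw [integral_const_mul, horth _ (Finset.mem_range.1 hj), mul_zero]
  refine integral_abs_le_of_sq_le hr2 hε (le_trans ?_ hPf)
  have hg2 : MemLp (fun x => lowFreq f M x - cosPoly P x) 2 μ := hcont _ (by fun_prop)
  have e2 : ∀ x, (cosPoly P x - f x) ^ 2 = (lowFreq f M x - f x) ^ 2 -
      2 * ((lowFreq f M x - f x) * (lowFreq f M x - cosPoly P x)) +
      (lowFreq f M x - cosPoly P x) ^ 2 := fun x => by ring
  have hri : Integrable (fun x => (lowFreq f M x - f x) * (lowFreq f M x - cosPoly P x)) μ :=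
    hr2.integrable_mul hg2
  simp_rw [e2]
  rw [integral_add (integrable_fun_sub hr2.integrable_sq (hri.const_mul 2)) hg2.integrable_sq,
    integral_sub hr2.integrable_sq (hri.const_mul 2), integral_const_mul, hcross]
  have : 0 ≤ ∫ x, (lowFreq f M x - cosPoly P x) ^ 2 ∂μ := integral_nonneg fun x => sq_nonneg _
  linarith

/-! ### Finite cosine sums as members of the family -/

theorem Model.IsInterior.isMean {m : Model} {t : ℝ} (h : m.IsInterior t) : m.IsMean t := by
  cases m with
  | bernoulli => exact ⟨h.1.le, (h.2 rfl).le⟩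
  | poisson => exact h.1

theorem cosCoeff_lowFreq_add (f₀ : ℝ → ℝ) {M : ℕ} {s : Finset ℕ} (b : ℕ → ℝ) {j : ℕ}
    (hj : M ≤ j) : cosCoeff (fun x => lowFreq f₀ M x + ∑ i ∈ s, b i * cosBasis i x) j =
      if j ∈ s then b j else 0 := by
  unfold cosCoeff
  simp_rw [add_mul]
  rw [intervalIntegral.integral_add (Continuous.intervalIntegrable (by fun_prop) _ _)
    (Continuous.intervalIntegrable (by fun_prop) _ _), integral_sum_mul_cosBasis]
  unfold lowFreq
  rw [integral_sum_mul_cosBasis, if_neg (by simpa using hj), zero_add]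

theorem mem_family {f₀ f : ℝ → ℝ} {ρ : ℝ≥0∞} {M : ℕ} {α Q t : ℝ} {s : Finset ℕ} {b : ℕ → ℝ}
    (hf : f = fun x => lowFreq f₀ M x + ∑ i ∈ s, b i * cosBasis i x) (hs : ∀ i ∈ s, M ≤ i)
    (hQ : ∑ i ∈ s, (1 + (Real.pi * i) ^ (2 * α)) * b i ^ 2 ≤ Q)
    (ht : ∀ x ∈ Icc (0 : ℝ) 1, |∑ i ∈ s, b i * cosBasis i x| ≤ t) (hρ : ENNReal.ofReal t < ρ) :
    f ∈ family f₀ ρ M α Q := by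
  have hc : ∀ j, M ≤ j → cosCoeff f j = if j ∈ s then b j else 0 := fun j hj => by
    rw [hf, cosCoeff_lowFreq_add f₀ b hj]
  have hx : ∀ x, f x - lowFreq f₀ M x = ∑ i ∈ s, b i * cosBasis i x := fun x => by
    rw [hf, add_sub_cancel_left]
  have hsum : HasSum (fun j : ℕ =>
      if M ≤ j then (1 + (Real.pi * j) ^ (2 * α)) * cosCoeff f j ^ 2 else 0)
      (∑ i ∈ s, (1 + (Real.pi * i) ^ (2 * α)) * b i ^ 2) := by
    have h := hasSum_sum_of_ne_finset_zero (L := .unconditional ℕ) (s := s) (f := fun j : ℕ =>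
      if M ≤ j then (1 + (Real.pi * j) ^ (2 * α)) * cosCoeff f j ^ 2 else 0) fun j hj => by
        split_ifs with h
        · rw [hc j h, if_neg hj]
          simp
        · rfl
    convert h using 1
    exact Finset.sum_congr rfl fun i hi => by rw [if_pos (hs i hi), hc i (hs i hi), if_pos hi]
  refine ⟨fun x _ => ?_, hsum.summable, hsum.tsum_eq ▸ hQ, ?_⟩
  · have h := hasSum_sum_of_ne_finset_zero (L := .unconditional ℕ) (s := s) (f := fun j : ℕ =>
      if M ≤ j then cosCoeff f j * cosBasis j x else 0) fun j hj => by
        split_ifs with h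
        · rw [hc j h, if_neg hj, zero_mul]
        · rfl
    rw [hx]
    convert h using 1
    exact Finset.sum_congr rfl fun i hi => by rw [if_pos (hs i hi), hc i (hs i hi), if_pos hi]
  · refine lt_of_le_of_lt (iSup₂_le fun x hxI => ?_) hρ
    rw [hx]
    exact ENNReal.ofReal_le_ofReal (ht x hxI)

/-! ### The directions of the submodel -/

/-- The `l`-th direction: a multiple of `h φ_{L+K+l}`. -/
def direction (h : ℝ → ℝ) (r : ℕ → ℝ) (L K l : ℕ) (x : ℝ) : ℝ :=
  r l * (h x * cosBasis (L + l + K) x)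

/-- The coefficient of `φ_{L+i}` in `∑ ξ_l r_l h φ_{L+K+l}`. -/
def curveCoeff {k : ℕ} (r : ℕ → ℝ) (d : ℤ → ℝ) (ξ : Fin k → ℝ) (i : ℕ) : ℝ :=
  ∑ l : Fin k, r l * d ((i : ℤ) - (l : ℕ)) * ξ l

section Direction

variable {h : ℝ → ℝ} {K k L : ℕ} {d : ℤ → ℝ} {r : ℕ → ℝ}

/-- Since d vanishes off [0, 2K], a sum over the shifted window may be extended to all frequencies
of the curve. It is applied with F the identity and with F the square. -/
theorem IsMultiplier.sum_shift (hd : IsMultiplier h K d) {l : ℕ} (hl : l < k) (u : ℕ → ℝ)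
    (F : ℝ → ℝ) (hF : F 0 = 0) :
    ∑ i ∈ Finset.range (k + 2 * K), F (d ((i : ℤ) - l)) * u i =
      ∑ i ∈ Finset.range (2 * K + 1), F (d i) * u (l + i) := by
  have h1 : ∑ i ∈ Finset.range (2 * K + 1), F (d i) * u (l + i) =
      ∑ i ∈ Finset.Ico l (l + (2 * K + 1)), F (d ((i : ℤ) - l)) * u i := by
    rw [Finset.sum_Ico_eq_sum_range, Nat.add_sub_cancel_left]
    refine Finset.sum_congr rfl fun i _ => ?_
    push_cast
    rw [add_sub_cancel_left]
  rw [h1]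
  refine (Finset.sum_subset (fun i hi => ?_) fun i _ hi => ?_).symm
  · rw [Finset.mem_Ico] at hi
    rw [Finset.mem_range]
    omega
  · rw [Finset.mem_Ico] at hi
    rw [hd.support _ (by omega), hF, zero_mul]

theorem IsMultiplier.sum_direction (hd : IsMultiplier h K d) (hL : 1 ≤ L) (ξ : Fin k → ℝ) (x : ℝ) :
    ∑ l : Fin k, ξ l * direction h r L K l x =
      ∑ i ∈ Finset.range (k + 2 * K), curveCoeff r d ξ i * cosBasis (L + i) x := by
  unfold curveCoeff direction
  simp_rw [Finset.sum_mul]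
  rw [Finset.sum_comm]
  refine Finset.sum_congr rfl fun l _ => ?_
  rw [hd.mul_eq _ (by omega)]
  have := hd.sum_shift l.2 (fun i => cosBasis (L + i) x) id rfl
  simp only [id] at this
  have e1 : ∀ i ∈ Finset.range (k + 2 * K), r l * d ((i : ℤ) - (l : ℕ)) * ξ l * cosBasis (L + i) x =
      ξ l * r l * (d ((i : ℤ) - (l : ℕ)) * cosBasis (L + i) x) := fun i _ => by ring
  rw [Finset.sum_congr rfl e1, ← Finset.mul_sum, this, mul_assoc]
  simp_rw [add_assoc]

theorem IsMultiplier.sum_abs_le (hd : IsMultiplier h K d) (i : ℕ) :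
    ∑ l : Fin k, |d ((i : ℤ) - (l : ℕ))| ≤ ∑ a ∈ Finset.range (2 * K + 1), |d a| := by
  rw [Fin.sum_univ_eq_sum_range (fun l => |d ((i : ℤ) - l)|)]
  have h1 : ∑ l ∈ Finset.range k with l ≤ i ∧ i ≤ l + 2 * K, |d ((i : ℤ) - l)| =
      ∑ l ∈ Finset.range k, |d ((i : ℤ) - l)| := by
    refine Finset.sum_subset (Finset.filter_subset _ _) fun l hl hl' => ?_
    rw [Finset.mem_filter, not_and] at hl'
    have := hl' hl
    rw [hd.support _ (by omega), abs_zero]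
  rw [← h1]
  have h2 : ∑ l ∈ Finset.range k with l ≤ i ∧ i ≤ l + 2 * K, |d ((i : ℤ) - l)| =
      ∑ a ∈ (Finset.range k |>.filter fun l => l ≤ i ∧ i ≤ l + 2 * K).image fun l => i - l,
        |d a| := by
    rw [Finset.sum_image fun a ha b hb hab => ?_]
    · refine Finset.sum_congr rfl fun l hl => ?_
      rw [Finset.mem_filter] at hl
      rw [Nat.cast_sub hl.2.1]
    · simp only [Finset.coe_filter, Set.mem_ofPred_eq] at ha hb
      omega
  rw [h2]
  refine Finset.sum_le_sum_of_subset_of_nonneg (fun a ha => ?_) fun a _ _ => abs_nonneg _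
  rw [Finset.mem_image] at ha
  obtain ⟨l, hl, rfl⟩ := ha
  rw [Finset.mem_filter] at hl
  rw [Finset.mem_range]
  omega

theorem IsMultiplier.abs_curveCoeff_le (hd : IsMultiplier h K d) {b : ℝ} (hb : 0 ≤ b)
    (hr : ∀ l < k, |r l| ≤ b)
    {ξ : Fin k → ℝ} (hξ : ξ ∈ paramBox k) (i : ℕ) :
    |curveCoeff r d ξ i| ≤ b * ∑ a ∈ Finset.range (2 * K + 1), |d a| := by
  unfold curveCoeff
  refine (Finset.abs_sum_le_sum_abs _ _).trans ?_
  refine le_trans ?_ (mul_le_mul_of_nonneg_left (hd.sum_abs_le (k := k) i) hb)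
  rw [Finset.mul_sum]
  refine Finset.sum_le_sum fun l _ => ?_
  rw [abs_mul, abs_mul]
  refine mul_le_of_le_one_right (by positivity) (abs_le.2 (hξ l)) |>.trans ?_
  exact mul_le_mul_of_nonneg_right (hr l l.2) (abs_nonneg _)

end Direction

/-! ### Concentration under the prior -/

namespace IsPrior

variable {q τ : ℝ → ℝ} {V J : ℝ} (hq : IsPrior q τ V J) {k : ℕ}

include hq

theorem memLp_prior {F : (Fin k → ℝ) → ℝ} (hF : Measurable F) {c : ℝ}
    (hc : ∀ ξ ∈ paramBox k, |F ξ| ≤ c) (p : ℝ≥0∞) : MemLp F p (prior k q) := by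
  have := hq.isProbabilityMeasure_prior (k := k)
  refine MemLp.of_bound hF.aestronglyMeasurable c ?_
  filter_upwards [hq.ae_mem_paramBox] with ξ hξ using hc ξ hξ

theorem iIndepFun_prior :
    ProbabilityTheory.iIndepFun (fun (l : Fin k) (ξ : Fin k → ℝ) => ξ l) (prior k q) := by
  have := hq.isProbabilityMeasure
  exact ProbabilityTheory.iIndepFun_pi (X := fun _ => id) fun _ => aemeasurable_id

theorem integral_prior_mul (i j : Fin k) :
    ∫ ξ, ξ i * ξ j ∂(prior k q) = if i = j then V else 0 := by
  have := hq.isProbabilityMeasure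
  have h1 : ∫ x, x ∂(priorMeasure q) = 0 := by rw [hq.integral_priorMeasure, hq.integral_id_mul]
  split_ifs with h
  · subst h
    have h2 := integral_pi_eval (P := priorMeasure q) (u := fun x => x * x)
      (hq.memLp_id.integrable_mul hq.memLp_id).1 i
    unfold prior
    rw [h2, hq.integral_priorMeasure, ← hq.var]
    exact integral_congr_ae (ae_of_all _ fun x => by simp only [sq])
  · have hm := hq.memLp_id.aestronglyMeasurable
    rw [prior, integral_pi_mul_of_ne hm hm h, h1, zero_mul]

theorem integral_prior_sq (a : Fin k → ℝ) :
    ∫ ξ, (∑ l, a l * ξ l) ^ 2 ∂(prior k q) = V * ∑ l, a l ^ 2 := by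
  have := hq.isProbabilityMeasure_prior (k := k)
  have hi : ∀ i j : Fin k, Integrable (fun ξ : Fin k → ℝ => ξ i * ξ j) (prior k q) := fun i j =>
    (hq.memLp_prior (c := 1) (by fun_prop) (fun ξ hξ => by
      rw [abs_mul]
      exact mul_le_one₀ (abs_le.2 (hξ i)) (abs_nonneg _) (abs_le.2 (hξ j))) 1).integrable le_rfl
  have e1 : ∀ ξ : Fin k → ℝ, (∑ l, a l * ξ l) ^ 2 = ∑ i, ∑ j, a i * a j * (ξ i * ξ j) := by
    intro ξ
    rw [sq, Finset.sum_mul_sum]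
    exact Finset.sum_congr rfl fun i _ => Finset.sum_congr rfl fun j _ => by ring
  simp_rw [e1]
  rw [integral_finsetSum _ fun i _ => integrable_finsetSum _ fun j _ => (hi i j).const_mul _,
    Finset.mul_sum]
  refine Finset.sum_congr rfl fun i _ => ?_
  rw [integral_finsetSum _ fun j _ => (hi i j).const_mul _]
  simp_rw [integral_const_mul, hq.integral_prior_mul]
  simp only [mul_ite, mul_zero, Finset.sum_ite_eq, Finset.mem_univ, if_true]
  ring

/-- Hoeffding's inequality: the terms are independent, centred because the prior density is even,
and confined to [-c,c]. -/
theorem prior_ge_le (a : Fin k → ℝ) {c t : ℝ} (hc : ∀ l, |a l| ≤ c) (ht : 0 ≤ t) :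
    (prior k q).real {ξ | t ≤ ∑ l, a l * ξ l} ≤ Real.exp (-t ^ 2 / (2 * (k * c ^ 2))) := by
  have := hq.isProbabilityMeasure_prior (k := k)
  have hmean : ∀ l, ∫ ξ, ξ l ∂(prior k q) = 0 := fun l => by
    have := hq.isProbabilityMeasure
    have h2 := integral_pi_eval (P := priorMeasure q) (u := fun x => x) hq.memLp_id.1 l
    unfold prior
    rw [h2, hq.integral_priorMeasure, hq.integral_id_mul]
  have hind : ProbabilityTheory.iIndepFun (fun (l : Fin k) (ξ : Fin k → ℝ) => a l * ξ l)
      (prior k q) := hq.iIndepFun_prior.comp (fun l x => a l * x) fun l => by fun_prop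
  have h := ProbabilityTheory.HasSubgaussianMGF.measure_sum_ge_le_of_iIndepFun hind
    (s := Finset.univ) (c := fun l => (‖c - -c‖₊ / 2) ^ 2) (fun l _ =>
      ProbabilityTheory.hasSubgaussianMGF_of_mem_Icc_of_integral_eq_zero
        (Measurable.aemeasurable (by fun_prop)) ?_ ?_) ht
  · convert h using 3
    have h2 : ‖c - -c‖ = 2 * |c| := by
      rw [sub_neg_eq_add, ← two_mul, norm_mul, Real.norm_eq_abs, Real.norm_eq_abs, abs_two]
    push_cast
    rw [h2, Finset.sum_const, Finset.card_univ, Fintype.card_fin, nsmul_eq_mul,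
      mul_div_cancel_left₀ _ two_ne_zero, sq_abs]
  · filter_upwards [hq.ae_mem_paramBox] with ξ hξ
    rw [Set.mem_Icc, ← abs_le, abs_mul]
    exact (mul_le_of_le_one_right (abs_nonneg _) (abs_le.2 (hξ l))).trans (hc l)
  · rw [integral_const_mul, hmean, mul_zero]

theorem prior_abs_ge_le (a : Fin k → ℝ) {c t : ℝ} (hc : ∀ l, |a l| ≤ c) (ht : 0 ≤ t) :
    (prior k q).real {ξ | t ≤ |∑ l, a l * ξ l|} ≤
      2 * Real.exp (-t ^ 2 / (2 * (k * c ^ 2))) := by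
  have := hq.isProbabilityMeasure_prior (k := k)
  have h1 := hq.prior_ge_le a hc ht
  have h2 := hq.prior_ge_le (fun l => -a l) (fun l => (abs_neg _).trans_le (hc l)) ht
  have hsub : {ξ : Fin k → ℝ | t ≤ |∑ l, a l * ξ l|} ⊆
      {ξ | t ≤ ∑ l, a l * ξ l} ∪ {ξ | t ≤ ∑ l, -a l * ξ l} := fun ξ hξ => by
    rw [Set.mem_ofPred_eq, le_abs] at hξ
    simpa [Finset.sum_neg_distrib] using hξ
  refine (measureReal_mono hsub).trans ((measureReal_union_le _ _).trans ?_)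
  linarith

/-- Concentration of a weighted sum of squares of linear forms which depend on few variables
each. -/
theorem prior_quadratic_gt_le (a : ℕ → Fin k → ℝ) {N T : ℕ} {c Q μ : ℝ} {w : ℕ → ℝ}
    (hw : ∀ i < N, 0 ≤ w i)
    (ha : ∀ i l, a i l ≠ 0 → (l : ℕ) ≤ i ∧ i ≤ l + T)
    (hc : ∀ i < N, ∀ ξ ∈ paramBox k, w i * (∑ l, a i l * ξ l) ^ 2 ≤ c)
    (hμ : V * ∑ i ∈ Finset.range N, w i * ∑ l, a i l ^ 2 ≤ μ) (hQ : μ < Q) :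
    (prior k q).real {ξ | Q < ∑ i ∈ Finset.range N, w i * (∑ l, a i l * ξ l) ^ 2} ≤
      N * (2 * T + 1) * c ^ 2 / (Q - μ) ^ 2 := by
  have := hq.isProbabilityMeasure_prior (k := k)
  set Y : ℕ → (Fin k → ℝ) → ℝ := fun i ξ => w i * (∑ l, a i l * ξ l) ^ 2 with hY
  have hYm : ∀ i, Measurable (Y i) := fun i => by
    simp only [hY]
    fun_prop
  have hY0 : ∀ i < N, ∀ ξ, 0 ≤ Y i ξ := fun i hi ξ => mul_nonneg (hw i hi) (sq_nonneg _)
  have hY2 : ∀ i < N, MemLp (Y i) 2 (prior k q) := fun i hi =>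
    hq.memLp_prior (hYm i) (fun ξ hξ => by
      rw [abs_of_nonneg (hY0 i hi ξ)]
      exact hc i hi ξ hξ) 2
  have hmean : ∫ ξ, (∑ i ∈ Finset.range N, Y i ξ) ∂(prior k q) ≤ μ := by
    rw [integral_finsetSum _ fun i hi => (hY2 i (Finset.mem_range.1 hi)).integrable one_le_two]
    refine le_trans (le_of_eq ?_) hμ
    rw [Finset.mul_sum]
    refine Finset.sum_congr rfl fun i _ => ?_
    simp only [hY]
    rw [integral_const_mul, hq.integral_prior_sq]
    ring
  -- For nearby indices E[Y_i Y_j] ≤ c² suffices, since the product of the nonnegative means may be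
  -- dropped. Each row has at most 2T + 1 such indices.
  have hcov : ∀ i < N, ∀ j < N, ProbabilityTheory.covariance (Y i) (Y j) (prior k q) ≤
      if i ≤ j + T ∧ j ≤ i + T then c ^ 2 else 0 := by
    intro i hi j hj
    split_ifs with h
    · rw [ProbabilityTheory.covariance_eq_sub (hY2 i hi) (hY2 j hj)]
      have h1 : 0 ≤ (∫ ξ, Y i ξ ∂(prior k q)) * ∫ ξ, Y j ξ ∂(prior k q) :=
        mul_nonneg (integral_nonneg (hY0 i hi)) (integral_nonneg (hY0 j hj))
      have h2 : ∫ ξ, (Y i * Y j) ξ ∂(prior k q) ≤ ∫ ξ, c ^ 2 ∂(prior k q) := by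
        refine integral_mono_ae ((hY2 i hi).integrable_mul (hY2 j hj)) (integrable_const _) ?_
        filter_upwards [hq.ae_mem_paramBox] with ξ hξ
        rw [sq]
        exact mul_le_mul (hc i hi ξ hξ) (hc j hj ξ hξ) (hY0 j hj ξ)
          ((hY0 i hi ξ).trans (hc i hi ξ hξ))
      simp only [integral_const, probReal_univ, smul_eq_mul, one_mul] at h2
      linarith
    -- Linear forms more than T apart involve disjoint sets of coordinates, hence are independent.
    · refine le_of_eq (ProbabilityTheory.IndepFun.covariance_eq_zero ?_ (hY2 i hi) (hY2 j hj))
      classical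
      let s : ℕ → Finset (Fin k) := fun i => Finset.univ.filter fun l => a i l ≠ 0
      have hst : Disjoint (s i) (s j) := by
        rw [Finset.disjoint_left]
        intro l h1 h2
        have h3 := ha i l (Finset.mem_filter.1 h1).2
        have h4 := ha j l (Finset.mem_filter.1 h2).2
        omega
      have hrep : ∀ i, Y i = (fun u : s i → ℝ => w i * (∑ l : s i, a i l * u l) ^ 2) ∘
          fun ξ (l : s i) => ξ l := by
        intro i
        ext ξ
        simp only [hY, Function.comp_apply]
        rw [Finset.sum_coe_sort (s i) fun l => a i l * ξ l]
        congr 2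
        refine (Finset.sum_subset (Finset.subset_univ _) fun l _ hl => ?_).symm
        have : a i l = 0 := by simpa [s] using hl
        rw [this, zero_mul]
      rw [hrep i, hrep j]
      exact (hq.iIndepFun_prior.indepFun_finset (s i) (s j) hst fun l => by fun_prop).comp
        (by fun_prop) (by fun_prop)
  have hS2 : MemLp (fun ξ => ∑ i ∈ Finset.range N, Y i ξ) 2 (prior k q) :=
    memLp_finsetSum _ fun i hi => hY2 i (Finset.mem_range.1 hi)
  have hvar : ProbabilityTheory.variance (fun ξ => ∑ i ∈ Finset.range N, Y i ξ) (prior k q) ≤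
      N * (2 * T + 1) * c ^ 2 := by
    rw [ProbabilityTheory.variance_fun_sum' fun i hi => hY2 i (Finset.mem_range.1 hi)]
    have h1 : ∀ i ∈ Finset.range N, ∑ j ∈ Finset.range N,
        ProbabilityTheory.covariance (Y i) (Y j) (prior k q) ≤ (2 * T + 1) * c ^ 2 := by
      intro i hi
      rw [Finset.mem_range] at hi
      refine (Finset.sum_le_sum fun j hj => hcov i hi j (Finset.mem_range.1 hj)).trans ?_
      rw [← Finset.sum_filter, Finset.sum_const, nsmul_eq_mul]
      refine mul_le_mul_of_nonneg_right ?_ (sq_nonneg c)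
      have : (Finset.range N).filter (fun j => i ≤ j + T ∧ j ≤ i + T) ⊆
          Finset.Icc (i - T) (i + T) := fun j hj => by
        rw [Finset.mem_filter] at hj
        rw [Finset.mem_Icc]
        omega
      have h2 := Finset.card_le_card this
      rw [Nat.card_Icc] at h2
      have h3 : ((Finset.range N).filter fun j => i ≤ j + T ∧ j ≤ i + T).card ≤ 2 * T + 1 := by
        omega
      exact_mod_cast h3
    refine (Finset.sum_le_sum h1).trans ?_
    rw [Finset.sum_const, Finset.card_range, nsmul_eq_mul, mul_assoc]
  have hgap : 0 < Q - μ := sub_pos.2 hQ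
  have hch := ProbabilityTheory.meas_ge_le_variance_div_sq hS2 hgap
  have hsub : {ξ : Fin k → ℝ | Q < ∑ i ∈ Finset.range N, w i * (∑ l, a i l * ξ l) ^ 2} ⊆
      {ξ | Q - μ ≤ |∑ i ∈ Finset.range N, Y i ξ -
        ∫ ξ, (∑ i ∈ Finset.range N, Y i ξ) ∂(prior k q)|} := fun ξ hξ => by
    rw [Set.mem_ofPred_eq] at hξ ⊢
    refine le_trans ?_ (le_abs_self _)
    simp only [hY] at hmean ⊢
    linarith
  have h1 := ENNReal.toReal_mono ENNReal.ofReal_ne_top ((measure_mono hsub).trans hch)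
  rw [ENNReal.toReal_ofReal (div_nonneg (ProbabilityTheory.variance_nonneg _ _) (sq_nonneg _))]
    at h1
  exact h1.trans (div_le_div_of_nonneg_right hvar (sq_nonneg _))

end IsPrior

/-! ### Most of the prior mass lies in the family -/

/-- The weights of the Sobolev ellipsoid. -/
def sobolevWeight (α : ℝ) (j : ℕ) : ℝ := 1 + (Real.pi * j) ^ (2 * α)

theorem sobolevWeight_nonneg (α : ℝ) (j : ℕ) : 0 ≤ sobolevWeight α j := by
  unfold sobolevWeight
  positivity

theorem sobolevWeight_mono {α : ℝ} (hα : 0 ≤ α) {i j : ℕ} (hij : i ≤ j) :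
    sobolevWeight α i ≤ sobolevWeight α j := by
  unfold sobolevWeight
  gcongr

theorem abs_cosBasis_sub_le (j : ℕ) (x y : ℝ) :
    |cosBasis j x - cosBasis j y| ≤ √2 * (Real.pi * j * |x - y|) := by
  have h1 : |Real.cos (Real.pi * j * x) - Real.cos (Real.pi * j * y)| ≤ Real.pi * j * |x - y| := by
    have h := Real.abs_cos_sub_cos_le (Real.pi * j * x) (Real.pi * j * y)
    rwa [← mul_sub, abs_mul, abs_of_nonneg (show 0 ≤ Real.pi * j by positivity)] at h
  have h2 : cosNorm j ≤ √2 := by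
    unfold cosNorm
    split_ifs
    · exact Real.one_le_sqrt.2 (by norm_num)
    · exact le_rfl
  rw [cosBasis_eq, cosBasis_eq, ← mul_sub, abs_mul, abs_of_pos (cosNorm_pos j)]
  exact mul_le_mul h2 h1 (abs_nonneg _) (by positivity)

section Mass

variable {h : ℝ → ℝ} {K k L : ℕ} {d : ℤ → ℝ} {r : ℕ → ℝ} {b : ℝ}

@[fun_prop]
theorem measurable_curveCoeff (r : ℕ → ℝ) (d : ℤ → ℝ) (i : ℕ) :
    Measurable fun ξ : Fin k → ℝ => curveCoeff r d ξ i := by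
  unfold curveCoeff
  fun_prop

/-- The sum of the absolute values of the coefficients of a multiplier. -/
def absSum (K : ℕ) (d : ℤ → ℝ) : ℝ := ∑ a ∈ Finset.range (2 * K + 1), |d a|

theorem absSum_nonneg (K : ℕ) (d : ℤ → ℝ) : 0 ≤ absSum K d :=
  Finset.sum_nonneg fun _ _ => abs_nonneg _

theorem IsMultiplier.sqDist_curve_le (hd : IsMultiplier h K d) (hL : 1 ≤ L) (hb : 0 ≤ b)
    (hr : ∀ l < k, |r l| ≤ b) (S : ℝ → ℝ) {ξ : Fin k → ℝ} (hξ : ξ ∈ paramBox k) :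
    sqDist (curve S (fun l : Fin k => direction h r L K l) ξ) S ≤
      ENNReal.ofReal (((k + 2 * K : ℕ) : ℝ) * (b * absSum K d) ^ 2) := by
  have e1 : ∀ x, (curve S (fun l : Fin k => direction h r L K l) ξ x - S x) ^ 2 =
      (∑ j ∈ Finset.Ico L (L + (k + 2 * K)), curveCoeff r d ξ (j - L) * cosBasis j x) ^ 2 := by
    intro x
    rw [curve, add_sub_cancel_left, hd.sum_direction hL, sum_range_cosBasis_shift]
  unfold sqDist
  simp_rw [e1]
  rw [← ofReal_integral_eq_lintegral_ofReal ?_ (ae_of_all _ fun x => sq_nonneg _),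
    setIntegral_Icc_eq, integral_sq_sum_cosBasis, Finset.sum_Ico_eq_sum_range,
    Nat.add_sub_cancel_left]
  · refine ENNReal.ofReal_le_ofReal ?_
    refine (Finset.sum_le_card_nsmul _ _ ((b * absSum K d) ^ 2) fun i _ => ?_).trans_eq ?_
    · rw [← sq_abs]
      exact pow_le_pow_left₀ (abs_nonneg _) (hd.abs_curveCoeff_le hb hr hξ _) 2
    · rw [Finset.card_range, nsmul_eq_mul]
  · exact Continuous.integrableOn_Icc (by fun_prop)

theorem abs_direction_le {Hb : ℝ} (hH : ∀ x, |h x| ≤ Hb) {l : ℕ} (hr : |r l| ≤ b) (x : ℝ) :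
    |direction h r L K l x| ≤ b * (Hb * √2) := by
  unfold direction
  rw [abs_mul, abs_mul]
  have := (abs_nonneg _).trans (hH x)
  have := (abs_nonneg _).trans hr
  have := abs_cosBasis_le (L + l + K) x
  have := hH x
  gcongr

theorem abs_sum_direction_le {Hb : ℝ} (hH : ∀ x, |h x| ≤ Hb)
    (hr : ∀ l < k, |r l| ≤ b) {ξ : Fin k → ℝ} (hξ : ξ ∈ paramBox k) (x : ℝ) :
    |∑ l : Fin k, ξ l * direction h r L K l x| ≤ k * (b * (Hb * √2)) := by
  refine (Finset.abs_sum_le_sum_abs _ _).trans ?_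
  refine (Finset.sum_le_card_nsmul _ _ (b * (Hb * √2)) fun l _ => ?_).trans_eq ?_
  · rw [abs_mul]
    exact (mul_le_of_le_one_left (abs_nonneg _) (abs_le.2 (hξ l))).trans
      (abs_direction_le hH (hr l l.2) x)
  · rw [Finset.card_univ, Fintype.card_fin, nsmul_eq_mul]

theorem IsMultiplier.abs_sum_direction_sub_le (hd : IsMultiplier h K d) (hL : 1 ≤ L) (hb : 0 ≤ b)
    (hr : ∀ l < k, |r l| ≤ b) {ξ : Fin k → ℝ} (hξ : ξ ∈ paramBox k) (x y : ℝ) :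
    |∑ l : Fin k, ξ l * direction h r L K l x - ∑ l : Fin k, ξ l * direction h r L K l y| ≤
      ((k + 2 * K : ℕ) : ℝ) * ((b * absSum K d) *
        (√2 * (Real.pi * (L + (k + 2 * K) : ℕ) * |x - y|))) := by
  rw [hd.sum_direction hL, hd.sum_direction hL, ← Finset.sum_sub_distrib]
  refine (Finset.abs_sum_le_sum_abs _ _).trans ?_
  refine (Finset.sum_le_card_nsmul _ _ _ fun i hi => ?_).trans_eq
    (by rw [Finset.card_range, nsmul_eq_mul])
  rw [← mul_sub, abs_mul]
  refine mul_le_mul (hd.abs_curveCoeff_le hb hr hξ i)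
    ((abs_cosBasis_sub_le _ _ _).trans ?_) (abs_nonneg _) (mul_nonneg hb (absSum_nonneg _ _))
  have : L + i ≤ L + (k + 2 * K) := by
    rw [Finset.mem_range] at hi
    omega
  gcongr

theorem exists_grid_near {n : ℕ} (hn : 1 ≤ n) {x : ℝ} (hx : x ∈ Icc (0 : ℝ) 1) :
    ∃ i ∈ Finset.range (n + 1), |x - (i : ℝ) / n| ≤ (n : ℝ)⁻¹ := by
  have hn0 : (0 : ℝ) < n := by exact_mod_cast hn
  have h1 := Nat.floor_le (mul_nonneg hn0.le hx.1)
  have h2 := Nat.lt_floor_add_one ((n : ℝ) * x)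
  refine ⟨⌊(n : ℝ) * x⌋₊, ?_, ?_⟩
  · rw [Finset.mem_range, Nat.lt_succ_iff]
    exact Nat.floor_le_of_le (mul_le_of_le_one_right hn0.le hx.2)
  · have e1 : x - (⌊(n : ℝ) * x⌋₊ : ℝ) / n = (n * x - ⌊(n : ℝ) * x⌋₊) * (n : ℝ)⁻¹ := by
      field_simp
    rw [e1, abs_mul, abs_of_nonneg (sub_nonneg.2 h1), abs_of_nonneg (by positivity)]
    exact mul_le_of_le_one_left (by positivity) (by linarith)

/-- The l-th direction spreads over the frequencies l, …, l + 2K with squared coefficients of total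
mass ∫h². Monotonicity moves all this mass to the highest frequency. -/
theorem IsMultiplier.sum_weight_mul_sq_le (hd : IsMultiplier h K d) {w : ℕ → ℝ}
    (hw : Monotone w) :
    ∑ i ∈ Finset.range (k + 2 * K), w i * ∑ l : Fin k, (r l * d ((i : ℤ) - (l : ℕ))) ^ 2 ≤
      (∫ x in (0 : ℝ)..1, h x ^ 2) * ∑ l ∈ Finset.range k, r l ^ 2 * w (l + 2 * K) := by
  simp_rw [Finset.mul_sum]
  rw [Finset.sum_comm, ← Fin.sum_univ_eq_sum_range
    (fun l => (∫ x in (0 : ℝ)..1, h x ^ 2) * (r l ^ 2 * w (l + 2 * K)))]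
  refine Finset.sum_le_sum fun l _ => ?_
  have h1 := hd.sum_shift l.2 w (fun t => t ^ 2) (by simp)
  have e1 : ∀ i ∈ Finset.range (k + 2 * K), w i * (r l * d ((i : ℤ) - (l : ℕ))) ^ 2 =
      r l ^ 2 * (d ((i : ℤ) - (l : ℕ)) ^ 2 * w i) := fun i _ => by ring
  rw [Finset.sum_congr rfl e1, ← Finset.mul_sum, h1, ← hd.sum_sq]
  have h2 : ∑ i ∈ Finset.range (2 * K + 1), d i ^ 2 * w (l + i) ≤
      ∑ i ∈ Finset.range (2 * K + 1), d i ^ 2 * w (l + 2 * K) := by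
    refine Finset.sum_le_sum fun i hi => mul_le_mul_of_nonneg_left (hw ?_) (sq_nonneg _)
    rw [Finset.mem_range] at hi
    omega
  rw [← Finset.sum_mul] at h2
  calc _ ≤ r l ^ 2 * ((∑ i ∈ Finset.range (2 * K + 1), d i ^ 2) * w (l + 2 * K)) :=
        mul_le_mul_of_nonneg_left h2 (sq_nonneg _)
    _ = _ := by ring

/-- A curve can leave the family only through its energy or its supremum. The energy has mean at
most μ < Q and is treated by Chebyshev. For the supremum, the values at the n + 1 grid points stay
below t/2 by Hoeffding, and the Lipschitz bound adds at most t/2 between grid points. -/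
theorem IsMultiplier.exists_mem_family (hd : IsMultiplier h K d) {q τ : ℝ → ℝ} {V J : ℝ}
    (hq : IsPrior q τ V J) (hL : 1 ≤ L) {M : ℕ} (hM : M ≤ L) (hb : 0 ≤ b)
    (hr : ∀ l < k, |r l| ≤ b) {Hb : ℝ} (hH : ∀ x, |h x| ≤ Hb) (f₀ : ℝ → ℝ) {ρ : ℝ≥0∞}
    {α Q μ t : ℝ} (hα : 0 ≤ α)
    (hμ : V * ((∫ x in (0 : ℝ)..1, h x ^ 2) *
      ∑ l ∈ Finset.range k, r l ^ 2 * sobolevWeight α (L + (l + 2 * K))) ≤ μ) (hQ : μ < Q)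
    {n : ℕ} (hn : 1 ≤ n) (ht : 0 ≤ t)
    (hLip : ((k + 2 * K : ℕ) : ℝ) * ((b * absSum K d) *
        (√2 * (Real.pi * (L + (k + 2 * K) : ℕ) * (n : ℝ)⁻¹))) ≤ t / 2)
    (hρ : ENNReal.ofReal t < ρ) :
    ∃ G : Set (Fin k → ℝ), MeasurableSet G ∧
      (∀ ξ ∈ paramBox k, ξ ∈ G →
        curve (lowFreq f₀ M) (fun l : Fin k => direction h r L K l) ξ ∈ family f₀ ρ M α Q) ∧
      (prior k q).real Gᶜ ≤
        ((k + 2 * K : ℕ) : ℝ) * (2 * (2 * K : ℕ) + 1) *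
          (sobolevWeight α (L + (k + 2 * K)) * (b * absSum K d) ^ 2) ^ 2 / (Q - μ) ^ 2 +
        (n + 1) * (2 * Real.exp (-(t / 2) ^ 2 / (2 * (k * (b * (Hb * √2)) ^ 2)))) := by
  have := hq.isProbabilityMeasure_prior (k := k)
  set E : (Fin k → ℝ) → ℝ → ℝ := fun ξ x => ∑ l : Fin k, ξ l * direction h r L K l x with hE
  have hEm : ∀ x, Measurable fun ξ => E ξ x := fun x => by
    simp only [hE]
    fun_prop
  set A : Set (Fin k → ℝ) := {ξ | Q < ∑ i ∈ Finset.range (k + 2 * K),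
    sobolevWeight α (L + i) * curveCoeff r d ξ i ^ 2} with hA
  set B : ℕ → Set (Fin k → ℝ) := fun g => {ξ | t / 2 ≤ |E ξ ((g : ℝ) / n)|} with hB
  refine ⟨(A ∪ ⋃ g ∈ Finset.range (n + 1), B g)ᶜ, ?_, fun ξ hξ hG => ?_, ?_⟩
  · refine (MeasurableSet.union (measurableSet_lt (by fun_prop) (by fun_prop)) ?_).compl
    exact Finset.measurableSet_biUnion _ fun g _ =>
      measurableSet_le measurable_const (hEm _).abs
  · rw [Set.mem_compl_iff, Set.mem_union, not_or] at hG
    have hG1 : ∑ i ∈ Finset.range (k + 2 * K),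
        sobolevWeight α (L + i) * curveCoeff r d ξ i ^ 2 ≤ Q := by
      simpa [hA] using hG.1
    have hG2 : ∀ g ∈ Finset.range (n + 1), |E ξ ((g : ℝ) / n)| < t / 2 := by
      intro g hg
      have h1 := hG.2
      simp only [Set.mem_iUnion, not_exists] at h1
      simpa [hB] using h1 g hg
    have e1 : ∀ x, E ξ x = ∑ j ∈ Finset.Ico L (L + (k + 2 * K)),
        curveCoeff r d ξ (j - L) * cosBasis j x := fun x => by
      simp only [hE]
      rw [hd.sum_direction hL, sum_range_cosBasis_shift]
    refine mem_family (s := Finset.Ico L (L + (k + 2 * K)))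
      (b := fun j => curveCoeff r d ξ (j - L)) (t := t) ?_ ?_ ?_ ?_ hρ
    · ext x
      rw [curve, ← e1]
    · intro i hi
      exact hM.trans (Finset.mem_Ico.1 hi).1
    · rw [Finset.sum_Ico_eq_sum_range, Nat.add_sub_cancel_left]
      refine le_trans (le_of_eq (Finset.sum_congr rfl fun i _ => ?_)) hG1
      rw [Nat.add_sub_cancel_left, sobolevWeight]
    · intro x hx
      rw [← e1]
      obtain ⟨g, hg, hxg⟩ := exists_grid_near hn hx
      have h1 := hd.abs_sum_direction_sub_le hL hb hr hξ x ((g : ℝ) / n)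
      have h2 : ((k + 2 * K : ℕ) : ℝ) * ((b * absSum K d) *
          (√2 * (Real.pi * (L + (k + 2 * K) : ℕ) * |x - (g : ℝ) / n|))) ≤ t / 2 := by
        refine le_trans ?_ hLip
        have := absSum_nonneg K d
        gcongr
      have h3 : |E ξ x - E ξ ((g : ℝ) / n)| ≤ t / 2 := h1.trans h2
      have h4 := hG2 g hg
      have h5 := abs_sub_abs_le_abs_sub (E ξ x) (E ξ ((g : ℝ) / n))
      linarith
  · rw [compl_compl]
    refine (measureReal_union_le _ _).trans (add_le_add ?_ ?_)
    · have h1 := hq.prior_quadratic_gt_le (k := k) (fun i l => r l * d ((i : ℤ) - (l : ℕ)))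
        (N := k + 2 * K) (T := 2 * K) (w := fun i => sobolevWeight α (L + i))
        (c := sobolevWeight α (L + (k + 2 * K)) * (b * absSum K d) ^ 2) (μ := μ) (Q := Q)
        (fun i _ => sobolevWeight_nonneg _ _) (fun i l hl => ?_) (fun i hi ξ hξ => ?_) ?_ hQ
      · exact h1
      · by_contra hcon
        refine hl ?_
        rw [hd.support _ (by omega), mul_zero]
      · refine mul_le_mul (sobolevWeight_mono hα (by omega)) ?_ (sq_nonneg _)
          (sobolevWeight_nonneg _ _)
        rw [← sq_abs]
        exact pow_le_pow_left₀ (abs_nonneg _) (hd.abs_curveCoeff_le hb hr hξ _) 2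
      · refine le_trans (mul_le_mul_of_nonneg_left ?_ hq.var_pos.le) hμ
        exact hd.sum_weight_mul_sq_le (w := fun i => sobolevWeight α (L + i))
          fun i j hij => sobolevWeight_mono hα (by omega)
    · refine (measureReal_biUnion_finset_le _ _).trans ?_
      refine (Finset.sum_le_card_nsmul _ _ _ fun g _ => ?_).trans_eq
        (by rw [Finset.card_range, nsmul_eq_mul]; push_cast; rfl)
      have h1 := hq.prior_abs_ge_le (k := k) (fun l => direction h r L K l ((g : ℝ) / n))
        (c := b * (Hb * √2)) (t := t / 2) (fun l => abs_direction_le hH (hr l l.2) _)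
        (by linarith)
      simp only [hB, hE]
      simp_rw [mul_comm (_ : ℝ) (direction h r L K _ _)]
      exact h1

end Mass

/-! ### A bound for the information quadratic form -/

section QuadraticForm

variable {h : ℝ → ℝ} {Hb : ℝ} {k : ℕ}

theorem integral_sq_mul_sum_sq_le (hh : Continuous h) (hH : ∀ x, |h x| ≤ Hb) (κ : Fin k → ℝ)
    {N : Fin k → ℕ} (hN : Function.Injective N) (y : ℝ) :
    ∫ x in (0 : ℝ)..1, h x ^ 2 * (∑ i, κ i * cosBasis (N i) y * cosBasis (N i) x) ^ 2 ≤
      2 * Hb ^ 2 * ∑ i, κ i ^ 2 := by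
  have h1 : ∫ x in (0 : ℝ)..1, (∑ i, κ i * cosBasis (N i) y * cosBasis (N i) x) ^ 2 =
      ∑ i, (κ i * cosBasis (N i) y) ^ 2 := by
    simp_rw [sq, Finset.mul_sum]
    rw [intervalIntegral.integral_finsetSum fun i _ =>
      Continuous.intervalIntegrable (by fun_prop) _ _]
    refine Finset.sum_congr rfl fun i _ => ?_
    simp_rw [Finset.sum_mul]
    rw [intervalIntegral.integral_finsetSum fun i _ =>
      Continuous.intervalIntegrable (by fun_prop) _ _]
    have e1 : ∀ j x, κ j * cosBasis (N j) y * cosBasis (N j) x *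
        (κ i * cosBasis (N i) y * cosBasis (N i) x) = κ j * cosBasis (N j) y *
        (κ i * cosBasis (N i) y) * (cosBasis (N j) x * cosBasis (N i) x) := fun j x => by ring
    simp_rw [e1, intervalIntegral.integral_const_mul, integral_cosBasis_mul, hN.eq_iff]
    simp
  calc _ ≤ ∫ x in (0 : ℝ)..1,
        Hb ^ 2 * (∑ i, κ i * cosBasis (N i) y * cosBasis (N i) x) ^ 2 := by
        refine intervalIntegral.integral_mono_on zero_le_one
          (Continuous.intervalIntegrable (by fun_prop) _ _)
          (Continuous.intervalIntegrable (by fun_prop) _ _) fun x _ => ?_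
        refine mul_le_mul_of_nonneg_right ?_ (sq_nonneg _)
        rw [← sq_abs]
        exact pow_le_pow_left₀ (abs_nonneg _) (hH x) 2
    _ = Hb ^ 2 * ∑ i, (κ i * cosBasis (N i) y) ^ 2 := by
        rw [intervalIntegral.integral_const_mul, h1]
    _ ≤ Hb ^ 2 * ∑ i, 2 * κ i ^ 2 := by
        refine mul_le_mul_of_nonneg_left (Finset.sum_le_sum fun i _ => ?_) (sq_nonneg _)
        rw [mul_pow, mul_comm]
        exact mul_le_mul_of_nonneg_right (cosBasis_sq_le _ _) (sq_nonneg _)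
    _ = 2 * Hb ^ 2 * ∑ i, κ i ^ 2 := by
        rw [← Finset.mul_sum]
        ring

/-- The double sum is the integral over y of v(y) times the squared norm of x ↦ h(x) Σ κ_i φ_i(y)
φ_i(x). By orthonormality and φ_i(y)² ≤ 2, that norm is at most 2Hb² Σ κ_i² for every y. Thus v
enters only through its L¹ norm, and the number of directions does not matter. -/
theorem sum_mul_integral_le (hh : Continuous h) (hH : ∀ x, |h x| ≤ Hb) (κ : Fin k → ℝ)
    {N : Fin k → ℕ} (hN : Function.Injective N) {v : ℝ → ℝ}
    (hv : IntegrableOn v (Icc (0 : ℝ) 1)) :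
    ∑ i, ∑ j, κ i * κ j * (∫ x in (0 : ℝ)..1, h x ^ 2 * (cosBasis (N i) x * cosBasis (N j) x)) *
      (∫ x in Icc (0 : ℝ) 1, v x * (cosBasis (N i) x * cosBasis (N j) x)) ≤
      2 * Hb ^ 2 * (∫ x in Icc (0 : ℝ) 1, |v x|) * ∑ i, κ i ^ 2 := by
  have hvi : ∀ i j, IntegrableOn (fun x => v x * (cosBasis (N i) x * cosBasis (N j) x))
      (Icc (0 : ℝ) 1) := fun i j => by
    refine Integrable.mul_bdd (c := √2 * √2) hv (Continuous.aestronglyMeasurable (by fun_prop))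
      (ae_of_all _ fun x => ?_)
    rw [Real.norm_eq_abs, abs_mul]
    exact mul_le_mul (abs_cosBasis_le _ _) (abs_cosBasis_le _ _) (abs_nonneg _) (by positivity)
  have e1 : ∀ y, ∫ x in (0 : ℝ)..1, h x ^ 2 *
      (∑ i, κ i * cosBasis (N i) y * cosBasis (N i) x) ^ 2 = ∑ i, ∑ j, κ i * κ j *
      (∫ x in (0 : ℝ)..1, h x ^ 2 * (cosBasis (N i) x * cosBasis (N j) x)) *
        (cosBasis (N i) y * cosBasis (N j) y) := by
    intro y
    have e2 : ∀ x, h x ^ 2 * (∑ i, κ i * cosBasis (N i) y * cosBasis (N i) x) ^ 2 =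
        ∑ i, ∑ j, κ i * κ j * (cosBasis (N i) y * cosBasis (N j) y) *
          (h x ^ 2 * (cosBasis (N i) x * cosBasis (N j) x)) := by
      intro x
      rw [sq (∑ i, _), Finset.sum_mul_sum, Finset.mul_sum]
      refine Finset.sum_congr rfl fun i _ => ?_
      rw [Finset.mul_sum]
      exact Finset.sum_congr rfl fun j _ => by ring
    simp_rw [e2]
    rw [intervalIntegral.integral_finsetSum fun i _ =>
      Continuous.intervalIntegrable (by fun_prop) _ _]
    refine Finset.sum_congr rfl fun i _ => ?_
    rw [intervalIntegral.integral_finsetSum fun j _ =>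
      Continuous.intervalIntegrable (by fun_prop) _ _]
    refine Finset.sum_congr rfl fun j _ => ?_
    rw [intervalIntegral.integral_const_mul]
    ring
  have e4 : ∀ y, v y * (∫ x in (0 : ℝ)..1, h x ^ 2 *
      (∑ i, κ i * cosBasis (N i) y * cosBasis (N i) x) ^ 2) = ∑ i, ∑ j, κ i * κ j *
      (∫ x in (0 : ℝ)..1, h x ^ 2 * (cosBasis (N i) x * cosBasis (N j) x)) *
      (v y * (cosBasis (N i) y * cosBasis (N j) y)) := by
    intro y
    rw [e1, Finset.mul_sum]
    refine Finset.sum_congr rfl fun i _ => ?_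
    rw [Finset.mul_sum]
    exact Finset.sum_congr rfl fun j _ => by ring
  have hint : IntegrableOn (fun y => v y * ∫ x in (0 : ℝ)..1, h x ^ 2 *
      (∑ i, κ i * cosBasis (N i) y * cosBasis (N i) x) ^ 2) (Icc (0 : ℝ) 1) := by
    simp_rw [e4]
    exact integrable_finsetSum _ fun i _ =>
      integrable_finsetSum _ fun j _ => Integrable.const_mul (hvi i j) _
  have e3 : ∑ i, ∑ j, κ i * κ j *
      (∫ x in (0 : ℝ)..1, h x ^ 2 * (cosBasis (N i) x * cosBasis (N j) x)) *
      (∫ x in Icc (0 : ℝ) 1, v x * (cosBasis (N i) x * cosBasis (N j) x)) =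
      ∫ y in Icc (0 : ℝ) 1, v y * ∫ x in (0 : ℝ)..1, h x ^ 2 *
        (∑ i, κ i * cosBasis (N i) y * cosBasis (N i) x) ^ 2 := by
    simp_rw [e4]
    rw [integral_finsetSum _ fun i _ =>
      integrable_finsetSum _ fun j _ => Integrable.const_mul (hvi i j) _]
    refine Finset.sum_congr rfl fun i _ => ?_
    rw [integral_finsetSum _ fun j _ => Integrable.const_mul (hvi i j) _]
    exact Finset.sum_congr rfl fun j _ => by rw [integral_const_mul]
  rw [e3, mul_right_comm, ← integral_const_mul]
  have h0 : ∀ y, 0 ≤ ∫ x in (0 : ℝ)..1, h x ^ 2 *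
      (∑ i, κ i * cosBasis (N i) y * cosBasis (N i) x) ^ 2 := fun y =>
    intervalIntegral.integral_nonneg zero_le_one fun x _ => by positivity
  refine integral_mono hint (hv.abs.const_mul _) fun y => ?_
  refine (mul_le_mul_of_nonneg_right (le_abs_self (v y)) (h0 y)).trans ?_
  rw [mul_comm]
  exact mul_le_mul_of_nonneg_right (integral_sq_mul_sum_sq_le hh hH κ hN y) (abs_nonneg _)

/-- Write 𝓘h² = 1 + v. The constant 1 contributes only on the diagonal, where the Gram entry is ∫h²
up to the scaling; v is the perturbation bounded in L¹. The weights κ_i / r_i² cancel the scale r_i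
in both matrices. -/
theorem IsMultiplier.sum_information_le {K L : ℕ} {d : ℤ → ℝ} (hd : IsMultiplier h K d)
    (hL : 1 ≤ L) (hh : Continuous h) (hH : ∀ x, |h x| ≤ Hb) (κ : Fin k → ℝ) {r : ℕ → ℝ}
    (hr : ∀ l < k, r l ≠ 0) {I : ℝ → ℝ} (hI : IntegrableOn I (Icc (0 : ℝ) 1)) :
    ∑ i : Fin k, ∑ j : Fin k, κ i / r i ^ 2 * (κ j / r j ^ 2) *
      unitInner (direction h r L K i) (direction h r L K j) *
      (∫ x in (0 : ℝ)..1, I x * (direction h r L K i x * direction h r L K j x)) ≤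
    ((∫ x in (0 : ℝ)..1, h x ^ 2) + 2 * Hb ^ 2 * ∫ x in Icc (0 : ℝ) 1, |I x * h x ^ 2 - 1|) *
      ∑ i, κ i ^ 2 := by
  set N : Fin k → ℕ := fun i => L + i + K with hN
  have hNi : Function.Injective N := fun i j hij => by
    simp only [hN] at hij
    exact Fin.ext (by omega)
  have hIh : IntegrableOn (fun x => I x * h x ^ 2) (Icc (0 : ℝ) 1) := by
    refine Integrable.mul_bdd (c := Hb ^ 2) hI (Continuous.aestronglyMeasurable (by fun_prop))
      (ae_of_all _ fun x => ?_)
    rw [Real.norm_eq_abs, abs_pow]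
    exact pow_le_pow_left₀ (abs_nonneg _) (hH x) 2
  have hv : IntegrableOn (fun x => I x * h x ^ 2 - 1) (Icc (0 : ℝ) 1) :=
    integrable_fun_sub hIh (integrable_const _)
  have hφ : ∀ i j, IntegrableOn (fun x => (I x * h x ^ 2 - 1) *
      (cosBasis (N i) x * cosBasis (N j) x)) (Icc (0 : ℝ) 1) := fun i j => by
    refine Integrable.mul_bdd (c := √2 * √2) hv (Continuous.aestronglyMeasurable (by fun_prop))
      (ae_of_all _ fun x => ?_)
    rw [Real.norm_eq_abs, abs_mul]
    exact mul_le_mul (abs_cosBasis_le _ _) (abs_cosBasis_le _ _) (abs_nonneg _) (by positivity)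
  have hterm : ∀ i j : Fin k, κ i / r i ^ 2 * (κ j / r j ^ 2) *
      unitInner (direction h r L K i) (direction h r L K j) *
      (∫ x in (0 : ℝ)..1, I x * (direction h r L K i x * direction h r L K j x)) =
      κ i * κ j * (∫ x in (0 : ℝ)..1, h x ^ 2 * (cosBasis (N i) x * cosBasis (N j) x)) *
        (∫ x in Icc (0 : ℝ) 1, (I x * h x ^ 2 - 1) * (cosBasis (N i) x * cosBasis (N j) x)) +
      (if i = j then κ i ^ 2 * ∫ x in (0 : ℝ)..1, h x ^ 2 else 0) := by
    intro i j
    have e1 : unitInner (direction h r L K i) (direction h r L K j) =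
        r i * r j * ∫ x in (0 : ℝ)..1, h x ^ 2 * (cosBasis (N i) x * cosBasis (N j) x) := by
      unfold unitInner direction
      rw [setIntegral_Icc_eq, ← intervalIntegral.integral_const_mul]
      refine intervalIntegral.integral_congr fun x _ => ?_
      simp only [hN]
      ring
    have e2 : ∫ x in (0 : ℝ)..1, I x * (direction h r L K i x * direction h r L K j x) =
        r i * r j * ((∫ x in Icc (0 : ℝ) 1, (I x * h x ^ 2 - 1) *
          (cosBasis (N i) x * cosBasis (N j) x)) + if i = j then 1 else 0) := by
      have e3 : (if i = j then (1 : ℝ) else 0) =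
          ∫ x in Icc (0 : ℝ) 1, cosBasis (N i) x * cosBasis (N j) x := by
        rw [setIntegral_Icc_eq, integral_cosBasis_mul]
        simp only [hNi.eq_iff]
      rw [e3, ← integral_add (hφ i j) (Continuous.integrableOn_Icc (by fun_prop)),
        ← integral_const_mul, ← setIntegral_Icc_eq]
      refine integral_congr_ae (ae_of_all _ fun x => ?_)
      simp only [direction, hN]
      ring
    rw [e1, e2]
    have hi := hr i i.2
    have hj := hr j j.2
    have e4 : (if i = j then κ i ^ 2 * ∫ x in (0 : ℝ)..1, h x ^ 2 else 0) =
        κ i * κ j * (∫ x in (0 : ℝ)..1, h x ^ 2 * (cosBasis (N i) x * cosBasis (N j) x)) *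
          if i = j then 1 else 0 := by
      split_ifs with hij
      · subst hij
        have := hd.integral_sq (L + i) (by omega)
        rw [← this, mul_one, ← sq]
        congr 1
        refine intervalIntegral.integral_congr fun x _ => ?_
        simp only [hN]
        ring
      · rw [mul_zero]
    rw [e4]
    field_simp
  simp_rw [hterm, Finset.sum_add_distrib]
  have h1 := sum_mul_integral_le hh hH κ hNi hv
  simp only [Finset.sum_ite_eq, Finset.mem_univ, if_true, ← Finset.sum_mul]
  linarith

end QuadraticForm

/-! ### The information of a design with bounded density -/

section Info

variable {D : ℕ} {m : Model} {p : ℝ × (Fin D → ℝ) → ℝ} {g : (Fin D → ℝ) → ℝ} {f f' : ℝ → ℝ}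
  {Pb C : ℝ}

instance isProbabilityMeasure_restrict_Icc_pi :
    IsProbabilityMeasure ((volume : Measure (Fin D → ℝ)).restrict (Icc 0 1)) :=
  ⟨by simp [Real.volume_Icc_pi]⟩

theorem Model.measurable_info (hp : Measurable p) (hg : Measurable g) (hf : Measurable f) :
    Measurable (m.info p g f) := by
  have hv := m.measurable_variance
  unfold Model.info
  refine (StronglyMeasurable.integral_prod_right (ν := (volume : Measure (Fin D → ℝ)).restrict
    (Icc 0 1)) (f := fun x z => p (x, z) * (m.variance (f x + g z))⁻¹) ?_).measurable
  refine Measurable.stronglyMeasurable ?_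
  exact (hp.comp (measurable_fst.prodMk measurable_snd)).mul
    (hv.comp ((hf.comp measurable_fst).add (hg.comp measurable_snd))).inv

theorem Model.integrable_info_integrand (hp : Measurable p) (hg : Measurable g) {x : ℝ}
    (hpb : ∀ z ∈ Icc (0 : Fin D → ℝ) 1, |p (x, z)| ≤ Pb)
    (hC : ∀ z ∈ Icc (0 : Fin D → ℝ) 1, |(m.variance (f x + g z))⁻¹| ≤ C) :
    IntegrableOn (fun z => p (x, z) * (m.variance (f x + g z))⁻¹) (Icc 0 1) := by
  have hv := m.measurable_variance
  refine Integrable.of_bound (((hp.comp measurable_prodMk_left).mul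
    (hv.comp (measurable_const.add hg)).inv).aestronglyMeasurable) (Pb * C)
    ((ae_restrict_iff' measurableSet_Icc).2 (ae_of_all _ fun z hz => ?_))
  rw [Real.norm_eq_abs, abs_mul]
  exact mul_le_mul (hpb z hz) (hC z hz) (abs_nonneg _) ((abs_nonneg _).trans (hpb z hz))

theorem Model.abs_info_le {x : ℝ} (hpb : ∀ z ∈ Icc (0 : Fin D → ℝ) 1, |p (x, z)| ≤ Pb)
    (hC : ∀ z ∈ Icc (0 : Fin D → ℝ) 1, |(m.variance (f x + g z))⁻¹| ≤ C) :
    |m.info p g f x| ≤ Pb * C := by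
  have h := norm_setIntegral_le_of_norm_le_const (μ := volume) (s := Icc (0 : Fin D → ℝ) 1)
    (f := fun z => p (x, z) * (m.variance (f x + g z))⁻¹) (C := Pb * C)
    isCompact_Icc.measure_lt_top fun z hz => by
      rw [Real.norm_eq_abs, abs_mul]
      exact mul_le_mul (hpb z hz) (hC z hz) (abs_nonneg _) ((abs_nonneg _).trans (hpb z hz))
  simpa [Model.info, Measure.real, Real.volume_Icc_pi] using h

theorem Model.abs_info_sub_le (hp : Measurable p) (hg : Measurable g) {x Λ : ℝ}
    (hpb : ∀ z ∈ Icc (0 : Fin D → ℝ) 1, |p (x, z)| ≤ Pb)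
    (hC : ∀ z ∈ Icc (0 : Fin D → ℝ) 1, |(m.variance (f x + g z))⁻¹| ≤ C)
    (hC' : ∀ z ∈ Icc (0 : Fin D → ℝ) 1, |(m.variance (f' x + g z))⁻¹| ≤ C)
    (hΛ : ∀ z ∈ Icc (0 : Fin D → ℝ) 1,
      |(m.variance (f x + g z))⁻¹ - (m.variance (f' x + g z))⁻¹| ≤ Λ) :
    |m.info p g f x - m.info p g f' x| ≤ Pb * Λ := by
  unfold Model.info
  rw [← integral_sub (Model.integrable_info_integrand hp hg hpb hC)
    (Model.integrable_info_integrand hp hg hpb hC')]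
  have h := norm_setIntegral_le_of_norm_le_const (μ := volume) (s := Icc (0 : Fin D → ℝ) 1)
    (f := fun z => p (x, z) * (m.variance (f x + g z))⁻¹ - p (x, z) * (m.variance (f' x + g z))⁻¹)
    (C := Pb * Λ) isCompact_Icc.measure_lt_top fun z hz => by
      rw [Real.norm_eq_abs, ← mul_sub, abs_mul]
      exact mul_le_mul (hpb z hz) (hΛ z hz) (abs_nonneg _) ((abs_nonneg _).trans (hpb z hz))
  simpa [Measure.real, Real.volume_Icc_pi] using h

end Info

/-! ### Approximate square roots of the reciprocal information -/

/-- The polynomial approximates 𝓘^{-1/2}. Its uniform bound Hb is fixed before the precision, so the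
precision may later be chosen small relative to powers of Hb. -/
theorem exists_cosPoly_sq_near_inv {I : ℝ → ℝ} (hI : Measurable I) {a A : ℝ} (ha : 0 < a)
    (hIb : ∀ x ∈ Icc (0 : ℝ) 1, a ≤ I x ∧ I x ≤ A) :
    ∃ Hb : ℝ, 0 < Hb ∧ ∀ ε : ℝ, 0 < ε → ∃ P : Polynomial ℝ, (∀ x, |cosPoly P x| ≤ Hb) ∧
      ∫ x in Icc (0 : ℝ) 1, |I x * cosPoly P x ^ 2 - 1| ≤ ε ∧
      (∫ x in (0 : ℝ)..1, 1 / I x) - ε ≤ ∫ x in (0 : ℝ)..1, cosPoly P x ^ 2 := by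
  set v : ℝ → ℝ := fun x => (√(I x))⁻¹ with hv
  have hvm : Measurable v := by
    simp only [hv]
    fun_prop
  have hv0 : ∀ x, 0 ≤ v x := fun x => by positivity
  have hA : 0 < A := ha.trans_le ((hIb 0 (by simp)).1.trans (hIb 0 (by simp)).2)
  have hvb : ∀ x ∈ Icc (0 : ℝ) 1, |v x| ≤ (√a)⁻¹ := fun x hx => by
    rw [abs_of_nonneg (hv0 x)]
    exact inv_anti₀ (Real.sqrt_pos.2 ha) (Real.sqrt_le_sqrt (hIb x hx).1)
  set Hb := (√a)⁻¹ + 1 with hHb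
  have hHb0 : 0 < Hb := by positivity
  refine ⟨Hb, hHb0, fun ε hε => ?_⟩
  -- Passing to squares costs a factor 2Hb and multiplying by 𝓘 a factor A; A + 1 covers both
  -- conclusions at once.
  obtain ⟨P, hPB, hP⟩ := exists_cosPoly_near hvm hvb (ε := ε / (2 * Hb * (A + 1)))
    (by positivity)
  have hdiff : IntegrableOn (fun x => |cosPoly P x - v x|) (Icc (0 : ℝ) 1) := by
    refine (integrable_fun_sub (Continuous.integrableOn_Icc (by fun_prop)) ?_).abs
    exact Integrable.of_bound hvm.aestronglyMeasurable _
      ((ae_restrict_iff' measurableSet_Icc).2 (ae_of_all _ hvb))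
  have hsq : ∀ x ∈ Icc (0 : ℝ) 1, |cosPoly P x ^ 2 - v x ^ 2| ≤ 2 * Hb * |cosPoly P x - v x| := by
    intro x hx
    rw [sq_sub_sq, abs_mul]
    refine mul_le_mul_of_nonneg_right ((abs_add_le _ _).trans ?_) (abs_nonneg _)
    linarith [hPB x, hvb x hx]
  have hIv : ∀ x ∈ Icc (0 : ℝ) 1, 0 < I x ∧ v x ^ 2 = 1 / I x := by
    intro x hx
    have h0 : 0 < I x := ha.trans_le (hIb x hx).1
    refine ⟨h0, ?_⟩
    simp only [hv]
    rw [inv_pow, Real.sq_sqrt h0.le, one_div]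
  have hsmall : 2 * Hb * ∫ x in Icc (0 : ℝ) 1, |cosPoly P x - v x| ≤ ε / (A + 1) := by
    refine (mul_le_mul_of_nonneg_left hP (by positivity)).trans_eq ?_
    field_simp
  refine ⟨P, hPB, ?_, ?_⟩
  · have h1 : ∫ x in Icc (0 : ℝ) 1, |I x * cosPoly P x ^ 2 - 1| ≤
        ∫ x in Icc (0 : ℝ) 1, A * (2 * Hb) * |cosPoly P x - v x| := by
      refine integral_mono_of_nonneg (ae_of_all _ fun x => abs_nonneg _) (hdiff.const_mul _)
        ((ae_restrict_iff' measurableSet_Icc).2 (ae_of_all _ fun x hx => ?_))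
      obtain ⟨h0, h2⟩ := hIv x hx
      have e1 : I x * cosPoly P x ^ 2 - 1 = I x * (cosPoly P x ^ 2 - v x ^ 2) := by
        rw [h2]
        field_simp
      simp only
      rw [e1, abs_mul, abs_of_pos h0, mul_assoc]
      exact mul_le_mul (hIb x hx).2 (hsq x hx) (abs_nonneg _) hA.le
    refine h1.trans ?_
    rw [integral_const_mul, mul_assoc]
    refine (mul_le_mul_of_nonneg_left hsmall hA.le).trans ?_
    rw [← mul_div_assoc, div_le_iff₀ (by linarith)]
    nlinarith
  · have hI1 : IntegrableOn (fun x => 1 / I x) (Icc (0 : ℝ) 1) := by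
      refine Integrable.of_bound (by fun_prop : Measurable fun x => 1 / I x).aestronglyMeasurable
        a⁻¹ ((ae_restrict_iff' measurableSet_Icc).2 (ae_of_all _ fun x hx => ?_))
      rw [one_div, Real.norm_eq_abs, abs_of_pos (inv_pos.2 (hIv x hx).1)]
      exact inv_anti₀ ha (hIb x hx).1
    have h1 : ∫ x in Icc (0 : ℝ) 1, (1 / I x - 2 * Hb * |cosPoly P x - v x|) ≤
        ∫ x in Icc (0 : ℝ) 1, cosPoly P x ^ 2 := by
      refine setIntegral_mono_on (integrable_fun_sub hI1 (hdiff.const_mul _))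
        (Continuous.integrableOn_Icc (by fun_prop)) measurableSet_Icc fun x hx => ?_
      rw [← (hIv x hx).2]
      have := (abs_le.1 (hsq x hx)).1
      linarith
    rw [integral_sub hI1 (hdiff.const_mul _), integral_const_mul, setIntegral_Icc_eq,
      setIntegral_Icc_eq (fun x => cosPoly P x ^ 2)] at h1
    have h2 : ε / (A + 1) ≤ ε := div_le_self hε.le (by linarith)
    linarith

theorem mem_Icc_exp_of_abs_log_le {t B : ℝ} (ht : 0 < t) (h : |Real.log t| ≤ B) :
    Real.exp (-B) ≤ t ∧ t ≤ Real.exp B := by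
  rw [abs_le] at h
  exact ⟨(Real.le_log_iff_exp_le ht).1 h.1, (Real.log_le_iff_le_exp ht).1 h.2⟩

theorem Model.ScaleAssumption.exists_bounds {D : ℕ} {m : Model} {p : ℝ × (Fin D → ℝ) → ℝ}
    {g : (Fin D → ℝ) → ℝ} {f : ℝ → ℝ} (h : m.ScaleAssumption p g f) (hg : Measurable g) :
    ∃ Pb a A : ℝ, 0 < Pb ∧ 0 < a ∧ (∀ w ∈ cube D, |p w| ≤ Pb) ∧
      ∀ x ∈ Icc (0 : ℝ) 1, a ≤ m.info p g f x ∧ m.info p g f x ≤ A := by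
  obtain ⟨B, hB⟩ := h.log_bounded
  have h1 : ∀ x ∈ Icc (0 : ℝ) 1, ∀ z ∈ Icc (0 : Fin D → ℝ) 1,
      |p (x, z)| ≤ Real.exp B ∧ |(m.variance (f x + g z))⁻¹| ≤ Real.exp (2 * B) ∧
        Real.exp (-B) * Real.exp (-(2 * B)) ≤ p (x, z) * (m.variance (f x + g z))⁻¹ := by
    intro x hx z hz
    obtain ⟨hp, hpB, hv, hvB⟩ := hB x hx z hz
    obtain ⟨p1, p2⟩ := mem_Icc_exp_of_abs_log_le hp hpB
    have hvB' : |Real.log (m.variance (f x + g z))| ≤ 2 * B := by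
      rw [Real.log_sqrt hv.le, abs_div, abs_two] at hvB
      linarith
    obtain ⟨v1, v2⟩ := mem_Icc_exp_of_abs_log_le hv hvB'
    have hi := inv_pos.2 hv
    refine ⟨by rwa [abs_of_pos hp], ?_, ?_⟩
    · rw [abs_of_pos hi]
      refine inv_le_of_inv_le₀ (Real.exp_pos _) ?_
      rwa [← Real.exp_neg]
    · refine mul_le_mul p1 ?_ (Real.exp_pos _).le hp.le
      rw [Real.exp_neg]
      exact inv_anti₀ hv v2
  refine ⟨Real.exp B, Real.exp (-B) * Real.exp (-(2 * B)), Real.exp B * Real.exp (2 * B),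
    Real.exp_pos _, by positivity, fun w hw => (h1 w.1 hw.1 w.2 hw.2).1, fun x hx => ⟨?_, ?_⟩⟩
  · have hi := Model.integrable_info_integrand h.density.measurable hg
      (fun z hz => (h1 x hx z hz).1)
      fun z hz => (h1 x hx z hz).2.1
    have h2 := setIntegral_mono_on (integrable_const (Real.exp (-B) * Real.exp (-(2 * B)))) hi
      measurableSet_Icc fun z hz => (h1 x hx z hz).2.2
    simpa [Model.info] using h2
  · exact (le_abs_self _).trans (Model.abs_info_le (fun z hz => (h1 x hx z hz).1)
      fun z hz => (h1 x hx z hz).2.1)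

theorem IsPrior.info_nonneg {q τ : ℝ → ℝ} {V J : ℝ} (hq : IsPrior q τ V J) : 0 ≤ J := by
  rw [← hq.info]
  exact integral_nonneg fun x => mul_nonneg (sq_nonneg _) (hq.nonneg x)

/-! ### The lower bound for a fixed sample size -/

section FixedSample

variable {D : ℕ} {m : Model} {p : ℝ × (Fin D → ℝ) → ℝ} {g : (Fin D → ℝ) → ℝ} {f₀ : ℝ → ℝ}
  {Pb C c c' Hb b : ℝ} {h : ℝ → ℝ} {K k L M : ℕ} {d : ℤ → ℝ} {r : ℕ → ℝ}

/-- The information is Lipschitz in the regression function, pointwise in x. The distance from f to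
the pivot is uniformly small from f to S, but small only in mean from S to f₀, which is enough for
an L¹ conclusion. -/
theorem integral_abs_info_curve_le (hp : IsDesignDensity p) (hpb : ∀ w ∈ cube D, |p w| ≤ Pb)
    (hg : Measurable g) (hf₀ : Measurable f₀) (hC0 : 0 ≤ C)
    (hC : ∀ t, m.Between c c' t → 0 < m.variance t ∧ (m.variance t)⁻¹ ≤ C)
    (hLip : ∀ s t, m.Between c c' s → m.Between c c' t →
      |(m.variance s)⁻¹ - (m.variance t)⁻¹| ≤ C * |s - t|)
    (hpivot : ∀ w ∈ cube D, m.Between c c' (f₀ w.1 + g w.2)) {f S : ℝ → ℝ} (hf : Measurable f)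
    (hfb : ∀ w ∈ cube D, m.Between c c' (f w.1 + g w.2)) {U : ℝ}
    (hU : ∀ x ∈ Icc (0 : ℝ) 1, |f x - S x| ≤ U)
    (hS : IntegrableOn (fun x => |S x - f₀ x|) (Icc (0 : ℝ) 1))
    (hh : Continuous h) (hH : ∀ x, |h x| ≤ Hb) :
    IntegrableOn (m.info p g f) (Icc (0 : ℝ) 1) ∧
    ∫ x in Icc (0 : ℝ) 1, |m.info p g f x * h x ^ 2 - 1| ≤
      (∫ x in Icc (0 : ℝ) 1, |m.info p g f₀ x * h x ^ 2 - 1|) +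
        Hb ^ 2 * (Pb * C) * ((∫ x in Icc (0 : ℝ) 1, |S x - f₀ x|) + U) := by
  have habs : ∀ u : ℝ → ℝ, (∀ w ∈ cube D, m.Between c c' (u w.1 + g w.2)) →
      ∀ x ∈ Icc (0 : ℝ) 1, ∀ z ∈ Icc (0 : Fin D → ℝ) 1, |(m.variance (u x + g z))⁻¹| ≤ C := by
    intro u hu x hx z hz
    obtain ⟨h1, h2⟩ := hC _ (hu (x, z) ⟨hx, hz⟩)
    rwa [abs_of_pos (inv_pos.2 h1)]
  have hint : ∀ u : ℝ → ℝ, Measurable u → (∀ w ∈ cube D, m.Between c c' (u w.1 + g w.2)) →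
      IntegrableOn (m.info p g u) (Icc (0 : ℝ) 1) := by
    intro u hu hub
    refine Integrable.of_bound (Model.measurable_info hp.measurable hg hu).aestronglyMeasurable
      (Pb * C) ((ae_restrict_iff' measurableSet_Icc).2 (ae_of_all _ fun x hx => ?_))
    exact Model.abs_info_le (fun z hz => hpb (x, z) ⟨hx, hz⟩) (habs u hub x hx)
  have hmul : ∀ u : ℝ → ℝ, IntegrableOn u (Icc (0 : ℝ) 1) →
      IntegrableOn (fun x => |u x * h x ^ 2 - 1|) (Icc (0 : ℝ) 1) := by
    intro u hu
    refine (integrable_fun_sub (Integrable.mul_bdd (c := Hb ^ 2) hu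
      (Continuous.aestronglyMeasurable (by fun_prop)) (ae_of_all _ fun x => ?_))
      (integrable_const _)).abs
    rw [Real.norm_eq_abs, abs_pow]
    exact pow_le_pow_left₀ (abs_nonneg _) (hH x) 2
  refine ⟨hint f hf hfb, ?_⟩
  have h1 : ∀ x ∈ Icc (0 : ℝ) 1, |m.info p g f x * h x ^ 2 - 1| ≤
      |m.info p g f₀ x * h x ^ 2 - 1| + Hb ^ 2 * (Pb * C) * (|S x - f₀ x| + U) := by
    intro x hx
    have hPb : 0 ≤ Pb := (abs_nonneg _).trans (hpb (x, 0) ⟨hx, by simp⟩)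
    have h2 : |m.info p g f x - m.info p g f₀ x| ≤ Pb * (C * |f x - f₀ x|) := by
      refine Model.abs_info_sub_le hp.measurable hg (fun z hz => hpb (x, z) ⟨hx, hz⟩)
        (habs f hfb x hx) (habs f₀ hpivot x hx) fun z hz => ?_
      refine (hLip _ _ (hfb (x, z) ⟨hx, hz⟩) (hpivot (x, z) ⟨hx, hz⟩)).trans_eq ?_
      rw [add_sub_add_right_eq_sub]
    have h3 : |f x - f₀ x| ≤ |S x - f₀ x| + U := by
      have := abs_sub_le (f x) (S x) (f₀ x)
      linarith [hU x hx]
    have h4 : |m.info p g f x - m.info p g f₀ x| * h x ^ 2 ≤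
        Pb * (C * (|S x - f₀ x| + U)) * Hb ^ 2 := by
      have h5 : h x ^ 2 ≤ Hb ^ 2 := by
        rw [← sq_abs]
        exact pow_le_pow_left₀ (abs_nonneg _) (hH x) 2
      have h6 : |m.info p g f x - m.info p g f₀ x| ≤ Pb * (C * (|S x - f₀ x| + U)) :=
        h2.trans (by gcongr)
      exact mul_le_mul h6 h5 (sq_nonneg _) ((abs_nonneg _).trans h6)
    have e1 : m.info p g f x * h x ^ 2 - 1 = (m.info p g f₀ x * h x ^ 2 - 1) +
        (m.info p g f x - m.info p g f₀ x) * h x ^ 2 := by ring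
    rw [e1]
    refine (abs_add_le _ _).trans ?_
    rw [abs_mul, abs_of_nonneg (sq_nonneg (h x))]
    linarith
  have h2 : IntegrableOn (fun x => Hb ^ 2 * (Pb * C) * (|S x - f₀ x| + U)) (Icc (0 : ℝ) 1) :=
    (hS.add (integrable_const U)).const_mul _
  refine (setIntegral_mono_on (hmul _ (hint f hf hfb))
    ((hmul _ (hint f₀ hf₀ hpivot)).add h2) measurableSet_Icc h1).trans_eq ?_
  rw [integral_add' (hmul _ (hint f₀ hf₀ hpivot)) h2, integral_const_mul,
    integral_add hS (integrable_const _)]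
  simp

theorem IsMultiplier.le_minimaxMISE_add (hd : IsMultiplier h K d) {q τ : ℝ → ℝ} {V J : ℝ}
    (hq : IsPrior q τ V J) (hL : 1 ≤ L) (hM : M ≤ L) (hb : 0 ≤ b)
    (hr0 : ∀ l < k, 0 < r l) (hr : ∀ l < k, r l ≤ b) (hh : Continuous h) (hH : ∀ x, |h x| ≤ Hb)
    (hp : IsDesignDensity p) (hpb : ∀ w ∈ cube D, |p w| ≤ Pb)
    (hg : Measurable g) (hf₀ : Measurable f₀) (hc : 0 < c) (hc' : c' < 1) (hC0 : 0 ≤ C)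
    (hC : ∀ t, m.Between c c' t → 0 < m.variance t ∧ (m.variance t)⁻¹ ≤ C)
    (hLip : ∀ s t, m.Between c c' s → m.Between c c' t →
      |(m.variance s)⁻¹ - (m.variance t)⁻¹| ≤ C * |s - t|)
    (hpivot : ∀ w ∈ cube D, m.Between c c' (f₀ w.1 + g w.2))
    (hlow : ∀ u, |u| ≤ k * (b * (Hb * √2)) → ∀ w ∈ cube D,
      m.Between c c' (lowFreq f₀ M w.1 + u + g w.2))
    (hS : IntegrableOn (fun x => |lowFreq f₀ M x - f₀ x|) (Icc (0 : ℝ) 1)) {ε : ℝ} (hε : 0 ≤ ε)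
    (hδ : 2 * Hb ^ 2 * ((∫ x in Icc (0 : ℝ) 1, |m.info p g f₀ x * h x ^ 2 - 1|) +
      Hb ^ 2 * (Pb * C) * ((∫ x in Icc (0 : ℝ) 1, |lowFreq f₀ M x - f₀ x|) +
        k * (b * (Hb * √2)))) ≤ ε * ∫ x in (0 : ℝ)..1, h x ^ 2)
    {ρ : ℝ≥0∞} {α Q μ t : ℝ} (hα : 0 ≤ α)
    (hμ : V * ((∫ x in (0 : ℝ)..1, h x ^ 2) *
      ∑ l ∈ Finset.range k, r l ^ 2 * sobolevWeight α (L + (l + 2 * K))) ≤ μ) (hQ : μ < Q)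
    {n : ℕ} (hn : 1 ≤ n) (ht : 0 ≤ t)
    (hgrid : ((k + 2 * K : ℕ) : ℝ) * ((b * absSum K d) *
        (√2 * (Real.pi * (L + (k + 2 * K) : ℕ) * (n : ℝ)⁻¹))) ≤ t / 2)
    (hρ : ENNReal.ofReal t < ρ) :
    ENNReal.ofReal ((∫ x in (0 : ℝ)..1, h x ^ 2) *
        ∑ l ∈ Finset.range k, (n * (1 + ε) + J / r l ^ 2)⁻¹) ≤
      m.minimaxMISE p g (family f₀ ρ M α Q ∩ m.bonaFide g) n +
      ENNReal.ofReal (10 * (((k + 2 * K : ℕ) : ℝ) * (b * absSum K d) ^ 2) *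
        (((k + 2 * K : ℕ) : ℝ) * (2 * (2 * K : ℕ) + 1) *
          (sobolevWeight α (L + (k + 2 * K)) * (b * absSum K d) ^ 2) ^ 2 / (Q - μ) ^ 2 +
        (n + 1) * (2 * Real.exp (-(t / 2) ^ 2 / (2 * (k * (b * (Hb * √2)) ^ 2)))))) := by
  have := hq.isProbabilityMeasure_prior (k := k)
  have hrabs : ∀ l < k, |r l| ≤ b := fun l hl => by
    rw [abs_of_pos (hr0 l hl)]
    exact hr l hl
  set H := ∫ x in (0 : ℝ)..1, h x ^ 2 with hHdef
  set S := lowFreq f₀ M with hSdef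
  set e : Fin k → ℝ → ℝ := fun l => direction h r L K l with he
  have hbt : ∀ ξ ∈ paramBox k, ∀ w ∈ cube D, m.Between c c' (curve S e ξ w.1 + g w.2) :=
    fun ξ hξ w hw => hlow _ (abs_sum_direction_le hH hrabs hξ w.1) w hw
  have hsub : IsSubmodel m p g S e C (b * (Hb * √2)) :=
    { density := hp
      measurable_g := hg
      measurable_S := (continuous_lowFreq f₀ M).measurable
      measurable_e := fun i => by
        simp only [he]
        unfold direction
        exact Continuous.measurable (by fun_prop)
      abs_e_le := fun i x => abs_direction_le hH (hrabs i i.2) x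
      regular := fun ξ hξ w hw => (hbt ξ hξ w hw).isInterior hc hc'
      inv_variance_le := fun ξ hξ w hw => (hC _ (hbt ξ hξ w hw)).2 }
  obtain ⟨G, hGm, hG, hGp⟩ := hd.exists_mem_family hq hL hM hb hrabs hH f₀ hα hμ hQ hn ht hgrid hρ
  -- Up to the factor ∫h², the l-th term of the van Trees bound with weight κ/r_l² is 2κ - κ²(n(1+ε)
  -- + J/r_l²). This is its maximiser, and the maximum equals κ itself.
  set κ : Fin k → ℝ := fun l => (n * (1 + ε) + J / r l ^ 2)⁻¹ with hκ
  have hn0 : (0 : ℝ) < n := by exact_mod_cast hn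
  have hJ := hq.info_nonneg
  have hκ0 : ∀ l : Fin k, 0 < n * (1 + ε) + J / r l ^ 2 := fun l => by positivity
  have hA : ∀ ξ ∈ paramBox k, ∑ i, ∑ j, κ i / r i ^ 2 * (κ j / r j ^ 2) * unitInner (e i) (e j) *
      (∫ x in (0 : ℝ)..1, m.info p g (curve S e ξ) x * (e i x * e j x)) ≤
      (H + ε * H) * ∑ i, κ i ^ 2 := by
    intro ξ hξ
    obtain ⟨hI, hI2⟩ := integral_abs_info_curve_le hp hpb hg hf₀ hC0 hC hLip hpivot
      (hsub.measurable_curve ξ) (hbt ξ hξ) (S := S) (U := k * (b * (Hb * √2)))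
      (fun x _ => by
        rw [curve, add_sub_cancel_left]
        exact abs_sum_direction_le hH hrabs hξ x) hS hh hH
    refine (hd.sum_information_le hL hh hH κ (fun l hl => (hr0 l hl).ne') hI).trans ?_
    refine mul_le_mul_of_nonneg_right ?_ (Finset.sum_nonneg fun i _ => sq_nonneg _)
    exact add_le_add le_rfl ((mul_le_mul_of_nonneg_left hI2 (by positivity)).trans hδ)
  have hmain := hsub.le_minimaxMISE_add (n := n) hq
    (R := ((k + 2 * K : ℕ) : ℝ) * (b * absSum K d) ^ 2)
    (by positivity) (fun ξ hξ => hd.sqDist_curve_le hL hb hrabs S hξ)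
    (fun i => κ i / r i ^ 2) hA (F := family f₀ ρ M α Q ∩ m.bonaFide g) hGm
    (fun ξ hξ hξG => ⟨hG ξ hξ hξG, fun x hx z hz =>
      ((hbt ξ hξ (x, z) ⟨hx, hz⟩).isInterior hc hc').isMean⟩)
  have hdiag : ∀ i, unitInner (e i) (e i) = r i ^ 2 * H := by
    intro i
    have h1 := hd.integral_sq (L + i) (by omega)
    rw [hHdef, ← h1, ← intervalIntegral.integral_const_mul]
    simp only [unitInner, he, direction]
    rw [setIntegral_Icc_eq]
    exact intervalIntegral.integral_congr fun x _ => by ring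
  have hval : 2 * ∑ i, κ i / r i ^ 2 * unitInner (e i) (e i) -
      n * ((H + ε * H) * ∑ i, κ i ^ 2) -
      J * ∑ i, (κ i / r i ^ 2) ^ 2 * unitInner (e i) (e i) =
      H * ∑ l ∈ Finset.range k, (n * (1 + ε) + J / r l ^ 2)⁻¹ := by
    rw [← Fin.sum_univ_eq_sum_range (fun l => (n * (1 + ε) + J / r l ^ 2)⁻¹)]
    simp_rw [Finset.mul_sum]
    rw [← Finset.sum_sub_distrib, ← Finset.sum_sub_distrib]
    refine Finset.sum_congr rfl fun i _ => ?_
    have hri := hr0 i i.2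
    have hκi : κ i * (n * (1 + ε) + J / r i ^ 2) = 1 := inv_mul_cancel₀ (hκ0 i).ne'
    rw [hdiag]
    have e1 : 2 * (κ i / r i ^ 2 * (r i ^ 2 * H)) - n * ((H + ε * H) * κ i ^ 2) -
        J * ((κ i / r i ^ 2) ^ 2 * (r i ^ 2 * H)) =
        H * (2 * κ i - κ i * (κ i * (n * (1 + ε) + J / r i ^ 2))) := by
      field_simp
      ring
    rw [e1, hκi]
    simp only [hκ]
    ring
  rw [hval] at hmain
  refine hmain.trans ?_
  gcongr
  rw [ENNReal.ofReal_mul' (le_trans measureReal_nonneg hGp)]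
  gcongr
  rw [← ofReal_measureReal]
  exact ENNReal.ofReal_le_ofReal hGp

end FixedSample

/-! ### Power sums -/

theorem sum_range_rpow_le {a : ℝ} (ha : 0 ≤ a) (m : ℕ) :
    ∑ j ∈ Finset.range m, (j : ℝ) ^ a ≤ (m : ℝ) ^ (a + 1) / (a + 1) := by
  have h := MonotoneOn.sum_le_integral (x₀ := 0) (a := m) (f := fun x : ℝ => x ^ a)
    fun x hx y _ hxy => Real.rpow_le_rpow hx.1 hxy ha
  simp only [zero_add] at h
  rwa [integral_rpow (Or.inl (by linarith)), Real.zero_rpow (by linarith), sub_zero] at h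

theorem le_sum_range_rpow {a : ℝ} (ha : 0 ≤ a) {m : ℕ} (hm : 1 ≤ m) :
    ((m : ℝ) - 1) ^ (a + 1) / (a + 1) ≤ ∑ j ∈ Finset.range m, (j : ℝ) ^ a := by
  obtain ⟨m, rfl⟩ := Nat.exists_eq_add_of_le' hm
  have h := MonotoneOn.integral_le_sum (x₀ := 0) (a := m) (f := fun x : ℝ => x ^ a)
    fun x hx y _ hxy => Real.rpow_le_rpow hx.1 hxy ha
  simp only [zero_add] at h
  rw [integral_rpow (Or.inl (by linarith)), Real.zero_rpow (by linarith), sub_zero] at h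
  rw [Finset.sum_range_succ']
  have h0 : (0 : ℝ) ≤ ((0 : ℕ) : ℝ) ^ a := by positivity
  push_cast at h h0 ⊢
  rw [add_sub_cancel_right]
  linarith

theorem tendsto_ceil_sub_one_div : Tendsto (fun N : ℝ => ((⌈N⌉₊ : ℝ) - 1) / N) atTop (𝓝 1) := by
  have h := (tendsto_nat_ceil_div_atTop (R := ℝ)).sub tendsto_inv_atTop_zero
  rw [sub_zero] at h
  exact h.congr fun N => by rw [sub_div, one_div]

/-- Neither the summand 1 nor the shift by T caused by h affects the leading order of the weights.
-/
theorem eventually_sobolevWeight_le {α θ : ℝ} (hα : 0 < α) (hθ : 1 < θ) (T : ℕ) :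
    ∀ᶠ j : ℕ in atTop, sobolevWeight α (j + T) ≤ θ * (Real.pi * j) ^ (2 * α) := by
  have h1 : Tendsto (fun j : ℕ => Real.pi * (j : ℝ)) atTop atTop :=
    tendsto_natCast_atTop_atTop.const_mul_atTop Real.pi_pos
  have h2 : Tendsto (fun j : ℕ => (Real.pi * (j : ℝ)) ^ (-(2 * α))) atTop (𝓝 0) :=
    (tendsto_rpow_neg_atTop (by linarith : 0 < 2 * α)).comp h1
  have h3 : Tendsto (fun j : ℕ => (1 + (T : ℝ) / j) ^ (2 * α)) atTop (𝓝 1) := by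
    have h4 := (tendsto_const_div_atTop_nhds_zero_nat (T : ℝ)).const_add 1
    rw [add_zero] at h4
    have h5 := h4.rpow_const (p := 2 * α) (Or.inl one_ne_zero)
    rwa [Real.one_rpow] at h5
  have h4 := h2.add h3
  rw [zero_add] at h4
  filter_upwards [h4.eventually_le_const hθ, eventually_gt_atTop 0] with j hj hj0
  have hj0' : (0 : ℝ) < j := by exact_mod_cast hj0
  have hpos : 0 < Real.pi * (j : ℝ) := by positivity
  have e1 : sobolevWeight α (j + T) = ((Real.pi * (j : ℝ)) ^ (-(2 * α)) +
      (1 + (T : ℝ) / j) ^ (2 * α)) * (Real.pi * j) ^ (2 * α) := by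
    rw [add_mul, ← Real.rpow_add hpos, neg_add_cancel, Real.rpow_zero,
      ← Real.mul_rpow (by positivity) hpos.le, sobolevWeight]
    congr 2
    push_cast
    field_simp
  rw [e1]
  exact mul_le_mul_of_nonneg_right hj (by positivity)

theorem lt_of_mem_Ico_ceil {N : ℝ} {L j : ℕ} (hj : j ∈ Finset.Ico L ⌈N⌉₊) : (j : ℝ) < N :=
  Nat.lt_ceil.1 (Finset.mem_Ico.1 hj).2

/-- The Sobolev energy of the least favourable prior. -/
theorem eventually_energy_le {α ε θ : ℝ} (hα : 0 < α) (hε : 0 < ε) (hθ : 1 < θ) (T : ℕ) :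
    ∀ᶠ N : ℝ in atTop, ∑ j ∈ Finset.Ico ⌈ε * N⌉₊ ⌈N⌉₊,
      ((N / j) ^ α - 1) * sobolevWeight α (j + T) ≤
        θ * (Real.pi ^ (2 * α) * (α / ((α + 1) * (2 * α + 1)))) * N ^ (2 * α + 1) := by
  -- One factor √θ pays for the Sobolev weights, the other for the power sums.
  have hθ1 : 1 < √θ := by
    rw [Real.lt_sqrt zero_le_one]
    simpa using hθ
  obtain ⟨j₀, hj₀⟩ := eventually_atTop.1 (eventually_sobolevWeight_le hα hθ1 T)
  -- Since ((N/j)^α - 1) j^{2α} = N^α j^α - j^{2α}, the normalised sum tends to 1/(α+1) - 1/(2α+1).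
  have h1 : Tendsto (fun N : ℝ => ((⌈N⌉₊ : ℝ) / N) ^ (α + 1) / (α + 1) -
      (((⌈N⌉₊ : ℝ) - 1) / N) ^ (2 * α + 1) / (2 * α + 1)) atTop
      (𝓝 (α / ((α + 1) * (2 * α + 1)))) := by
    have h2 := ((tendsto_nat_ceil_div_atTop (R := ℝ)).rpow_const (p := α + 1)
      (Or.inl one_ne_zero)).div_const (α + 1)
    have h3 := (tendsto_ceil_sub_one_div.rpow_const (p := 2 * α + 1)
      (Or.inl one_ne_zero)).div_const (2 * α + 1)
    have h4 := h2.sub h3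
    rw [Real.one_rpow, Real.one_rpow] at h4
    convert h4 using 2
    field_simp
    ring
  have hpos : 0 < α / ((α + 1) * (2 * α + 1)) := by positivity
  filter_upwards [h1.eventually_le_const (by nlinarith :
    α / ((α + 1) * (2 * α + 1)) < √θ * (α / ((α + 1) * (2 * α + 1)))), eventually_ge_atTop 1,
    (tendsto_id.const_mul_atTop hε).eventually_ge_atTop (j₀ + 1 : ℝ)] with N hN hN1 hNj
  simp only [id] at hNj
  have hN0 : 0 < N := by linarith
  have hm : 1 ≤ ⌈N⌉₊ := Nat.one_le_ceil_iff.2 hN0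
  have hm1 : (1 : ℝ) ≤ ⌈N⌉₊ := by exact_mod_cast hm
  have hterm : ∀ j : ℕ, (j : ℝ) < N → 0 ≤ N ^ α * (j : ℝ) ^ α - (j : ℝ) ^ (2 * α) := by
    intro j hj
    rw [two_mul, Real.rpow_add_of_nonneg (Nat.cast_nonneg j) hα.le hα.le, ← sub_mul]
    exact mul_nonneg (sub_nonneg.2 (Real.rpow_le_rpow (Nat.cast_nonneg j) hj.le hα.le))
      (by positivity)
  calc _ ≤ ∑ j ∈ Finset.Ico ⌈ε * N⌉₊ ⌈N⌉₊,
        √θ * Real.pi ^ (2 * α) * (N ^ α * (j : ℝ) ^ α - (j : ℝ) ^ (2 * α)) := by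
        refine Finset.sum_le_sum fun j hj => ?_
        have hjN := lt_of_mem_Ico_ceil hj
        have hjL : j₀ + 1 ≤ j := by
          have h5 : (j₀ + 1 : ℝ) ≤ j := hNj.trans ((Nat.le_ceil _).trans
            (by exact_mod_cast (Finset.mem_Ico.1 hj).1))
          exact_mod_cast h5
        have hj0 : (0 : ℝ) < j := by
          have : 0 < j := by omega
          exact_mod_cast this
        have h6 : 0 ≤ (N / j) ^ α - 1 := by
          rw [sub_nonneg]
          exact Real.one_le_rpow ((one_le_div hj0).2 hjN.le) hα.le
        refine (mul_le_mul_of_nonneg_left (hj₀ j (by omega)) h6).trans_eq ?_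
        rw [Real.mul_rpow Real.pi_pos.le hj0.le, Real.div_rpow hN0.le hj0.le, two_mul,
          Real.rpow_add hj0]
        have : (j : ℝ) ^ α ≠ 0 := (Real.rpow_pos_of_pos hj0 _).ne'
        field_simp
    _ ≤ √θ * Real.pi ^ (2 * α) * ∑ j ∈ Finset.range ⌈N⌉₊,
        (N ^ α * (j : ℝ) ^ α - (j : ℝ) ^ (2 * α)) := by
        rw [← Finset.mul_sum]
        refine mul_le_mul_of_nonneg_left ?_ (by positivity)
        refine Finset.sum_le_sum_of_subset_of_nonneg (fun j hj => ?_) fun j hj _ =>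
          hterm j (Nat.lt_ceil.1 (Finset.mem_range.1 hj))
        exact Finset.mem_range.2 (Finset.mem_Ico.1 hj).2
    _ ≤ √θ * Real.pi ^ (2 * α) * (N ^ (2 * α + 1) *
        (((⌈N⌉₊ : ℝ) / N) ^ (α + 1) / (α + 1) -
          (((⌈N⌉₊ : ℝ) - 1) / N) ^ (2 * α + 1) / (2 * α + 1))) := by
        refine mul_le_mul_of_nonneg_left ?_ (by positivity)
        rw [Finset.sum_sub_distrib, ← Finset.mul_sum]
        have h7 := mul_le_mul_of_nonneg_left (sum_range_rpow_le hα.le ⌈N⌉₊)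
          (Real.rpow_nonneg hN0.le α)
        have h8 := le_sum_range_rpow (a := 2 * α) (by positivity) hm
        refine (sub_le_sub h7 h8).trans_eq ?_
        rw [Real.div_rpow (Nat.cast_nonneg _) hN0.le, Real.div_rpow (by linarith) hN0.le,
          show 2 * α + 1 = α + (α + 1) by ring, Real.rpow_add hN0 α (α + 1)]
        have h9 : N ^ (α + 1) ≠ 0 := (Real.rpow_pos_of_pos hN0 _).ne'
        have h10 : N ^ α ≠ 0 := (Real.rpow_pos_of_pos hN0 _).ne'
        field_simp
    _ ≤ √θ * Real.pi ^ (2 * α) * (N ^ (2 * α + 1) *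
        (√θ * (α / ((α + 1) * (2 * α + 1))))) := by gcongr
    _ = _ := by
        nth_rewrite 3 [← Real.mul_self_sqrt (by linarith : 0 ≤ θ)]
        ring

/-- The risk of the least favourable prior. -/
theorem eventually_le_risk {α ε : ℝ} (hα : 0 < α) (hε : 0 < ε) :
    ∀ᶠ N : ℝ in atTop, (α / (α + 1) - 2 * ε) * N ≤
      ∑ j ∈ Finset.Ico ⌈ε * N⌉₊ ⌈N⌉₊, (1 - ((j : ℝ) / N) ^ α) := by
  -- One ε is lost by omitting the frequencies below εN, the other is slack in the limit.
  have h1 : Tendsto (fun N : ℝ => (⌈N⌉₊ : ℝ) / N - (⌈ε * N⌉₊ : ℝ) / N -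
      ((⌈N⌉₊ : ℝ) / N) ^ (α + 1) / (α + 1)) atTop (𝓝 (1 - ε - 1 / (α + 1))) := by
    have h2 := ((tendsto_nat_ceil_div_atTop (R := ℝ)).rpow_const (p := α + 1)
      (Or.inl one_ne_zero)).div_const (α + 1)
    have h3 := ((tendsto_nat_ceil_div_atTop (R := ℝ)).sub
      (tendsto_nat_ceil_mul_div_atTop hε.le)).sub h2
    rwa [Real.one_rpow] at h3
  have e0 : 1 - 1 / (α + 1) = α / (α + 1) := by
    field_simp
    ring
  filter_upwards [h1.eventually_const_le (by linarith :
    α / (α + 1) - 2 * ε < 1 - ε - 1 / (α + 1)), eventually_gt_atTop 0] with N hN hN0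
  refine (mul_le_mul_of_nonneg_right hN hN0.le).trans ?_
  rw [Finset.sum_sub_distrib, Finset.sum_const, Nat.card_Ico, nsmul_one]
  have h4 : ∑ j ∈ Finset.Ico ⌈ε * N⌉₊ ⌈N⌉₊, ((j : ℝ) / N) ^ α ≤
      (N ^ α)⁻¹ * ((⌈N⌉₊ : ℝ) ^ (α + 1) / (α + 1)) := by
    refine le_trans (Finset.sum_le_sum_of_subset_of_nonneg (t := Finset.range ⌈N⌉₊)
      (fun j hj => Finset.mem_range.2 (Finset.mem_Ico.1 hj).2) fun j _ _ => by positivity) ?_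
    refine le_trans (le_of_eq ?_) (mul_le_mul_of_nonneg_left (sum_range_rpow_le hα.le ⌈N⌉₊)
      (by positivity))
    rw [Finset.mul_sum]
    refine Finset.sum_congr rfl fun j _ => ?_
    rw [Real.div_rpow (Nat.cast_nonneg _) hN0.le, div_eq_inv_mul]
  have h5 : (⌈N⌉₊ : ℝ) - ⌈ε * N⌉₊ ≤ ((⌈N⌉₊ - ⌈ε * N⌉₊ : ℕ) : ℝ) := by
    have : ⌈N⌉₊ ≤ ⌈N⌉₊ - ⌈ε * N⌉₊ + ⌈ε * N⌉₊ := by omega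
    have h6 : (⌈N⌉₊ : ℝ) ≤ ((⌈N⌉₊ - ⌈ε * N⌉₊ : ℕ) : ℝ) + ⌈ε * N⌉₊ := by exact_mod_cast this
    linarith
  refine le_trans (le_of_eq ?_) (sub_le_sub h5 h4)
  rw [Real.div_rpow (Nat.cast_nonneg _) hN0.le, Real.rpow_add hN0, Real.rpow_one]
  have h10 : N ^ α ≠ 0 := (Real.rpow_pos_of_pos hN0 _).ne'
  field_simp

/-! ### Rates -/

section Rates

variable {α κ : ℝ}

theorem tendsto_rate_atTop (hα : 0 < α) (hκ : 0 < κ) :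
    Tendsto (fun n : ℕ => (κ * (n : ℝ)) ^ (1 / (2 * α + 1))) atTop atTop :=
  (tendsto_rpow_atTop (by positivity)).comp (tendsto_natCast_atTop_atTop.const_mul_atTop hκ)

theorem tendsto_natCast_rpow_zero {a : ℝ} (ha : a < 0) :
    Tendsto (fun n : ℕ => (n : ℝ) ^ a) atTop (𝓝 0) := by
  have h := (tendsto_rpow_neg_atTop (neg_pos.2 ha)).comp tendsto_natCast_atTop_atTop
  rw [neg_neg] at h
  exact h

theorem one_div_two_mul_add_one_le (hα : 1 ≤ α) : 1 / (2 * α + 1) ≤ 1 / 3 :=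
  one_div_le_one_div_of_le (by norm_num) (by linarith)

/-- About N terms of size n^{-1/2} bound the perturbation of S_M f₀ uniformly. It vanishes, so all
curves remain interior and their information stays close to that of the pivot. -/
theorem tendsto_rate_mul_inv_sqrt (hα : 1 ≤ α) (hκ : 0 < κ) :
    Tendsto (fun n : ℕ => (κ * (n : ℝ)) ^ (1 / (2 * α + 1)) * (√n)⁻¹) atTop (𝓝 0) := by
  have hγ := one_div_two_mul_add_one_le hα
  have h := (tendsto_natCast_rpow_zero (a := 1 / (2 * α + 1) - 1 / 2) (by linarith)).const_mul
    (κ ^ (1 / (2 * α + 1)))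
  rw [mul_zero] at h
  refine h.congr' ?_
  filter_upwards [eventually_gt_atTop 0] with n hn
  have hn0 : (0 : ℝ) < n := by exact_mod_cast hn
  rw [Real.mul_rpow hκ.le hn0.le, Real.rpow_sub hn0, Real.sqrt_eq_rpow]
  ring

theorem eventually_grid_le (hα : 1 ≤ α) (hκ : 0 < κ) (C : ℝ) :
    ∀ᶠ n : ℕ in atTop, C * ((κ * (n : ℝ)) ^ (1 / (2 * α + 1))) ^ 2 * ((√n)⁻¹ * (n : ℝ)⁻¹) ≤
      (n : ℝ) ^ (-(1 / (2 * α + 1))) * Real.log n := by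
  have hγ := one_div_two_mul_add_one_le hα
  set γ := 1 / (2 * α + 1) with hγdef
  have h := (tendsto_natCast_rpow_zero (a := γ + γ + γ - 1 / 2 - 1) (by linarith)).const_mul
    (C * (κ ^ γ) ^ 2)
  rw [mul_zero] at h
  have hlog : Tendsto (fun n : ℕ => Real.log n) atTop atTop :=
    Real.tendsto_log_atTop.comp tendsto_natCast_atTop_atTop
  filter_upwards [eventually_gt_atTop 0, h.eventually_le_const zero_lt_one,
    hlog.eventually_ge_atTop 1] with n hn h1 h2
  have hn0 : (0 : ℝ) < n := by exact_mod_cast hn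
  have e1 : C * ((κ * (n : ℝ)) ^ γ) ^ 2 * ((√n)⁻¹ * (n : ℝ)⁻¹) =
      (n : ℝ) ^ (-γ) * (C * (κ ^ γ) ^ 2 * (n : ℝ) ^ (γ + γ + γ - 1 / 2 - 1)) := by
    have : (n : ℝ) ^ γ ≠ 0 := (Real.rpow_pos_of_pos hn0 _).ne'
    rw [Real.mul_rpow hκ.le hn0.le, Real.rpow_sub hn0, Real.rpow_sub hn0, Real.rpow_add hn0,
      Real.rpow_add hn0, Real.rpow_one, Real.rpow_neg hn0.le, Real.sqrt_eq_rpow]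
    field_simp
  rw [e1]
  exact mul_le_mul_of_nonneg_left (h1.trans h2) (by positivity)

/-- The variance proxy at one point is of order N/n and the threshold is n^{-γ} ln n with γ =
1/(2α+1), so the exponent has order n^{1-3γ} ln² n. For α ≥ 1 this is at least of order ln² n and
beats the number of grid points. -/
theorem tendsto_exp_grid (hα : 1 ≤ α) (hκ : 0 < κ) {C : ℝ} (hC : 0 < C) :
    Tendsto (fun n : ℕ => ((n : ℝ) + 1) * (2 * Real.exp (-((n : ℝ) ^ (-(1 / (2 * α + 1))) *
      Real.log n / 2) ^ 2 / (C * (κ * (n : ℝ)) ^ (1 / (2 * α + 1)) * (n : ℝ)⁻¹))))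
      atTop (𝓝 0) := by
  have hγ := one_div_two_mul_add_one_le hα
  set γ := 1 / (2 * α + 1) with hγdef
  have hlog : Tendsto (fun n : ℕ => Real.log n) atTop atTop :=
    Real.tendsto_log_atTop.comp tendsto_natCast_atTop_atTop
  have hbound : Tendsto (fun n : ℕ => 4 * ((n : ℝ))⁻¹) atTop (𝓝 0) := by
    have h := tendsto_inv_atTop_nhds_zero_nat (𝕜 := ℝ).const_mul 4
    rwa [mul_zero] at h
  refine squeeze_zero' (Eventually.of_forall fun n => by positivity) ?_ hbound
  filter_upwards [eventually_ge_atTop 1, hlog.eventually_ge_atTop 0,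
    hlog.eventually_ge_atTop (8 * C * κ ^ γ)] with n hn h1 h2
  have hn1 : (1 : ℝ) ≤ n := by exact_mod_cast hn
  have hn0 : (0 : ℝ) < n := by linarith
  have hx : 0 < (n : ℝ) ^ γ := Real.rpow_pos_of_pos hn0 _
  have hκγ : 0 < κ ^ γ := Real.rpow_pos_of_pos hκ _
  -- The condition 3γ ≤ 1 is exactly α ≥ 1.
  have hx3 : ((n : ℝ) ^ γ) ^ 3 ≤ n := by
    rw [← Real.rpow_natCast, ← Real.rpow_mul hn0.le]
    calc _ ≤ (n : ℝ) ^ (1 : ℝ) := Real.rpow_le_rpow_of_exponent_le hn1 (by push_cast; linarith)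
      _ = n := Real.rpow_one _
  have h3 : -((n : ℝ) ^ (-γ) * Real.log n / 2) ^ 2 / (C * (κ * (n : ℝ)) ^ γ * (n : ℝ)⁻¹) ≤
      -(2 * Real.log n) := by
    rw [neg_div, neg_le_neg_iff, le_div_iff₀ (by positivity), Real.mul_rpow hκ.le hn0.le,
      Real.rpow_neg hn0.le]
    have h4 : 8 * C * κ ^ γ * Real.log n ≤ Real.log n ^ 2 := by
      rw [sq]
      exact mul_le_mul_of_nonneg_right h2 h1
    have h5 : 0 ≤ Real.log n ^ 2 := sq_nonneg _
    have e1 : (((n : ℝ) ^ γ)⁻¹ * Real.log n / 2) ^ 2 =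
        n * (Real.log n ^ 2 / (4 * ((n : ℝ) ^ γ) ^ 2 * n)) := by
      field_simp
      norm_num
    have e2 : 2 * Real.log n * (C * (κ ^ γ * (n : ℝ) ^ γ) * (n : ℝ)⁻¹) =
        ((n : ℝ) ^ γ) ^ 3 * (8 * C * κ ^ γ * Real.log n / (4 * ((n : ℝ) ^ γ) ^ 2 * n)) := by
      field_simp
      ring
    rw [e1, e2]
    gcongr
  have h4 : Real.exp (-((n : ℝ) ^ (-γ) * Real.log n / 2) ^ 2 /
      (C * (κ * (n : ℝ)) ^ γ * (n : ℝ)⁻¹)) ≤ ((n : ℝ) ^ 2)⁻¹ := by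
    refine (Real.exp_le_exp.2 h3).trans_eq ?_
    rw [Real.exp_neg, two_mul, Real.exp_add, Real.exp_log hn0, sq]
  calc _ ≤ ((n : ℝ) + n) * (2 * ((n : ℝ) ^ 2)⁻¹) := by gcongr
    _ = 4 * (n : ℝ)⁻¹ := by
      field_simp
      norm_num

theorem eventually_lowFreq_cutoff (hκ : 0 < κ) {ε γ : ℝ} (hε : 0 < ε) :
    ∀ᶠ n : ℕ in atTop, (n : ℝ) ^ γ / Real.log n ^ 2 ≤ ε * (κ * (n : ℝ)) ^ γ := by
  have hlog : Tendsto (fun n : ℕ => Real.log n) atTop atTop :=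
    Real.tendsto_log_atTop.comp tendsto_natCast_atTop_atTop
  have hκγ : 0 < κ ^ γ := Real.rpow_pos_of_pos hκ _
  filter_upwards [eventually_gt_atTop 0, hlog.eventually_ge_atTop 1,
    hlog.eventually_ge_atTop (1 / (ε * κ ^ γ))] with n hn h1 h2
  have hn0 : (0 : ℝ) < n := by exact_mod_cast hn
  rw [Real.mul_rpow hκ.le hn0.le, div_le_iff₀ (by positivity)]
  rw [div_le_iff₀ (by positivity)] at h2
  have h3 : 1 ≤ ε * κ ^ γ * Real.log n ^ 2 := by
    nlinarith [mul_pos hε hκγ]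
  nlinarith [Real.rpow_pos_of_pos hn0 γ]

end Rates

/-! ### The constants -/

/-- With κ the base of the last power on the left, H·α/(α+1)·κ^{1/(2α+1)} is the coefficient of the
asymptotic risk. The identity splits H and α/(α+1) by 1 = 2α/(2α+1) + 1/(2α+1); θ records the slack
in the energy. -/
theorem difficulty_mul_rate {α Q H θ : ℝ} (hα : 0 < α) (hQ : 0 < Q) (hH : 0 < H) (hθ : 0 < θ) :
    H * (α / (α + 1)) *
      (Q * (α + 1) * (2 * α + 1) / (θ ^ 2 * H * Real.pi ^ (2 * α) * α)) ^ (1 / (2 * α + 1)) =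
    pinsker α Q * H ^ (2 * α / (2 * α + 1)) * (θ ^ 2) ^ (-(1 / (2 * α + 1))) := by
  have h1 : (0 : ℝ) < 2 * α + 1 := by linarith
  have h2 : (0 : ℝ) < α + 1 := by linarith
  have hpi := Real.pi_pos
  have e0 : 1 = 2 * α / (2 * α + 1) + 1 / (2 * α + 1) := by
    rw [← add_div, div_self h1.ne']
  have hrep : ∀ x : ℝ, 0 < x → x = x ^ (2 * α / (2 * α + 1)) * x ^ (1 / (2 * α + 1)) := by
    intro x hx
    rw [← Real.rpow_add hx, ← e0, Real.rpow_one]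
  have e1 : Q * (α + 1) * (2 * α + 1) / (θ ^ 2 * H * Real.pi ^ (2 * α) * α) =
      (Q * (2 * α + 1)) * (α / (α + 1))⁻¹ * (θ ^ 2)⁻¹ * H⁻¹ * (Real.pi ^ (2 * α))⁻¹ := by
    field_simp
  have e2 : α / (Real.pi * (α + 1)) = (α / (α + 1)) * Real.pi⁻¹ := by
    field_simp
  have hx : 0 < α / (α + 1) := by positivity
  rw [e1, pinsker, e2, Real.mul_rpow (by positivity) (by positivity),
    Real.mul_rpow (by positivity) (by positivity), Real.mul_rpow (by positivity) (by positivity),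
    Real.mul_rpow (by positivity) (by positivity),
    Real.mul_rpow (x := α / (α + 1)) (by positivity) (by positivity),
    Real.inv_rpow hx.le, Real.inv_rpow hH.le, Real.inv_rpow (by positivity : 0 ≤ θ ^ 2),
    Real.inv_rpow (by positivity : (0 : ℝ) ≤ Real.pi ^ (2 * α)), Real.inv_rpow hpi.le,
    ← Real.rpow_mul hpi.le, Real.rpow_neg (by positivity), mul_one_div]
  have h3 := (Real.rpow_pos_of_pos hx (1 / (2 * α + 1))).ne'
  have h4 := (Real.rpow_pos_of_pos hH (1 / (2 * α + 1))).ne'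
  calc _ = (H ^ (2 * α / (2 * α + 1)) * H ^ (1 / (2 * α + 1))) *
        ((α / (α + 1)) ^ (2 * α / (2 * α + 1)) * (α / (α + 1)) ^ (1 / (2 * α + 1))) *
        ((Q * (2 * α + 1)) ^ (1 / (2 * α + 1)) * ((α / (α + 1)) ^ (1 / (2 * α + 1)))⁻¹ *
          ((θ ^ 2) ^ (1 / (2 * α + 1)))⁻¹ * (H ^ (1 / (2 * α + 1)))⁻¹ *
          (Real.pi ^ (2 * α / (2 * α + 1)))⁻¹) := by
        rw [← hrep H hH, ← hrep _ hx]
    _ = _ := by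
        generalize (α / (α + 1)) ^ (1 / (2 * α + 1)) = u at *
        generalize H ^ (1 / (2 * α + 1)) = v at *
        field_simp

theorem pinsker_pos {α Q : ℝ} (hα : 0 < α) (hQ : 0 < Q) : 0 < pinsker α Q := by
  have := Real.pi_pos
  unfold pinsker
  positivity

/-! ### The lower bound for large samples -/

/-- The standard deviations of the least favourable prior, up to normalization. -/
def spread (α N V : ℝ) (n L l : ℕ) : ℝ := √(((N / (L + l : ℕ)) ^ α - 1) / (n * V))

/-! ### Size and risk contribution of the Pinsker standard deviations. -/

section Spread

variable {α N V J ε : ℝ} {n L l : ℕ}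

theorem spread_sq (hα : 0 < α) (hV : 0 < V) (hn : 1 ≤ n) (hL : 1 ≤ L) (hl : ((L + l : ℕ) : ℝ) < N) :
    0 < spread α N V n L l ∧
      spread α N V n L l ^ 2 = ((N / (L + l : ℕ)) ^ α - 1) / (n * V) := by
  have hn0 : (0 : ℝ) < n := by exact_mod_cast hn
  have hj : (0 : ℝ) < (L + l : ℕ) := by
    have : 0 < L + l := by omega
    exact_mod_cast this
  have h1 : 0 < ((N / (L + l : ℕ)) ^ α - 1) / (n * V) :=
    div_pos (sub_pos.2 (Real.one_lt_rpow ((one_lt_div hj).2 hl) hα)) (by positivity)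
  exact ⟨Real.sqrt_pos.2 h1, Real.sq_sqrt h1.le⟩

/-- Starting at frequency εN keeps N/j ≤ 1/ε, so all deviations are uniformly of order n^{-1/2}.
This is why the lowest frequencies are left out of the prior. -/
theorem spread_le (hα : 0 < α) (hV : 0 < V) (hn : 1 ≤ n) (hε : 0 < ε) (hN : 0 < N)
    (hL : 1 ≤ L) (hL2 : ε * N ≤ L) :
    spread α N V n L l ≤ √(ε⁻¹ ^ α / V) * (√n)⁻¹ := by
  have hn0 : (0 : ℝ) < n := by exact_mod_cast hn
  have hj : (0 : ℝ) < (L + l : ℕ) := by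
    have : 0 < L + l := by omega
    exact_mod_cast this
  rw [← Real.sqrt_inv, ← Real.sqrt_mul (by positivity)]
  refine Real.sqrt_le_sqrt ?_
  have h1 : N / (L + l : ℕ) ≤ ε⁻¹ := by
    rw [div_le_iff₀ hj, ← div_eq_inv_mul, le_div_iff₀ hε, mul_comm]
    exact hL2.trans (by push_cast; linarith [(Nat.cast_nonneg l : (0 : ℝ) ≤ l)])
  have h2 : (N / (L + l : ℕ)) ^ α - 1 ≤ ε⁻¹ ^ α :=
    (sub_le_self _ zero_le_one).trans (Real.rpow_le_rpow (by positivity) h1 hα.le)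
  rw [div_mul_eq_mul_div, ← div_eq_mul_inv, div_div]
  exact div_le_div_of_nonneg_right h2 (by positivity)

/-- With y = (N/j)^α one has J/r² = nVJ/(y-1) ≤ n(1+ε)/(y-1), so the denominator is at most
n(1+ε)·y/(y-1). Its inverse contains Pinsker's shrinkage factor 1 - (j/N)^α. -/
theorem le_inv_add_div_spread_sq (hα : 0 < α) (hV : 0 < V) (hn : 1 ≤ n) (hε : 0 < ε)
    (hVJ : V * J ≤ 1 + ε) (hL : 1 ≤ L) (hl : ((L + l : ℕ) : ℝ) < N) (hJ : 0 ≤ J) :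
    (1 + ε)⁻¹ * (n : ℝ)⁻¹ * (1 - ((L + l : ℕ) / N) ^ α) ≤
      (n * (1 + ε) + J / spread α N V n L l ^ 2)⁻¹ := by
  have hn0 : (0 : ℝ) < n := by exact_mod_cast hn
  have hj : (0 : ℝ) < (L + l : ℕ) := by
    have : 0 < L + l := by omega
    exact_mod_cast this
  have hN : 0 < N := hj.trans hl
  obtain ⟨h0, h1⟩ := spread_sq hα hV hn hL hl
  have hy : 1 < (N / (L + l : ℕ)) ^ α := Real.one_lt_rpow ((one_lt_div hj).2 hl) hα
  have e1 : ((L + l : ℕ) / N) ^ α = ((N / (L + l : ℕ)) ^ α)⁻¹ := by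
    rw [← Real.inv_rpow (by positivity), inv_div]
  rw [h1, e1]
  generalize (N / (L + l : ℕ)) ^ α = y at *
  have hy1 : 0 < y - 1 := sub_pos.2 hy
  have hy0 : 0 < y := by linarith
  have e2 : (1 + ε)⁻¹ * (n : ℝ)⁻¹ * (1 - y⁻¹) = (n * (1 + ε) * (1 + 1 / (y - 1)))⁻¹ := by
    have : 1 + 1 / (y - 1) = y / (y - 1) := by
      field_simp
      ring
    rw [this]
    field_simp
  rw [e2]
  refine inv_anti₀ (by positivity) ?_
  have e3 : J / ((y - 1) / (n * V)) = n * (V * J) * (1 / (y - 1)) := by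
    field_simp
  have h2 : n * (V * J) * (1 / (y - 1)) ≤ n * (1 + ε) * (1 / (y - 1)) := by gcongr
  rw [e3]
  linarith

end Spread

/-! ### The lower bound with all parameters expressed through N and n. -/

section Large

variable {D : ℕ} {m : Model} {p : ℝ × (Fin D → ℝ) → ℝ} {g : (Fin D → ℝ) → ℝ} {f₀ : ℝ → ℝ}
  {Pb C c c' Hb : ℝ} {h : ℝ → ℝ} {K M : ℕ} {d : ℤ → ℝ}

theorem sobolevWeight_le_of_le {α N : ℝ} (hα : 0 ≤ α) (hN : 1 ≤ N) {j : ℕ} (hj : (j : ℝ) ≤ 2 * N) :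
    sobolevWeight α j ≤ (1 + (2 * Real.pi) ^ (2 * α)) * N ^ (2 * α) := by
  have hpi := Real.pi_pos
  unfold sobolevWeight
  rw [add_mul, one_mul, ← Real.mul_rpow (by positivity) (by linarith)]
  refine add_le_add (Real.one_le_rpow hN (by positivity)) ?_
  refine Real.rpow_le_rpow (by positivity) ?_ (by positivity)
  nlinarith

/-- Bookkeeping for the exceptional set: x stands for n, y for N^{2α}, W for the largest Sobolev
weight, A for the absolute sum of d, and G for the squared gap. A single energy term is of order
N^{2α}/n, that is 1/N, and there are at most 2N of them, so the Chebyshev term is O(1/N). -/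
theorem error_le {N x κ b b₀ A k k' W w y G t T : ℝ} (hN0 : 0 < N) (hx : 0 < x) (hb₀ : 0 < b₀)
    (hb2 : b ^ 2 = b₀ * x⁻¹) (hk0 : 0 < k) (hk0' : 0 ≤ k') (hk' : k' ≤ 2 * N) (hk : k ≤ 2 * N)
    (hW0 : 0 ≤ W) (hW : W ≤ w * y) (hy : y * x⁻¹ = κ * N⁻¹)
    (hHb : 0 < Hb) (hT : 0 ≤ T) (hG : 0 ≤ G) :
    10 * (k' * (b * A) ^ 2) * (k' * T * (W * (b * A) ^ 2) ^ 2 / G +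
      (x + 1) * (2 * Real.exp (-(t / 2) ^ 2 / (2 * (k * (b * (Hb * √2)) ^ 2))))) ≤
    10 * (2 * N * (b₀ * A ^ 2 * x⁻¹)) * (2 * T * (w * κ * (b₀ * A ^ 2)) ^ 2 / G * N⁻¹ +
      (x + 1) * (2 * Real.exp (-(t / 2) ^ 2 / (8 * b₀ * Hb ^ 2 * N * x⁻¹)))) := by
  have hbA : (b * A) ^ 2 = b₀ * A ^ 2 * x⁻¹ := by
    rw [mul_pow, hb2]
    ring
  have hWb : W * (b * A) ^ 2 ≤ w * κ * (b₀ * A ^ 2) * N⁻¹ := by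
    rw [hbA]
    refine (mul_le_mul_of_nonneg_right hW (by positivity)).trans_eq ?_
    linear_combination (w * (b₀ * A ^ 2)) * hy
  have h1 : k' * T * (W * (b * A) ^ 2) ^ 2 / G ≤ 2 * T * (w * κ * (b₀ * A ^ 2)) ^ 2 / G * N⁻¹ := by
    rw [div_mul_eq_mul_div]
    refine div_le_div_of_nonneg_right ?_ hG
    calc k' * T * (W * (b * A) ^ 2) ^ 2 ≤ 2 * N * T * (w * κ * (b₀ * A ^ 2) * N⁻¹) ^ 2 := by gcongr
      _ = 2 * T * (w * κ * (b₀ * A ^ 2)) ^ 2 * N⁻¹ := by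
        field_simp
  have h2 : Real.exp (-(t / 2) ^ 2 / (2 * (k * (b * (Hb * √2)) ^ 2))) ≤
      Real.exp (-(t / 2) ^ 2 / (8 * b₀ * Hb ^ 2 * N * x⁻¹)) := by
    have e1 : (b * (Hb * √2)) ^ 2 = b₀ * x⁻¹ * (Hb ^ 2 * 2) := by
      rw [mul_pow b, mul_pow, hb2, Real.sq_sqrt (by norm_num)]
    have h3 : 2 * (k * (b₀ * x⁻¹ * (Hb ^ 2 * 2))) ≤ 8 * b₀ * Hb ^ 2 * N * x⁻¹ := by
      calc _ ≤ 2 * (2 * N * (b₀ * x⁻¹ * (Hb ^ 2 * 2))) := by gcongr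
        _ = _ := by ring
    rw [e1, Real.exp_le_exp, neg_div, neg_div, neg_le_neg_iff]
    exact div_le_div_of_nonneg_left (sq_nonneg _) (by positivity) h3
  rw [hbA] at h1 ⊢
  have h0 : 0 ≤ 10 * (2 * N * (b₀ * A ^ 2 * x⁻¹)) := by positivity
  have h4 : 10 * (k' * (b₀ * A ^ 2 * x⁻¹)) ≤ 10 * (2 * N * (b₀ * A ^ 2 * x⁻¹)) := by gcongr
  have h5 : 0 ≤ 2 * T * (w * κ * (b₀ * A ^ 2)) ^ 2 / G * N⁻¹ := by positivity
  calc _ ≤ 10 * (k' * (b₀ * A ^ 2 * x⁻¹)) * (2 * T * (w * κ * (b₀ * A ^ 2)) ^ 2 / G * N⁻¹ +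
      (x + 1) * (2 * Real.exp (-(t / 2) ^ 2 / (8 * b₀ * Hb ^ 2 * N * x⁻¹)))) := by
        refine mul_le_mul_of_nonneg_left (add_le_add h1 ?_) (by positivity)
        gcongr
    _ ≤ _ := mul_le_mul_of_nonneg_right h4 (by positivity)

theorem IsMultiplier.le_minimaxMISE_of_large (hd : IsMultiplier h K d) {q τ : ℝ → ℝ} {V J : ℝ}
    (hq : IsPrior q τ V J) (hh : Continuous h) (hHb : 0 < Hb) (hH : ∀ x, |h x| ≤ Hb)
    (hp : IsDesignDensity p) (hpb : ∀ w ∈ cube D, |p w| ≤ Pb)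
    (hg : Measurable g) (hf₀ : Measurable f₀) (hc : 0 < c) (hc' : c' < 1) (hC0 : 0 ≤ C)
    (hC : ∀ t, m.Between c c' t → 0 < m.variance t ∧ (m.variance t)⁻¹ ≤ C)
    (hLip : ∀ s t, m.Between c c' s → m.Between c c' t →
      |(m.variance s)⁻¹ - (m.variance t)⁻¹| ≤ C * |s - t|)
    (hpivot : ∀ w ∈ cube D, m.Between c c' (f₀ w.1 + g w.2))
    (hS : IntegrableOn (fun x => |lowFreq f₀ M x - f₀ x|) (Icc (0 : ℝ) 1))
    {α Q ε N κ t U H : ℝ} {ρ : ℝ≥0∞} {n : ℕ} (hα : 0 < α) (hQ : 0 < Q) (hε : 0 < ε)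
    (hε1 : ε ≤ 1 / 2) (hVJ : V * J ≤ 1 + ε) (hHdef : ∫ x in (0 : ℝ)..1, h x ^ 2 = H) (hH0 : 0 < H)
    (hκ : κ = Q * (α + 1) * (2 * α + 1) / ((1 + ε) ^ 2 * H * Real.pi ^ (2 * α) * α))
    (hn : 1 ≤ n) (hN : N ^ (2 * α + 1) = κ * n) (hN1 : 4 + 2 * K ≤ N) (hεN : 1 ≤ ε * N)
    (hM : M ≤ ε * N)
    (hU : 2 * N * (√(ε⁻¹ ^ α / V) * (√n)⁻¹ * (Hb * √2)) ≤ U)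
    (hlow : ∀ u, |u| ≤ U → ∀ w ∈ cube D, m.Between c c' (lowFreq f₀ M w.1 + u + g w.2))
    (hδ : 2 * Hb ^ 2 * ((∫ x in Icc (0 : ℝ) 1, |m.info p g f₀ x * h x ^ 2 - 1|) +
      Hb ^ 2 * (Pb * C) * ((∫ x in Icc (0 : ℝ) 1, |lowFreq f₀ M x - f₀ x|) + U)) ≤ ε * H)
    (henergy : ∑ j ∈ Finset.Ico ⌈ε * N⌉₊ ⌈N⌉₊, ((N / j) ^ α - 1) * sobolevWeight α (j + 2 * K) ≤
      (1 + ε) * (Real.pi ^ (2 * α) * (α / ((α + 1) * (2 * α + 1)))) * N ^ (2 * α + 1))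
    (hrisk : (α / (α + 1) - 2 * ε) * N ≤
      ∑ j ∈ Finset.Ico ⌈ε * N⌉₊ ⌈N⌉₊, (1 - ((j : ℝ) / N) ^ α))
    (ht : 0 ≤ t)
    (hgrid : 16 * √(ε⁻¹ ^ α / V) * absSum K d * √2 * Real.pi * N ^ 2 * ((√n)⁻¹ * (n : ℝ)⁻¹) ≤ t)
    (hρ : ENNReal.ofReal t < ρ) :
    ENNReal.ofReal (H * ((1 + ε)⁻¹ * (n : ℝ)⁻¹ * ((α / (α + 1) - 2 * ε) * N))) ≤
      m.minimaxMISE p g (family f₀ ρ M α Q ∩ m.bonaFide g) n +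
      ENNReal.ofReal (10 * (2 * N * ((ε⁻¹ ^ α / V) * absSum K d ^ 2 * (n : ℝ)⁻¹)) *
        (2 * (2 * (2 * K : ℕ) + 1) * ((1 + (2 * Real.pi) ^ (2 * α)) * κ *
          ((ε⁻¹ ^ α / V) * absSum K d ^ 2)) ^ 2 / (Q - Q / (1 + ε)) ^ 2 * N⁻¹ +
        (n + 1) * (2 * Real.exp (-(t / 2) ^ 2 /
          (8 * (ε⁻¹ ^ α / V) * Hb ^ 2 * N * (n : ℝ)⁻¹))))) := by
  have hn0 : (0 : ℝ) < n := by exact_mod_cast hn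
  have hK0 : (0 : ℝ) ≤ K := Nat.cast_nonneg K
  have hN0 : 0 < N := by linarith
  have hV := hq.var_pos
  have hJ := hq.info_nonneg
  have hpi := Real.pi_pos
  have hA := absSum_nonneg K d
  have hκ0 : 0 < κ := by
    rw [hκ]
    positivity
  set A := absSum K d with hAdef
  set b₀ := ε⁻¹ ^ α / V with hb₀
  have hb₀0 : 0 < b₀ := by positivity
  -- The prior starts above the frequencies fixed by the family, since M ≤ εN, and ends just below
  -- N.
  set L := ⌈ε * N⌉₊ with hLdef
  set k := ⌈N⌉₊ - L with hkdef
  set b := √b₀ * (√n)⁻¹ with hbdef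
  have hb0 : 0 ≤ b := by positivity
  have hb2 : b ^ 2 = b₀ * (n : ℝ)⁻¹ := by
    rw [hbdef, mul_pow, Real.sq_sqrt hb₀0.le, inv_pow, Real.sq_sqrt hn0.le]
  have hL1 : 1 ≤ L := Nat.one_le_ceil_iff.2 (by linarith)
  have hL2 : ε * N ≤ L := Nat.le_ceil _
  have hL3 : (L : ℝ) < ε * N + 1 := Nat.ceil_lt_add_one (by positivity)
  have hm1 : N ≤ ⌈N⌉₊ := Nat.le_ceil _
  have hm2 : (⌈N⌉₊ : ℝ) < N + 1 := Nat.ceil_lt_add_one hN0.le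
  have hLm : L < ⌈N⌉₊ := by
    have : (L : ℝ) < ⌈N⌉₊ := by nlinarith
    exact_mod_cast this
  have hk1 : 1 ≤ k := by omega
  have hk2 : ((L + (k + 2 * K) : ℕ) : ℝ) ≤ 2 * N := by
    have : L + (k + 2 * K) = ⌈N⌉₊ + 2 * K := by omega
    rw [this]
    push_cast
    linarith
  have hk3 : ((k + 2 * K : ℕ) : ℝ) ≤ 2 * N := by
    push_cast at hk2 ⊢
    linarith [(Nat.cast_nonneg L : (0 : ℝ) ≤ L)]
  have hk4 : (k : ℝ) ≤ 2 * N := by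
    push_cast at hk3
    linarith
  have hk0 : (0 : ℝ) < k := by exact_mod_cast hk1
  have hlt : ∀ l < k, ((L + l : ℕ) : ℝ) < N := fun l hl => Nat.lt_ceil.1 (by omega)
  have hM' : M ≤ L := by
    have : (M : ℝ) ≤ L := hM.trans hL2
    exact_mod_cast this
  have hU' : (k : ℝ) * (b * (Hb * √2)) ≤ U := by
    refine le_trans ?_ hU
    gcongr
  -- The definition of κ contains (1+ε)²: one factor absorbs the slack in the energy sum, and the
  -- other leaves mean energy Q/(1+ε), strictly below Q as Chebyshev requires.
  have hμ : V * ((∫ x in (0 : ℝ)..1, h x ^ 2) * ∑ l ∈ Finset.range k,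
      spread α N V n L l ^ 2 * sobolevWeight α (L + (l + 2 * K))) ≤ Q / (1 + ε) := by
    rw [hHdef]
    have h1 : ∑ l ∈ Finset.range k, spread α N V n L l ^ 2 * sobolevWeight α (L + (l + 2 * K)) =
        (n * V)⁻¹ * ∑ j ∈ Finset.Ico L ⌈N⌉₊,
          ((N / j) ^ α - 1) * sobolevWeight α (j + 2 * K) := by
      rw [Finset.sum_Ico_eq_sum_range, Finset.mul_sum]
      refine Finset.sum_congr rfl fun l hl => ?_
      rw [(spread_sq hα hV hn hL1 (hlt l (Finset.mem_range.1 hl))).2, add_assoc]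
      ring
    rw [h1]
    have h2 := mul_le_mul_of_nonneg_left henergy (by positivity : 0 ≤ V * (H * (n * V)⁻¹))
    refine le_trans (le_of_eq (by ring)) (h2.trans_eq ?_)
    rw [hN, hκ]
    field_simp
  have hQμ : Q / (1 + ε) < Q := div_lt_self hQ (by linarith)
  have hcore := hd.le_minimaxMISE_add (k := k) (b := b) (r := spread α N V n L) hq hL1 hM' hb0
    (fun l hl => (spread_sq hα hV hn hL1 (hlt l hl)).1)
    (fun l _ => spread_le hα hV hn hε hN0 hL1 hL2) hh hH hp hpb hg hf₀ hc hc' hC0 hC hLip hpivot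
    (fun u hu => hlow u (hu.trans hU')) hS hε.le
    (by
      rw [hHdef]
      refine le_trans ?_ hδ
      have : 0 ≤ Pb := by
        refine (abs_nonneg (p (0, 0))).trans (hpb _ ?_)
        exact ⟨by simp, by simp⟩
      gcongr)
    hα.le hμ hQμ hn ht
    (by
      have h1 : ((k + 2 * K : ℕ) : ℝ) * ((b * A) * (√2 * (Real.pi * (L + (k + 2 * K) : ℕ) *
          (n : ℝ)⁻¹))) ≤ 2 * N * ((b * A) * (√2 * (Real.pi * (2 * N) * (n : ℝ)⁻¹))) := by
        gcongr
      refine h1.trans ?_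
      have h2 : 2 * N * ((b * A) * (√2 * (Real.pi * (2 * N) * (n : ℝ)⁻¹))) =
          (16 * √b₀ * A * √2 * Real.pi * N ^ 2 * ((√n)⁻¹ * (n : ℝ)⁻¹)) / 4 := by
        rw [hbdef]
        ring
      rw [h2]
      linarith)
    hρ
  refine le_trans (ENNReal.ofReal_le_ofReal ?_) (hcore.trans ?_)
  · rw [hHdef]
    refine mul_le_mul_of_nonneg_left ?_ hH0.le
    refine (mul_le_mul_of_nonneg_left hrisk (by positivity)).trans ?_
    rw [Finset.sum_Ico_eq_sum_range, Finset.mul_sum]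
    exact Finset.sum_le_sum fun l hl =>
      le_inv_add_div_spread_sq hα hV hn hε hVJ hL1 (hlt l (Finset.mem_range.1 hl)) hJ
  · refine add_le_add le_rfl (ENNReal.ofReal_le_ofReal ?_)
    have hNα : N ^ (2 * α) * (n : ℝ)⁻¹ = κ * N⁻¹ := by
      rw [Real.rpow_add hN0, Real.rpow_one] at hN
      field_simp
      linarith
    exact error_le hN0 hn0 hb₀0 hb2 hk0 (Nat.cast_nonneg _) hk3 hk4 (sobolevWeight_nonneg _ _)
      (sobolevWeight_le_of_le hα.le (by linarith : 1 ≤ N) hk2) hNα hHb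
      (by positivity) (sq_nonneg _)

end Large

/-! ### The asymptotic lower bound -/

section Asymptotic

theorem Model.Between.mono {m : Model} {c c' a a' t : ℝ} (h : m.Between c c' t) (hc : a ≤ c)
    (hc' : c' ≤ a') : m.Between a a' t :=
  ⟨hc.trans h.1, fun hm => (h.2 hm).trans hc'⟩

theorem Model.Between.add {m : Model} {c c' t u γ : ℝ} (h : m.Between c c' t) (hu : |u| ≤ γ) :
    m.Between (c - γ) (c' + γ) (t + u) := by
  rw [abs_le] at hu
  exact ⟨by linarith [h.1], fun hm => by linarith [h.2 hm]⟩

/-- The losses multiply: 1 - ε from H against d, (1 - ε)² from the energy slack, 1 - ε from the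
information, and 1 - 4ε from the risk sum because a ≥ 1/2. Their product is at least 1 - 8ε. -/
theorem constant_le {τ H d ε s γ a ν : ℝ} (hτ : 0 < τ) (hd : 0 < d) (hε : 0 < ε) (hε1 : ε ≤ 1 / 8)
    (hH : (1 - ε) * d ≤ H) (hs : 0 ≤ s) (hs1 : s ≤ 1) (hγ1 : γ ≤ 1 / 3)
    (ha : 1 / 2 ≤ a) (h : H * a * ν = τ * H ^ s * ((1 + ε) ^ 2) ^ (-γ)) :
    (1 - 8 * ε) * (τ * d ^ s) ≤ H * ((1 + ε)⁻¹ * ((a - 2 * ε) * ν)) := by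
  have hH0 : 0 < H := lt_of_lt_of_le (mul_pos (by linarith) hd) hH
  have h1 : (1 - ε) * d ^ s ≤ H ^ s := by
    have h2 : (1 - ε) ^ (1 : ℝ) ≤ (1 - ε) ^ s :=
      Real.rpow_le_rpow_of_exponent_ge (by linarith) (by linarith) hs1
    rw [Real.rpow_one] at h2
    calc (1 - ε) * d ^ s ≤ (1 - ε) ^ s * d ^ s := by gcongr
      _ = ((1 - ε) * d) ^ s := (Real.mul_rpow (by linarith) hd.le).symm
      _ ≤ H ^ s := Real.rpow_le_rpow (mul_nonneg (by linarith) hd.le) hH hs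
  have hinv : 1 - ε ≤ (1 + ε)⁻¹ := by
    rw [← one_div, le_div_iff₀ (by linarith)]
    nlinarith
  have h3 : (1 - ε) ^ 2 ≤ ((1 + ε) ^ 2) ^ (-γ) := by
    have h4 : ((1 + ε) ^ 2) ^ (-1 : ℝ) ≤ ((1 + ε) ^ 2) ^ (-γ) :=
      Real.rpow_le_rpow_of_exponent_le (by nlinarith) (by linarith)
    refine le_trans ?_ h4
    rw [Real.rpow_neg_one, ← inv_pow]
    exact pow_le_pow_left₀ (by linarith) hinv 2
  have h5 : 1 - 4 * ε ≤ (a - 2 * ε) / a := by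
    rw [le_div_iff₀ (by linarith)]
    nlinarith
  have e1 : H * ((1 + ε)⁻¹ * ((a - 2 * ε) * ν)) =
      (1 + ε)⁻¹ * ((a - 2 * ε) / a) * (τ * H ^ s * ((1 + ε) ^ 2) ^ (-γ)) := by
    rw [← h]
    have : a ≠ 0 := by linarith
    field_simp
  rw [e1]
  have hds : 0 < d ^ s := Real.rpow_pos_of_pos hd s
  have h6 : τ * ((1 - ε) * d ^ s) * (1 - ε) ^ 2 ≤ τ * H ^ s * ((1 + ε) ^ 2) ^ (-γ) := by
    gcongr
  have h7 : (1 - ε) * (1 - 4 * ε) ≤ (1 + ε)⁻¹ * ((a - 2 * ε) / a) :=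
    mul_le_mul hinv h5 (by linarith) (by positivity)
  have h8 : 0 ≤ τ * ((1 - ε) * d ^ s) * (1 - ε) ^ 2 := by
    have : 0 < 1 - ε := by linarith
    positivity
  have h9 : (1 - ε) * (1 - 4 * ε) * (τ * ((1 - ε) * d ^ s) * (1 - ε) ^ 2) ≤
      (1 + ε)⁻¹ * ((a - 2 * ε) / a) * (τ * H ^ s * ((1 + ε) ^ 2) ^ (-γ)) :=
    mul_le_mul h7 h6 h8 (le_trans (mul_nonneg (by linarith) (by linarith)) h7)
  refine le_trans ?_ h9
  have e2 : (1 - ε) * (1 - 4 * ε) * (τ * ((1 - ε) * d ^ s) * (1 - ε) ^ 2) =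
      ((1 - ε) ^ 4 * (1 - 4 * ε)) * (τ * d ^ s) := by ring
  rw [e2]
  refine mul_le_mul_of_nonneg_right ?_ (by positivity)
  have h10 : 1 - 4 * ε ≤ (1 - ε) ^ 4 := by
    have := one_add_mul_le_pow (a := -ε) (by linarith) 4
    push_cast at this
    rw [← sub_eq_add_neg] at this
    linarith
  calc 1 - 8 * ε ≤ (1 - 4 * ε) * (1 - 4 * ε) := by nlinarith
    _ ≤ (1 - ε) ^ 4 * (1 - 4 * ε) := mul_le_mul_of_nonneg_right h10 (by linarith)

theorem integral_one_div_pos {I : ℝ → ℝ} (hI : Measurable I) {a A : ℝ} (ha : 0 < a)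
    (hIb : ∀ x ∈ Icc (0 : ℝ) 1, a ≤ I x ∧ I x ≤ A) : 0 < ∫ x in (0 : ℝ)..1, 1 / I x := by
  have hA : 0 < A := ha.trans_le ((hIb 0 (by simp)).1.trans (hIb 0 (by simp)).2)
  have hI1 : IntegrableOn (fun x => 1 / I x) (Icc (0 : ℝ) 1) := by
    refine Integrable.of_bound (by fun_prop : Measurable fun x => 1 / I x).aestronglyMeasurable
      a⁻¹ ((ae_restrict_iff' measurableSet_Icc).2 (ae_of_all _ fun x hx => ?_))
    rw [one_div, Real.norm_eq_abs, abs_of_pos (inv_pos.2 (ha.trans_le (hIb x hx).1))]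
    exact inv_anti₀ ha (hIb x hx).1
  have h1 := setIntegral_mono_on (integrable_const (1 / A)) hI1 measurableSet_Icc fun x hx =>
    one_div_le_one_div_of_le (ha.trans_le (hIb x hx).1) (hIb x hx).2
  rw [setIntegral_Icc_eq (fun x => 1 / I x)] at h1
  have h2 : 0 < 1 / A := by positivity
  simp only [integral_const, smul_eq_mul, probReal_univ, one_mul] at h1
  linarith

variable {D : ℕ} {m : Model} {p : ℝ × (Fin D → ℝ) → ℝ} {g : (Fin D → ℝ) → ℝ} {f₀ : ℝ → ℝ}
  {α Q : ℝ} {M : ℕ → ℕ} {ρ : ℕ → ℝ≥0∞} {Clow Cup : ℝ}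

set_option maxHeartbeats 1000000 in
theorem eventually_ofReal_le_minimaxMISE (hα : 1 ≤ α) (hQ : 0 < Q) (hg : Measurable g)
    (hf₀ : Measurable f₀) (hf₀b : ∃ B : ℝ, ∀ x ∈ Icc (0 : ℝ) 1, |f₀ x| ≤ B)
    (hClow : 0 < Clow) (hCup : Cup < 1) (hpivot : m.MeanBounds Clow Cup f₀ g)
    (hscale : m.ScaleAssumption p g f₀)
    (hM : ∀ᶠ n : ℕ in atTop, (M n : ℝ) < (n : ℝ) ^ (1 / (2 * α + 1)) / Real.log n ^ 2)
    (hMtop : Tendsto M atTop atTop)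
    (hρ : ∀ᶠ n : ℕ in atTop,
      ENNReal.ofReal ((n : ℝ) ^ (-(1 / (2 * α + 1))) * Real.log n) < ρ n)
    (hlow : ∃ c c' : ℝ, 0 < c ∧ c' < 1 ∧
      ∀ᶠ n : ℕ in atTop, m.MeanBounds c c' (lowFreq f₀ (M n)) g) {η : ℝ} (hη : 0 < η)
    (hη1 : η < 1) :
    ∀ᶠ n : ℕ in atTop, ENNReal.ofReal ((1 - η) *
      (pinsker α Q * (m.difficulty p g f₀ * (n : ℝ)⁻¹) ^ (2 * α / (2 * α + 1)))) ≤
      m.minimaxMISE p g (family f₀ (ρ n) (M n) α Q ∩ m.bonaFide g) n := by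
  have hα0 : 0 < α := by linarith
  have hpi := Real.pi_pos
  obtain ⟨Pb, a, A, hPb, ha, hpb, hIb⟩ := hscale.exists_bounds hg
  have hIm := Model.measurable_info (m := m) hscale.density.measurable hg hf₀
  obtain ⟨Hb, hHb, hP⟩ := exists_cosPoly_sq_near_inv hIm ha hIb
  have hdd := integral_one_div_pos hIm ha hIb
  change 0 < m.difficulty p g f₀ at hdd
  set dd := m.difficulty p g f₀ with hdddef
  obtain ⟨B, hB⟩ := hf₀b
  obtain ⟨c₀, c₀', hc₀, hc₀', hlow⟩ := hlow
  -- constants for the regularity of the submodel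
  set cm := min c₀ Clow with hcm
  set cM := max c₀' Cup with hcM
  have hcm0 : 0 < cm := lt_min hc₀ hClow
  have hcM1 : cM < 1 := max_lt hc₀' hCup
  -- Perturbations up to γ₀ use at most half of the room left by the pivot and by its low-frequency
  -- part.
  set γ₀ := min (cm / 2) ((1 - cM) / 2) with hγ₀
  have hγ₀0 : 0 < γ₀ := lt_min (by linarith) (by linarith)
  have hγ₀1 : γ₀ ≤ cm / 2 := min_le_left _ _
  have hγ₀2 : γ₀ ≤ (1 - cM) / 2 := min_le_right _ _
  obtain ⟨C, hC0, hC, hLip⟩ := m.exists_inv_variance_lipschitz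
    (c := cm - γ₀) (c' := cM + γ₀) (by linarith) (by linarith)
  -- the prior and the multiplier
  set ε := η / 16 with hε
  have hε0 : 0 < ε := by positivity
  have hε1 : ε ≤ 1 / 16 := by linarith
  obtain ⟨q, τ, V, J, hq, hVJ⟩ := exists_isPrior hε0
  have hV := hq.var_pos
  -- The first bound makes ∫h² at least (1 - ε) times the difficulty, the second controls the
  -- information at the pivot.
  set ε₁ := min (ε * dd) (ε * dd / (8 * Hb ^ 2)) with hε₁
  have hε₁0 : 0 < ε₁ := lt_min (by positivity) (by positivity)
  obtain ⟨P, hPH, hP1, hP2⟩ := hP ε₁ hε₁0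
  change dd - ε₁ ≤ _ at hP2
  obtain ⟨K, d, hd⟩ := exists_isMultiplier P
  set H := ∫ x in (0 : ℝ)..1, cosPoly P x ^ 2 with hHdef
  have hH1 : (1 - ε) * dd ≤ H := by linarith [min_le_left (ε * dd) (ε * dd / (8 * Hb ^ 2))]
  have hH2 : dd / 2 ≤ H := by
    have h1 : (1 - 1 / 2) * dd ≤ (1 - ε) * dd := by
      gcongr
      linarith only [hε1]
    linarith only [h1, hH1]
  have hH0 : 0 < H := by linarith
  set γ := 1 / (2 * α + 1) with hγ
  have hγ1 : γ ≤ 1 / 3 := one_div_two_mul_add_one_le hα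
  set s := 2 * α / (2 * α + 1) with hs
  have hs0 : 0 ≤ s := by positivity
  have hsγ : s + γ = 1 := by
    rw [hs, hγ, ← add_div, div_self (by linarith)]
  have hs1 : s ≤ 1 := by
    have : 0 < γ := by positivity
    linarith only [this, hsγ]
  set κ := Q * (α + 1) * (2 * α + 1) / ((1 + ε) ^ 2 * H * Real.pi ^ (2 * α) * α) with hκ
  have hκ0 : 0 < κ := by positivity
  set N : ℕ → ℝ := fun n => (κ * n) ^ γ with hN
  have hNtop : Tendsto N atTop atTop := tendsto_rate_atTop hα0 hκ0
  set b₀ := ε⁻¹ ^ α / V with hb₀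
  have hb₀0 : 0 < b₀ := by positivity
  set τ₀ := pinsker α Q * dd ^ s with hτ₀
  have hpk := pinsker_pos hα0 hQ
  have hτ₀0 : 0 < τ₀ := by positivity
  -- the perturbation of the information
  set ζ := ε * dd / (16 * Hb ^ 4 * (Pb * C)) with hζ
  have hζ0 : 0 < ζ := by positivity
  have hU : Tendsto (fun n : ℕ => 2 * N n * (√b₀ * (√n)⁻¹ * (Hb * √2))) atTop (𝓝 0) := by
    have h1 := (tendsto_rate_mul_inv_sqrt hα hκ0).const_mul (2 * √b₀ * (Hb * √2))
    rw [mul_zero] at h1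
    exact h1.congr fun n => by ring
  -- the error term
  set w := (1 + (2 * Real.pi) ^ (2 * α)) * κ * (b₀ * absSum K d ^ 2) with hw
  -- This bounds the prior mass outside the family. Its factor in the risk is of order N/n, hence
  -- n^{-s}, so E → 0 is sufficient.
  set E : ℕ → ℝ := fun n => 2 * (2 * (2 * K : ℕ) + 1) * w ^ 2 / (Q - Q / (1 + ε)) ^ 2 * (N n)⁻¹ +
    (n + 1) * (2 * Real.exp (-((n : ℝ) ^ (-γ) * Real.log n / 2) ^ 2 /
      (8 * b₀ * Hb ^ 2 * N n * (n : ℝ)⁻¹))) with hE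
  have hEt : Tendsto (fun n => 10 * (2 * (b₀ * absSum K d ^ 2)) * κ ^ γ * E n) atTop (𝓝 0) := by
    have h1 := (hNtop.inv_tendsto_atTop).const_mul
      (2 * (2 * (2 * K : ℕ) + 1) * w ^ 2 / (Q - Q / (1 + ε)) ^ 2)
    have h2 := h1.add (tendsto_exp_grid hα hκ0 (C := 8 * b₀ * Hb ^ 2) (by positivity))
    rw [mul_zero, zero_add] at h2
    have h3 := h2.const_mul (10 * (2 * (b₀ * absSum K d ^ 2)) * κ ^ γ)
    rw [mul_zero] at h3
    exact h3
  filter_upwards [eventually_ge_atTop 1,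
    hNtop.eventually (eventually_energy_le (α := α) (ε := ε) (θ := 1 + ε) hα0 hε0 (by linarith)
      (2 * K)),
    hNtop.eventually (eventually_le_risk (α := α) (ε := ε) hα0 hε0),
    hNtop.eventually_ge_atTop (4 + 2 * K), hNtop.eventually_ge_atTop ε⁻¹, hM,
    eventually_lowFreq_cutoff (γ := γ) hκ0 hε0, hρ, hlow,
    hU.eventually_le_const (lt_min hγ₀0 hζ0),
    hMtop.eventually (tendsto_integral_abs_lowFreq_sub hf₀ hB hζ0),
    eventually_grid_le hα hκ0 (16 * √b₀ * absSum K d * √2 * Real.pi),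
    hEt.eventually_le_const (by positivity : 0 < τ₀ * (η / 2))]
    with n hn henergy hrisk hN1 hN2 hMn hcut hρn hlown hUn hfn hgrid hEn
  have hn0 : (0 : ℝ) < n := by exact_mod_cast hn
  have hN0 : 0 < N n := by linarith [(Nat.cast_nonneg K : (0 : ℝ) ≤ K)]
  have hNpow : N n ^ (2 * α + 1) = κ * n := by
    simp only [hN]
    rw [← Real.rpow_mul (by positivity), hγ, one_div_mul_cancel (by linarith), Real.rpow_one]
  have hNn : N n * (n : ℝ)⁻¹ = κ ^ γ * (n : ℝ) ^ (-s) := by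
    simp only [hN]
    rw [Real.mul_rpow hκ0.le hn0.le, mul_assoc, ← Real.rpow_neg_one, ← Real.rpow_add hn0]
    congr 2
    linarith
  have hlowB : ∀ w ∈ cube D, m.Between cm cM (lowFreq f₀ (M n) w.1 + g w.2) := fun w hw =>
    Model.Between.mono (hlown w.1 hw.1 w.2 hw.2) (min_le_left _ _) (le_max_left _ _)
  have hpivB : ∀ w ∈ cube D, m.Between (cm - γ₀) (cM + γ₀) (f₀ w.1 + g w.2) := fun w hw =>
    Model.Between.mono (hpivot w.1 hw.1 w.2 hw.2) (by linarith [min_le_right c₀ Clow])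
      (by linarith [le_max_right c₀' Cup])
  have hS : IntegrableOn (fun x => |lowFreq f₀ (M n) x - f₀ x|) (Icc (0 : ℝ) 1) := by
    refine (integrable_fun_sub (Continuous.integrableOn_Icc (by fun_prop)) ?_).abs
    exact Integrable.of_bound hf₀.aestronglyMeasurable _
      ((ae_restrict_iff' measurableSet_Icc).2 (ae_of_all _ hB))
  have hmain := hd.le_minimaxMISE_of_large hq (by fun_prop) hHb hPH hscale.density hpb hg hf₀
    (by linarith : 0 < cm - γ₀) (by linarith : cM + γ₀ < 1) hC0.le hC hLip hpivB (M := M n) hS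
    (α := α) (Q := Q) (ε := ε) (N := N n) (κ := κ) (t := (n : ℝ) ^ (-γ) * Real.log n)
    (U := min γ₀ ζ) (H := H) (ρ := ρ n) (n := n) hα0 hQ hε0 (by linarith) hVJ rfl hH0 hκ hn
    hNpow hN1
    ((inv_le_iff_one_le_mul₀' hε0).1 hN2) (hMn.le.trans hcut) hUn
    (fun u hu w hw => by
      rw [add_right_comm]
      exact (hlowB w hw).add (hu.trans (min_le_left _ _)))
    (by
      -- The allowed relative error ε of the information is shared: one half goes to the polynomial
      -- h, the other to the low-frequency error and the perturbation, each at most ζ. The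
      -- definitions of ε₁ and ζ make each half at most ε·dd/4, and dd/2 ≤ H.
      have h1 : 2 * Hb ^ 2 * ε₁ ≤ ε * dd / 4 := by
        refine (mul_le_mul_of_nonneg_left (min_le_right _ _) (by positivity)).trans_eq ?_
        field_simp
        norm_num
      have h2 : 2 * Hb ^ 2 * (Hb ^ 2 * (Pb * C) * (ζ + ζ)) = ε * dd / 4 := by
        rw [hζ]
        field_simp
        norm_num
      have h3 : 2 * Hb ^ 2 * ((∫ x in Icc (0 : ℝ) 1, |m.info p g f₀ x * cosPoly P x ^ 2 - 1|) +
          Hb ^ 2 * (Pb * C) * ((∫ x in Icc (0 : ℝ) 1, |lowFreq f₀ (M n) x - f₀ x|) +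
            min γ₀ ζ)) ≤ 2 * Hb ^ 2 * (ε₁ + Hb ^ 2 * (Pb * C) * (ζ + ζ)) := by
        gcongr
        exact min_le_right _ _
      have h4 : ε * (dd / 2) ≤ ε * H := mul_le_mul_of_nonneg_left hH2 hε0.le
      rw [mul_add] at h3
      linarith only [h1, h2, h3, h4])
    henergy hrisk (mul_nonneg (by positivity) (Real.log_natCast_nonneg n)) hgrid hρn
  -- Since ε = η/16, the multiplicative losses 8ε amount to η/2; the other η/2 is spent on the
  -- exceptional set.
  have hval : (1 - η / 2) * τ₀ * (n : ℝ) ^ (-s) ≤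
      H * ((1 + ε)⁻¹ * (n : ℝ)⁻¹ * ((α / (α + 1) - 2 * ε) * N n)) := by
    have h1 := constant_le (τ := pinsker α Q) (H := H) (d := dd) (ε := ε) (s := s) (γ := γ)
      (a := α / (α + 1)) (ν := κ ^ γ) hpk hdd hε0 (by linarith) hH1 hs0 hs1 hγ1
      (by rw [div_le_div_iff₀ (by norm_num) (by linarith)]; linarith)
      (difficulty_mul_rate hα0 hQ hH0 (by linarith))
    have h2 : (1 - 8 * ε) = 1 - η / 2 := by
      rw [hε]
      ring
    rw [h2] at h1
    have h3 := mul_le_mul_of_nonneg_right h1 (Real.rpow_nonneg hn0.le (-s))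
    refine h3.trans_eq ?_
    linear_combination (-(H * ((1 + ε)⁻¹ * (α / (α + 1) - 2 * ε)))) * hNn
  have herr : 10 * (2 * N n * (b₀ * absSum K d ^ 2 * (n : ℝ)⁻¹)) * E n ≤
      η / 2 * τ₀ * (n : ℝ) ^ (-s) := by
    have h1 : 10 * (2 * N n * (b₀ * absSum K d ^ 2 * (n : ℝ)⁻¹)) * E n =
        10 * (2 * (b₀ * absSum K d ^ 2)) * κ ^ γ * E n * (n : ℝ) ^ (-s) := by
      linear_combination (10 * (2 * (b₀ * absSum K d ^ 2)) * E n) * hNn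
    rw [h1]
    refine (mul_le_mul_of_nonneg_right hEn (Real.rpow_nonneg hn0.le (-s))).trans_eq ?_
    ring
  have htarget : (1 - η) * (pinsker α Q * (dd * (n : ℝ)⁻¹) ^ s) =
      (1 - η) * τ₀ * (n : ℝ) ^ (-s) := by
    rw [Real.mul_rpow hdd.le (by positivity), Real.inv_rpow hn0.le, ← Real.rpow_neg hn0.le, hτ₀]
    ring
  rw [htarget]
  rw [← tsub_le_iff_right] at hmain
  refine le_trans ?_ hmain
  rw [← ENNReal.ofReal_sub _ (by
    have := absSum_nonneg K d
    positivity)]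
  refine ENNReal.ofReal_le_ofReal ?_
  simp only [hE, hw] at herr
  linarith only [hval, herr]

end Asymptotic

/-- A sequence of extended nonnegative numbers which is eventually above every multiple `1 - η` of
a positive sequence is asymptotically at least this sequence. -/
theorem exists_tendsto_zero_of_eventually_le {T : ℕ → ℝ} {R : ℕ → ℝ≥0∞}
    (hT : ∀ n, 1 ≤ n → 0 < T n)
    (h : ∀ η : ℝ, 0 < η → η < 1 → ∀ᶠ n in atTop, ENNReal.ofReal ((1 - η) * T n) ≤ R n) :
    ∃ o : ℕ → ℝ, Tendsto o atTop (𝓝 0) ∧ ∀ n, 1 ≤ n → ENNReal.ofReal (T n * (1 + o n)) ≤ R n := by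
  classical
  -- Only the negative part of the relative error is kept, as R may be much larger than T. An
  -- infinite R is treated apart because `toReal` would send it to 0.
  refine ⟨fun n => if R n = ∞ then 0 else min 0 ((R n).toReal / T n - 1), ?_, fun n hn => ?_⟩
  · rw [Metric.tendsto_nhds]
    intro ε hε
    have h1 := h (min (ε / 2) (1 / 2)) (lt_min (by linarith) (by norm_num))
      ((min_le_right _ _).trans_lt (by norm_num))
    filter_upwards [h1, eventually_ge_atTop 1] with n hn hn1
    have hTn := hT n hn1
    rw [Real.dist_eq, sub_zero]
    split_ifs with hR
    · simpa using hε
    · have h2 : (1 - min (ε / 2) (1 / 2)) * T n ≤ (R n).toReal :=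
        (ENNReal.ofReal_le_iff_le_toReal hR).1 hn
      have h3 : 1 - min (ε / 2) (1 / 2) ≤ (R n).toReal / T n := (le_div_iff₀ hTn).2 h2
      have h4 : min (ε / 2) (1 / 2) ≤ ε / 2 := min_le_left _ _
      have h5 : -(ε / 2) ≤ min 0 ((R n).toReal / T n - 1) := le_min (by linarith) (by linarith)
      rw [abs_of_nonpos (min_le_left _ _)]
      linarith
  · have hTn := hT n hn
    simp only
    split_ifs with hR
    · rw [hR]
      exact le_top
    · rw [ENNReal.ofReal_le_iff_le_toReal hR]
      have h1 : min 0 ((R n).toReal / T n - 1) ≤ (R n).toReal / T n - 1 := min_le_right _ _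
      calc T n * (1 + min 0 ((R n).toReal / T n - 1)) ≤ T n * ((R n).toReal / T n) :=
            mul_le_mul_of_nonneg_left (by linarith) hTn.le
        _ = (R n).toReal := by field_simp

theorem Model.ScaleAssumption.difficulty_pos {D : ℕ} {m : Model} {p : ℝ × (Fin D → ℝ) → ℝ}
    {g : (Fin D → ℝ) → ℝ} {f : ℝ → ℝ} (h : m.ScaleAssumption p g f) (hg : Measurable g)
    (hf : Measurable f) : 0 < m.difficulty p g f := by
  obtain ⟨Pb, a, A, -, ha, -, hI⟩ := h.exists_bounds hg
  exact integral_one_div_pos (Model.measurable_info h.density.measurable hg hf) ha hI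

end SharpMinimax

end

theorem theorem2p2 (m : Model) (D : ℕ)
    (p : ℝ × (Fin D → ℝ) → ℝ) (g : (Fin D → ℝ) → ℝ) (f₀ : ℝ → ℝ)
    (α Q : ℝ) (M : ℕ → ℕ) (ρ : ℕ → ℝ≥0∞) (Clow Cup : ℝ)
    (hα : 1 ≤ α) (hQ : 0 < Q)
    -- the nuisance component
    (hg : Measurable g) (hg0 : ∫ z in Icc (0 : Fin D → ℝ) 1, g z = 0)
    -- the pivot
    (hf₀ : Measurable f₀) (hf₀b : ∃ B : ℝ, ∀ x ∈ Icc (0 : ℝ) 1, |f₀ x| ≤ B)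
    (hClow : 0 < Clow) (hCup : Cup < 1) (hpivot : m.MeanBounds Clow Cup f₀ g)
    -- the design density and the scale at the pivot
    (hscale : m.ScaleAssumption p g f₀)
    -- the sequences of the family
    (hM : ∀ᶠ n : ℕ in atTop, (M n : ℝ) < (n : ℝ) ^ (1 / (2 * α + 1)) / Real.log n ^ 2)
    (hMtop : Tendsto M atTop atTop)
    (hρ : ∀ᶠ n : ℕ in atTop,
      ENNReal.ofReal ((n : ℝ) ^ (-(1 / (2 * α + 1))) * Real.log n) < ρ n)
    -- the low-frequency part of the pivot stays away from the boundary of the admissible means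
    (hlow : ∃ c c' : ℝ, 0 < c ∧ c' < 1 ∧
      ∀ᶠ n : ℕ in atTop, m.MeanBounds c c' (lowFreq f₀ (M n)) g) :
    ∃ o : ℕ → ℝ, Tendsto o atTop (𝓝 0) ∧ ∀ n : ℕ, 1 ≤ n →
      ENNReal.ofReal
          (pinsker α Q * (m.difficulty p g f₀ * (n : ℝ)⁻¹) ^ (2 * α / (2 * α + 1)) * (1 + o n)) ≤
        m.minimaxMISE p g (family f₀ (ρ n) (M n) α Q ∩ m.bonaFide g) n := by
  have hdiff := hscale.difficulty_pos hg hf₀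
  have hpk := pinsker_pos (by linarith : 0 < α) hQ
  refine exists_tendsto_zero_of_eventually_le (fun n hn => ?_) fun η hη hη1 =>
    eventually_ofReal_le_minimaxMISE hα hQ hg hf₀ hf₀b hClow hCup hpivot hscale hM hMtop hρ hlow
      hη hη1
  have hn0 : (0 : ℝ) < n := by exact_mod_cast hn
  positivity
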